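/- **Languages and logic.** Derivability $\vdash$ is in classical first-order logic with equality; $\neg,\wedge,\to,\forall$ are primitive and $\vee,\exists,\leftrightarrow$ are defined. $\mathcal L_{FS}$ has the constants $\mathsf k,\mathsf s,\mathsf p,\mathsf p_0,\mathsf p_1,\mathsf 0,\mathsf s_{\mathsf N},\mathsf p_{\mathsf N},\mathsf d_{\mathsf N}$ and $\dot=,\dot\neg,\dot\wedge,\dot\to,\dot\forall,\dot{\mathsf N},\mathsf l$, a binary application function (written $st$, associating to the left), and the unary predicates $\mathrm N,\mathrm T,\mathrm U$. Put $(x,y):=\mathsf pxy$, $(x)_i:=\mathsf p_ix$, $x\mathbin{\dot\circ}y:=\dot\circ(x,y)$ for $\circ\in\{=,\wedge,\to\}$, $\mathrm P(x):=\mathrm T(x)\vee\mathrm T(\dot\neg x)$ and $\mathrm C(f):=\forall x\,\mathrm P(fx)$. **The theory $\mathsf{KFUPI}$** has (the universal closures of) the following axioms. 1. $\mathsf{TON}$: $\mathsf kab=a$; $\mathsf sabc=ac(bc)$; $((a,b))_0=a\wedge((a,b))_1=b$; $\mathrm N(\mathsf 0)\wedge\forall x(\mathrm N(x)\to\mathrm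 N(\mathsf s_{\mathsf N}x))$; $\mathrm N(x)\to\mathsf s_{\mathsf N}x\ne\mathsf 0\wedge\mathsf p_{\mathsf N}(\mathsf s_{\mathsf N}x)=x$; $\mathrm N(x)\wedge x\neq\mathsf 0\to\mathrm N(\mathsf p_{\mathsf N}x)\wedge\mathsf s_{\mathsf N}(\mathsf p_{\mathsf N}x)=x$; $\mathrm N(a)\wedge\mathrm N(b)\wedge a=b\to\mathsf d_{\mathsf N}uvab=u$; $\mathrm N(a)\wedge\mathrm N(b)\wedge a\ne b\to\mathsf d_{\mathsf N}uvab=v$; and induction $A(\mathsf 0)\wedge\forall x(\mathrm N(x)\wedge A(x)\to A(\mathsf s_{\mathsf N}x))\to\forall x(\mathrm N(x)\to A(x))$ for all $\mathcal L_{FS}$-formulas $A$. 2. For every $u$ with $\mathrm U(u)$ and all $x,y,f$, writing $\mathrm T_u(t)$ for $\mathrm T(ut)$: $\mathrm T_u(x\dot=y)\leftrightarrow x=y$; $\mathrm T_u(\dot\neg(x\dot=y))\leftrightarrow x\ne y$; $\mathrm T_u(\dot{\mathsf N}x)\leftrightarrow\mathrm N(x)$; $\mathrm T_u(\dot\neg(\dot{\mathsf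 N}x))\leftrightarrow\neg\mathrm N(x)$; $\mathrm T_u(\dot\neg\dot\neg x)\leftrightarrow\mathrm T_u(x)$; $\mathrm T_u(x\dot\wedge y)\leftrightarrow\mathrm T_u(x)\wedge\mathrm T_u(y)$; $\mathrm T_u(\dot\neg(x\dot\wedge y))\leftrightarrow\mathrm T_u(\dot\neg x)\vee\mathrm T_u(\dot\neg y)$; $\mathrm T_u(x\dot\to y)\leftrightarrow\mathrm T_u(\dot\neg x)\vee\mathrm T_u(y)$; $\mathrm T_u(\dot\neg(x\dot\to y))\leftrightarrow\mathrm T_u(x)\wedge\mathrm T_u(\dot\neg y)$; $\mathrm T_u(\dot\forall f)\leftrightarrow\forall x\,\mathrm T_u(fx)$; $\mathrm T_u(\dot\neg(\dot\forall f))\leftrightarrow\exists x\,\mathrm T_u(\dot\neg(fx))$; $\neg(\mathrm T_u(x)\wedge\mathrm T_u(\dot\neg x))$; $\mathrm C(u)$; $\mathrm T_u(x)\to\mathrm T(x)$. Moreover $\mathrm C(f)\to\mathrm U(\mathsf lf)\wedge\forall x(\mathrm T(fx)\to\mathrm T(\mathsf lf(fx)))\wedge\forall x(\mathrm T(\dot\neg(fx))\to\mathrm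 T(\mathsf lf(\dot\neg(fx))))$. 3. Unique decomposition $(\mathsf{UG})$, for $c,d\in\{\dot=,\dot\neg,\dot\wedge,\dot\to,\dot\forall,\dot{\mathsf N},\mathsf l\}$: $c\ne d$ and $ca\ne db$ if $c,d$ are different constants; $c\ne da$; $ca=cb\to a=b$; $\mathsf lab\ne c$; $\mathsf lab\ne ce$; $\mathsf lab=\mathsf la'b'\to a=a'\wedge b=b'$. 4. Proposition induction: $\forall x(\mathscr A(B,x)\to B(x))\to\forall x(\mathrm P(x)\to B(x))$ for all $\mathcal L_{FS}$-formulas $B$ (possibly with parameters), where $\mathscr A(B,x)$ is the disjunction of: $\exists y,z\;x=(y\dot=z)$; $\exists y\;x=\dot{\mathsf N}y$; $\exists y(x=\dot\neg y\wedge B(y))$; $\exists y,z(x=y\dot\wedge z\wedge\{[B(y)\wedge B(z)]\vee[B(y)\wedge\mathrm T(\dot\neg y)]\vee[B(z)\wedge\mathrm T(\dot\neg z)]\})$; $\exists y,z(x=y\dot\to z\wedge\{[B(y)\wedge B(z)]\vee[B(y)\wedge\mathrm T(\dot\neg y)]\vee[B(z)\wedge\mathrm T(z)]\})$; $\exists g(x=\dot\forall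 g\wedge\{\forall y\,B(gy)\vee\exists y(B(gy)\wedge\mathrm T(\dot\neg(gy)))\})$; $\exists f,y(x=\mathsf lfy\wedge\forall z\,B(fz))$. **The theory $\mathsf{FID}([\mathsf{POS},\mathsf{QF}])$.** Let $\mathcal L'$ be the language of arithmetic with a symbol for each primitive recursive function definition. An operator form is an $\mathcal L'$-formula with an additional unary predicate $X$ and at most one free variable; it is in $\mathsf{POS}$ if $X$ occurs only positively in it, and in $\mathsf{QF}$ if it has no quantifiers. For operator forms $\mathfrak A_0,\mathfrak A_1$ put $\mathfrak A(X,u):=\mathfrak A_0(X,u)\vee([\forall x(\mathfrak A_0(X,x)\to x\in X)]\wedge\mathfrak A_1(X,u))$. The two-sorted language $\mathcal L_{\mathcal K}$ extends $\mathcal L'$ by ordinal variables, $<$ and $=$ on ordinals, and a binary predicate $\mathrm P^\alpha_{\mathfrak A}(s)$ (with $\alpha$ an ordinal and $s$ a number). Put $\mathrm P^{<\alpha}_{\mathfrak A}(s):=\exists\xi<\alpha\,\mathrm P^\xi_{\mathfrak A}(s)$ and $\mathrm P_{\mathfrak A}(s):=\exists\alpha\,\mathrm P^\alpha_{\mathfrak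 A}(s)$. The axioms of $\mathsf{FID}([\mathsf{POS},\mathsf{QF}])$ are: Peano arithmetic with the defining equations of all primitive recursive function symbols and induction for all $\mathcal L_{\mathcal K}$-formulas; $<$ is a strict linear order on the ordinals; $\mathrm P^\alpha_{\mathfrak A}(s)\leftrightarrow\mathrm P^{<\alpha}_{\mathfrak A}(s)\vee\mathfrak A(\mathrm P^{<\alpha}_{\mathfrak A},s)$; $\mathfrak A(\mathrm P_{\mathfrak A},s)\to\mathrm P_{\mathfrak A}(s)$; and $\forall\xi[(\forall\eta<\xi\,A(\eta))\to A(\xi)]\to\forall\xi\,A(\xi)$ for all $\mathcal L_{\mathcal K}$-formulas $A$. This is used for the following $\mathfrak A_0,\mathfrak A_1$. **The coded term model.** Closed $\mathcal L_{FS}$-terms are coded bijectively by natural numbers: the $16$ constants by $0,\dots,15$, and $st$ by $16+\langle\ulcorner s\urcorner,\ulcorner t\urcorner\rangle$, where $\langle m,n\rangle=\frac{(m+n)(m+n+1)}2+n$. Number variables are thus read as variables for closed terms, application stands for the primitive recursive function $(\ulcorner s\urcorner,\ulcorner t\urcorner)\mapsto\ulcorner st\urcorner$, and constants stand for their codes.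 Let $\mathrm{Red}$ be the $\mathcal L'$-formula (quantifying over coded finite derivations) for the least reflexive transitive relation compatible with application that contains $\mathsf kab\to a$, $\mathsf sabc\to ac(bc)$, $\mathsf p_0(\mathsf pab)\to a$, $\mathsf p_1(\mathsf pab)\to b$, $\mathsf p_{\mathsf N}(\mathsf s_{\mathsf N}a)\to a$, $\mathsf d_{\mathsf N}ab\,\overline n\,\overline n\to a$, and $\mathsf d_{\mathsf N}ab\,\overline m\,\overline n\to b$ for $m\neq n$, where $\overline n$ is the $n$-fold application of $\mathsf s_{\mathsf N}$ to $\mathsf 0$. Put $x=^\star y:\Leftrightarrow\exists z(\mathrm{Red}(x,z)\wedge\mathrm{Red}(y,z))$ and $\mathrm N^\star(x):\Leftrightarrow\exists n\,\mathrm{Red}(x,\overline n)$. **The operator forms.** $\mathfrak A_0(X,a)$ is the disjunction of: $\exists b,c(a=^\star(b\dot=c)\wedge b=^\star c)$; $\exists b,c(a=^\star\dot\neg(b\dot=c)\wedge\neg\,b=^\star c)$; $\exists b(a=^\star\dot{\mathsf N}b\wedge\mathrm N^\star(b))$; $\exists b(a=^\star\dot\neg(\dot{\mathsf N}b)\wedge\neg\mathrm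 N^\star(b))$; $\exists b(a=^\star\dot\neg(\dot\neg b)\wedge b\in X)$; $\exists b,c(a=^\star(b\dot\wedge c)\wedge b\in X\wedge c\in X)$; $\exists b,c(a=^\star\dot\neg(b\dot\wedge c)\wedge[\dot\neg b\in X\vee\dot\neg c\in X])$; $\exists b,c(a=^\star(b\dot\to c)\wedge[\dot\neg b\in X\vee c\in X])$; $\exists b,c(a=^\star\dot\neg(b\dot\to c)\wedge b\in X\wedge\dot\neg c\in X)$; $\exists f(a=^\star\dot\forall f\wedge\forall b\;fb\in X)$; $\exists f(a=^\star\dot\neg(\dot\forall f)\wedge\exists b\;\dot\neg(fb)\in X)$; $\exists f(a=^\star\mathsf lf(\mathsf 0\dot=\mathsf 0)\wedge\forall b[fb\in X\vee\dot\neg(fb)\in X])$; $\exists b(a=^\star b\wedge b\in X)$. $\mathfrak A_1(X,a)$ is the quantifier-free formula, written with the primitive recursive decoding functions for applications, which says that for some $f,b$ with $\mathsf lf(\mathsf 0\dot=\mathsf 0)\in X$ and $\mathsf lf(\dot{\mathsf N}\mathsf 0)\notin X$, either $a$ is the code of $\mathsf lfb$ and $b\in X$, or $a$ is the code of $\dot\neg(\mathsf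 lfb)$ and $b\notin X$. (Here identity is identity of codes.) **The translation ${}^\star$** from $\mathcal L_{FS}$ to $\mathcal L_{\mathcal K}$ interprets application, constants, $=$ and $\mathrm N$ as above, and commutes with $\neg,\wedge,\to,\forall$, individual variables becoming number variables. Moreover $\mathrm T^\star(t):=\mathrm P_{\mathfrak A}(t)$ and $\mathrm U^\star(u):=\exists f(u=^\star\mathsf lf\wedge\forall x[\mathrm P_{\mathfrak A}(fx)\vee\mathrm P_{\mathfrak A}(\dot\neg(fx))])$. **Lemma.** $\mathfrak A_0\in\mathsf{POS}$ and $\mathfrak A_1\in\mathsf{QF}$, and for every $\mathcal L_{FS}$-formula $A$: if $\mathsf{KFUPI}\vdash A$, then $\mathsf{FID}([\mathsf{POS},\mathsf{QF}])\vdash A^\star$. -/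

import Mathlib

/-! ## The first-order language of Frege structures -/

/-- The individual constants: combinators, pairing and projections, zero, successor, predecessor,
numerical case distinction; then the dotted constants and the universe generator `l`. -/
inductive FConst : Type
  | k | s | p | p0 | p1 | zero | sN | pN | dN
  | eqd | negd | andd | impd | alld | natd | l
  deriving DecidableEq

/-- Terms of the language; variables are numbered (de Bruijn style in formulas). -/
inductive FTerm : Type
  | var (i : ℕ)
  | const (c : FConst)
  | app (s t : FTerm)

namespace FTerm

def subst (σ : ℕ → FTerm) : FTerm → FTerm
  | var i => σ i
  | const c => const c
  | app s t => app (s.subst σ) (t.subst σ)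

/-- The substitution `σ` pushed under one quantifier. -/
def up (σ : ℕ → FTerm) : ℕ → FTerm
  | 0 => var 0
  | i + 1 => (σ i).subst (fun j => var (j + 1))

def app2 (r s t : FTerm) : FTerm := app (app r s) t
def pair (s t : FTerm) : FTerm := app2 (const .p) s t
def dEq (s t : FTerm) : FTerm := app (const .eqd) (pair s t)
def dNeg (s : FTerm) : FTerm := app (const .negd) s
def dAnd (s t : FTerm) : FTerm := app (const .andd) (pair s t)
def dImp (s t : FTerm) : FTerm := app (const .impd) (pair s t)
def dAll (s : FTerm) : FTerm := app (const .alld) s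
def dNat (s : FTerm) : FTerm := app (const .natd) s

end FTerm

/-- Formulas with atoms `s = t`, `N t`, `T t`, `U t`; `all` binds the variable `0` and shifts the
others, i.e. inside `all A` the variable `i + 1` is the outer variable `i`. -/
inductive FForm : Type
  | eq (s t : FTerm)
  | nat (t : FTerm)
  | tr (t : FTerm)
  | univ (t : FTerm)
  | neg (A : FForm)
  | and (A B : FForm)
  | imp (A B : FForm)
  | all (A : FForm)

namespace FForm
open FTerm

def or (A B : FForm) : FForm := neg (and (neg A) (neg B))
def iff (A B : FForm) : FForm := and (imp A B) (imp B A)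
def ex (A : FForm) : FForm := neg (all (neg A))
def ne (s t : FTerm) : FForm := neg (eq s t)

/-- Capture-avoiding simultaneous substitution. -/
def subst (σ : ℕ → FTerm) : FForm → FForm
  | eq s t => eq (s.subst σ) (t.subst σ)
  | nat t => nat (t.subst σ)
  | tr t => tr (t.subst σ)
  | univ t => univ (t.subst σ)
  | neg A => neg (A.subst σ)
  | and A B => and (A.subst σ) (B.subst σ)
  | imp A B => imp (A.subst σ) (B.subst σ)
  | all A => all (A.subst (up σ))

/-- `A(t)`, where `A` has the distinguished variable `0` and the parameters `1, 2, …`, in a context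
in which the `i`-th parameter is the variable `i + m`. -/
def at' (A : FForm) (m : ℕ) (t : FTerm) : FForm :=
  A.subst (fun i => match i with
    | 0 => t
    | i + 1 => var (i + m))

def shift (A : FForm) : FForm := A.subst (fun i => var (i + 1))

/-- `P(t)`: `t` is a proposition. -/
def prop (t : FTerm) : FForm := or (tr t) (tr (dNeg t))

/-- `C(f)`: `f` is a class, where `f` is the variable with index `i`. -/
def cls (i : ℕ) : FForm := all (prop (app (var (i + 1)) (var 0)))

end FForm

/-- Derivability from the non-logical axioms `T` in classical first-order logic with equality
(Hilbert-style; free variables of axioms are read universally, by generalization). -/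
inductive FProv (T : FForm → Prop) : FForm → Prop
  | ax {A} : T A → FProv T A
  | mp {A B} : FProv T (.imp A B) → FProv T A → FProv T B
  | gen {A} : FProv T A → FProv T (.all A)
  | imp_k (A B) : FProv T (.imp A (.imp B A))
  | imp_s (A B C) : FProv T (.imp (.imp A (.imp B C)) (.imp (.imp A B) (.imp A C)))
  | contra (A B) : FProv T (.imp (.imp (.neg A) (.neg B)) (.imp B A))
  | and_left (A B) : FProv T (.imp (.and A B) A)
  | and_right (A B) : FProv T (.imp (.and A B) B)
  | and_intro (A B) : FProv T (.imp A (.imp B (.and A B)))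
  | all_elim (A : FForm) (t) : FProv T (.imp (.all A) (A.at' 0 t))
  | all_distr (A B : FForm) : FProv T (.imp (.all (.imp A.shift B)) (.imp A (.all B)))
  | eq_refl (t) : FProv T (.eq t t)
  | eq_subst (A : FForm) (s t) : FProv T (.imp (.eq s t) (.imp (A.at' 0 s) (A.at' 0 t)))

/-! ## The theory KFUPI -/

section KFUPI
open FTerm FForm

/-- Axioms of the total applicative theory, with induction for all formulas of the language. -/
inductive TON : FForm → Prop
  | k : TON (eq (app2 (const .k) (var 0) (var 1)) (var 0))
  | s : TON (eq (app (app2 (const .s) (var 0) (var 1)) (var 2))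
      (app (app (var 0) (var 2)) (app (var 1) (var 2))))
  | pair : TON (and (eq (app (const .p0) (FTerm.pair (var 0) (var 1))) (var 0))
      (eq (app (const .p1) (FTerm.pair (var 0) (var 1))) (var 1)))
  | nat_zero_succ : TON (and (nat (const .zero))
      (all (imp (nat (var 0)) (nat (app (const .sN) (var 0))))))
  | succ : TON (all (imp (nat (var 0))
      (and (ne (app (const .sN) (var 0)) (const .zero))
        (eq (app (const .pN) (app (const .sN) (var 0))) (var 0)))))
  | pred : TON (all (imp (and (nat (var 0)) (ne (var 0) (const .zero)))
      (and (nat (app (const .pN) (var 0)))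
        (eq (app (const .sN) (app (const .pN) (var 0))) (var 0)))))
  | cases_eq : TON (imp (and (nat (var 0)) (and (nat (var 1)) (eq (var 0) (var 1))))
      (eq (app2 (app2 (const .dN) (var 2) (var 3)) (var 0) (var 1)) (var 2)))
  | cases_ne : TON (imp (and (nat (var 0)) (and (nat (var 1)) (ne (var 0) (var 1))))
      (eq (app2 (app2 (const .dN) (var 2) (var 3)) (var 0) (var 1)) (var 3)))
  | ind (A : FForm) : TON (imp
      (and (A.at' 0 (const .zero))
        (all (imp (and (nat (var 0)) A) (A.at' 1 (app (const .sN) (var 0))))))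
      (all (imp (nat (var 0)) A)))

/-- `T(u t)` for the variable `u` with index `i`. -/
def trU (i : ℕ) (t : FTerm) : FForm := tr (app (var i) t)

/-- `g` reflects on `f`, where `f` is the variable `i` and `g` is given (under one quantifier). -/
def reflects (i : ℕ) (g : FTerm) : FForm :=
  and (all (imp (tr (app (var (i + 1)) (var 0))) (tr (app g (app (var (i + 1)) (var 0))))))
    (all (imp (tr (dNeg (app (var (i + 1)) (var 0))))
      (tr (app g (dNeg (app (var (i + 1)) (var 0)))))))

/-- The axioms of KFU beyond those of TON; the variable `0` is the universe `u` (or, in `lim`, the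
class `f`). -/
inductive KFUAx : FForm → Prop
  | u_eq : KFUAx (imp (univ (var 0)) (all (all
      (iff (trU 2 (dEq (var 1) (var 0))) (eq (var 1) (var 0))))))
  | u_neg_eq : KFUAx (imp (univ (var 0)) (all (all
      (iff (trU 2 (dNeg (dEq (var 1) (var 0)))) (ne (var 1) (var 0))))))
  | u_nat : KFUAx (imp (univ (var 0)) (all
      (iff (trU 1 (dNat (var 0))) (nat (var 0)))))
  | u_neg_nat : KFUAx (imp (univ (var 0)) (all
      (iff (trU 1 (dNeg (dNat (var 0)))) (neg (nat (var 0))))))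
  | u_neg_neg : KFUAx (imp (univ (var 0)) (all
      (iff (trU 1 (dNeg (dNeg (var 0)))) (trU 1 (var 0)))))
  | u_and : KFUAx (imp (univ (var 0)) (all (all
      (iff (trU 2 (dAnd (var 1) (var 0))) (and (trU 2 (var 1)) (trU 2 (var 0)))))))
  | u_neg_and : KFUAx (imp (univ (var 0)) (all (all
      (iff (trU 2 (dNeg (dAnd (var 1) (var 0))))
        (or (trU 2 (dNeg (var 1))) (trU 2 (dNeg (var 0))))))))
  | u_imp : KFUAx (imp (univ (var 0)) (all (all
      (iff (trU 2 (dImp (var 1) (var 0))) (or (trU 2 (dNeg (var 1))) (trU 2 (var 0)))))))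
  | u_neg_imp : KFUAx (imp (univ (var 0)) (all (all
      (iff (trU 2 (dNeg (dImp (var 1) (var 0))))
        (and (trU 2 (var 1)) (trU 2 (dNeg (var 0))))))))
  | u_all : KFUAx (imp (univ (var 0)) (all
      (iff (trU 1 (dAll (var 0))) (all (trU 2 (app (var 1) (var 0)))))))
  | u_neg_all : KFUAx (imp (univ (var 0)) (all
      (iff (trU 1 (dNeg (dAll (var 0)))) (ex (trU 2 (dNeg (app (var 1) (var 0))))))))
  | u_cons : KFUAx (imp (univ (var 0)) (all
      (neg (and (trU 1 (var 0)) (trU 1 (dNeg (var 0)))))))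
  | u_class : KFUAx (imp (univ (var 0)) (cls 0))
  | u_true : KFUAx (imp (univ (var 0)) (all (imp (trU 1 (var 0)) (tr (var 0)))))
  | lim : KFUAx (imp (cls 0) (and (univ (app (const .l) (var 0)))
      (reflects 0 (app (const .l) (var 1)))))

/-- The constants whose applications decompose uniquely. -/
def FConst.IsDotted : FConst → Prop
  | .eqd | .negd | .andd | .impd | .alld | .natd | .l => True
  | _ => False

/-- Unique decomposition: objects of the shapes `c`, `c a` (for the constants above) and `l a b`
have only one such presentation. -/
inductive UG : FForm → Prop
  | ne (c d : FConst) : c.IsDotted → d.IsDotted → c ≠ d → UG (FForm.ne (const c) (const d))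
  | ne_app (c d : FConst) : c.IsDotted → d.IsDotted →
      UG (FForm.ne (const c) (app (const d) (var 0)))
  | app_ne_app (c d : FConst) : c.IsDotted → d.IsDotted → c ≠ d →
      UG (FForm.ne (app (const c) (var 0)) (app (const d) (var 1)))
  | app_inj (c : FConst) : c.IsDotted →
      UG (imp (eq (app (const c) (var 0)) (app (const c) (var 1))) (eq (var 0) (var 1)))
  | l_ne (c : FConst) : c.IsDotted →
      UG (FForm.ne (app2 (const .l) (var 0) (var 1)) (const c))
  | l_ne_app (c : FConst) : c.IsDotted →
      UG (FForm.ne (app2 (const .l) (var 0) (var 1)) (app (const c) (var 2)))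
  | l_inj : UG (imp (eq (app2 (const .l) (var 0) (var 1)) (app2 (const .l) (var 2) (var 3)))
      (and (eq (var 0) (var 2)) (eq (var 1) (var 3))))

/-- The operator `𝒜(B, x)` of proposition induction, where `x` is the variable `0` and the `i`-th
parameter of `B` is the variable `i + 1`. -/
def propOp (B : FForm) : FForm :=
  or (ex (ex (eq (var 2) (dEq (var 1) (var 0))))) <|
  or (ex (eq (var 1) (dNat (var 0)))) <|
  or (ex (and (eq (var 1) (dNeg (var 0))) (B.at' 2 (var 0)))) <|
  or (ex (ex (and (eq (var 2) (dAnd (var 1) (var 0)))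
      (or (and (B.at' 3 (var 1)) (B.at' 3 (var 0)))
        (or (and (B.at' 3 (var 1)) (tr (dNeg (var 1))))
          (and (B.at' 3 (var 0)) (tr (dNeg (var 0))))))))) <|
  or (ex (ex (and (eq (var 2) (dImp (var 1) (var 0)))
      (or (and (B.at' 3 (var 1)) (B.at' 3 (var 0)))
        (or (and (B.at' 3 (var 1)) (tr (dNeg (var 1))))
          (and (B.at' 3 (var 0)) (tr (var 0)))))))) <|
  or (ex (and (eq (var 1) (dAll (var 0)))
      (or (all (B.at' 3 (app (var 1) (var 0))))
        (ex (and (B.at' 3 (app (var 1) (var 0))) (tr (dNeg (app (var 1) (var 0)))))))))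
  (ex (ex (and (eq (var 2) (app2 (const .l) (var 1) (var 0)))
      (all (B.at' 4 (app (var 2) (var 0)))))))

/-- The non-logical axioms of KFUPI. -/
inductive KFUPI : FForm → Prop
  | ton {A} : TON A → KFUPI A
  | kfu {A} : KFUAx A → KFUPI A
  | ug {A} : UG A → KFUPI A
  | pi (B : FForm) : KFUPI (imp (all (imp (propOp B) B)) (all (imp (prop (var 0)) B)))

end KFUPI

/-! ## Arithmetic with symbols for the primitive recursive functions -/

/-- Symbols for `n`-ary primitive recursive functions, one for each definition scheme. -/
inductive PR : ℕ → Type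
  | zero : PR 0
  | succ : PR 1
  | proj {n : ℕ} (i : Fin n) : PR n
  | comp {m n : ℕ} (f : PR m) (g : Fin m → PR n) : PR n
  | prec {n : ℕ} (f : PR n) (g : PR (n + 2)) : PR (n + 1)

namespace PR

/-- The function denoted by a symbol. -/
def eval : {n : ℕ} → PR n → (Fin n → ℕ) → ℕ
  | _, zero, _ => 0
  | _, succ, v => v 0 + 1
  | _, proj i, v => v i
  | _, comp f g, v => f.eval (fun i => (g i).eval v)
  | _, prec f g, v =>
      Nat.rec (f.eval (Fin.tail v)) (fun y r => g.eval (Fin.cons y (Fin.cons r (Fin.tail v)))) (v 0)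

def comp1 {n : ℕ} (f : PR 1) (g : PR n) : PR n := comp f ![g]
def comp2 {n : ℕ} (f : PR 2) (g h : PR n) : PR n := comp f ![g, h]

def const {n : ℕ} : ℕ → PR n
  | 0 => comp zero ![]
  | k + 1 => comp1 succ (const k)

def add : PR 2 := prec (proj 0) (comp1 succ (proj 1))
def pred : PR 1 := prec zero (proj 0)
/-- `(y, x) ↦ x - y` (truncated). -/
def rsub : PR 2 := prec (proj 0) (comp1 pred (proj 1))
/-- `(x, y) ↦ x - y` (truncated). -/
def sub : PR 2 := comp2 rsub (proj 1) (proj 0)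
/-- `n ↦ 0 + 1 + ⋯ + n`. -/
def tri : PR 1 := prec zero (comp2 add (comp1 succ (proj 0)) (proj 1))
/-- Cantor's pairing `(x, y) ↦ tri (x + y) + y`. -/
def pair : PR 2 := comp2 add (comp1 tri (comp2 add (proj 0) (proj 1))) (proj 1)
/-- `n ↦` the largest `r` with `tri r ≤ n`. -/
def row : PR 1 := prec zero (comp2 add (proj 1)
  (comp2 sub (const 1) (comp2 sub (comp1 tri (comp1 succ (proj 1))) (comp1 succ (proj 0)))))
def right : PR 1 := comp2 sub (proj 0) (comp1 tri row)
def left : PR 1 := comp2 sub row right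
/-- The code of an application: `(x, y) ↦ pair x y + 16`. -/
def ap : PR 2 := comp2 add (const 16) pair
/-- Function part and argument part of the code of an application. -/
def fnPart : PR 1 := comp1 left (comp2 sub (proj 0) (const 16))
def argPart : PR 1 := comp1 right (comp2 sub (proj 0) (const 16))
/-- `(i, w) ↦` the `i`-th entry of the sequence coded by `w = pair w₀ (pair w₁ …)`. -/
def nth : PR 2 := comp1 left (prec (n := 1) (proj 0) (comp1 right (proj 1)))

end PR

/-- Terms for numbers. -/
inductive NTerm : Type
  | var (i : ℕ)
  | fn {n : ℕ} (f : PR n) (ts : Fin n → NTerm)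

namespace NTerm

def subst (σ : ℕ → NTerm) : NTerm → NTerm
  | var i => σ i
  | fn f ts => fn f (fun i => (ts i).subst σ)

def up (σ : ℕ → NTerm) : ℕ → NTerm
  | 0 => var 0
  | i + 1 => (σ i).subst (fun j => var (j + 1))

def zero : NTerm := fn .zero ![]
def succ (t : NTerm) : NTerm := fn .succ ![t]
def numeral : ℕ → NTerm
  | 0 => zero
  | n + 1 => succ (numeral n)
def sub (s t : NTerm) : NTerm := fn .sub ![s, t]
def pair (s t : NTerm) : NTerm := fn .pair ![s, t]
def left (t : NTerm) : NTerm := fn .left ![t]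
def right (t : NTerm) : NTerm := fn .right ![t]
def nth (i w : NTerm) : NTerm := fn .nth ![i, w]

/-- All variables of the term are `< n`. -/
def VarsBelow (n : ℕ) : NTerm → Prop
  | var i => i < n
  | fn _ ts => ∀ i, (ts i).VarsBelow n

end NTerm

/-! ## Coding the closed total term model -/

/-- Closed terms of the language of Frege structures: the domain of the closed term model. -/
inductive CTerm : Type
  | const (c : FConst)
  | app (s t : CTerm)

def FConst.code : FConst → ℕ
  | .k => 0 | .s => 1 | .p => 2 | .p0 => 3 | .p1 => 4 | .zero => 5 | .sN => 6 | .pN => 7 | .dN => 8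
  | .eqd => 9 | .negd => 10 | .andd => 11 | .impd => 12 | .alld => 13 | .natd => 14 | .l => 15

/-- The Gödel numbering of closed terms. -/
def CTerm.code : CTerm → ℕ
  | .const c => c.code
  | .app s t => PR.ap.eval ![s.code, t.code]

theorem PR.comp1_eval {n : ℕ} (f : PR 1) (g : PR n) (v : Fin n → ℕ) :
    (PR.comp1 f g).eval v = f.eval ![g.eval v] := by
  rw [PR.comp1, PR.eval]
  congr 1
  funext i
  fin_cases i
  rfl

theorem PR.comp2_eval {n : ℕ} (f : PR 2) (g h : PR n) (v : Fin n → ℕ) :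
    (PR.comp2 f g h).eval v = f.eval ![g.eval v, h.eval v] := by
  rw [PR.comp2, PR.eval]
  congr 1
  funext i
  fin_cases i <;> rfl

theorem PR.add_eval (x y : ℕ) : PR.add.eval ![x, y] = x + y := by
  induction x with
  | zero => rw [Nat.zero_add]; rfl
  | succ x ih =>
    have : PR.add.eval ![x + 1, y] = PR.add.eval ![x, y] + 1 := rfl
    omega

theorem PR.tri_eval_succ (n : ℕ) : PR.tri.eval ![n + 1] = PR.tri.eval ![n] + (n + 1) := by
  have : PR.tri.eval ![n + 1] = (PR.comp2 .add (.comp1 .succ (.proj 0)) (.proj 1)).eval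
      (Fin.cons n (Fin.cons (PR.tri.eval ![n]) (Fin.tail ![n + 1]))) := rfl
  rw [this, PR.comp2_eval, PR.add_eval, PR.comp1_eval, Nat.add_comm]
  rfl

theorem PR.const_eval {n : ℕ} (k : ℕ) (v : Fin n → ℕ) : (PR.const k : PR n).eval v = k := by
  induction k with
  | zero => rfl
  | succ k ih => rw [PR.const, PR.comp1_eval, ih]; rfl

theorem PR.ap_eval (x y : ℕ) : PR.ap.eval ![x, y] = PR.tri.eval ![x + y] + y + 16 := by
  have h0 : (PR.proj 0 : PR 2).eval ![x, y] = x := rfl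
  have h1 : (PR.proj 1 : PR 2).eval ![x, y] = y := rfl
  rw [PR.ap, PR.comp2_eval, PR.add_eval, PR.const_eval, PR.pair, PR.comp2_eval, PR.add_eval,
    PR.comp1_eval, PR.comp2_eval, PR.add_eval, h0, h1, Nat.add_comm]

/-- The Gödel numbering is a bijection between the closed terms and the natural numbers. -/
theorem CTerm.code_bijective : Function.Bijective CTerm.code := by
  have hmono : ∀ s d : ℕ, PR.tri.eval ![s] + s + 1 ≤ PR.tri.eval ![s + 1 + d] := by
    intro s d
    induction d with
    | zero => rw [Nat.add_zero, PR.tri_eval_succ]; omega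
    | succ d ih => rw [← Nat.add_assoc, PR.tri_eval_succ]; omega
  have hlt : ∀ c : FConst, c.code < 16 := by intro c; cases c <;> decide
  have hinj : ∀ x y x' y' : ℕ, PR.tri.eval ![x + y] + y = PR.tri.eval ![x' + y'] + y' →
      x = x' ∧ y = y' := by
    intro x y x' y' h
    rcases lt_trichotomy (x + y) (x' + y') with h1 | h1 | h1
    · have := hmono (x + y) (x' + y' - (x + y) - 1)
      rw [show x + y + 1 + (x' + y' - (x + y) - 1) = x' + y' by omega] at this
      omega
    · rw [h1] at h; omega
    · have := hmono (x' + y') (x + y - (x' + y') - 1)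
      rw [show x' + y' + 1 + (x + y - (x' + y') - 1) = x + y by omega] at this
      omega
  have hsurj : ∀ n : ℕ, ∃ x y, PR.tri.eval ![x + y] + y = n := by
    intro n
    induction n with
    | zero => exact ⟨0, 0, rfl⟩
    | succ n ih =>
      obtain ⟨x, y, h⟩ := ih
      cases x with
      | zero =>
        refine ⟨y + 1, 0, ?_⟩
        rw [Nat.add_zero, PR.tri_eval_succ]
        rw [Nat.zero_add] at h
        omega
      | succ x =>
        refine ⟨x, y + 1, ?_⟩
        rw [show x + (y + 1) = x + 1 + y by omega]
        omega
  have hge : ∀ s : ℕ, s ≤ PR.tri.eval ![s] := by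
    intro s
    induction s with
    | zero => exact Nat.zero_le _
    | succ s ih => rw [PR.tri_eval_succ]; omega
  constructor
  · intro s
    induction s with
    | const c =>
      intro t h
      cases t with
      | const d =>
        congr 1
        revert h
        cases c <;> cases d <;> simp [CTerm.code, FConst.code]
      | app t u =>
        have := hlt c
        simp only [CTerm.code, PR.ap_eval] at h
        omega
    | app s₁ s₂ ih₁ ih₂ =>
      intro t h
      cases t with
      | const d =>
        have := hlt d
        simp only [CTerm.code, PR.ap_eval] at h
        omega
      | app t₁ t₂ =>
        simp only [CTerm.code, PR.ap_eval] at h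
        obtain ⟨h₁, h₂⟩ := hinj _ _ _ _ (Nat.add_right_cancel h)
        rw [ih₁ h₁, ih₂ h₂]
  · intro n
    induction n using Nat.strong_induction_on with
    | _ n ih =>
      by_cases hn : n < 16
      · have : ∃ c : FConst, c.code = n := by
          interval_cases n
          exacts [⟨.k, rfl⟩, ⟨.s, rfl⟩, ⟨.p, rfl⟩, ⟨.p0, rfl⟩, ⟨.p1, rfl⟩, ⟨.zero, rfl⟩,
            ⟨.sN, rfl⟩, ⟨.pN, rfl⟩, ⟨.dN, rfl⟩, ⟨.eqd, rfl⟩, ⟨.negd, rfl⟩, ⟨.andd, rfl⟩,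
            ⟨.impd, rfl⟩, ⟨.alld, rfl⟩, ⟨.natd, rfl⟩, ⟨.l, rfl⟩]
        obtain ⟨c, hc⟩ := this
        exact ⟨.const c, hc⟩
      · obtain ⟨x, y, h⟩ := hsurj (n - 16)
        have := hge (x + y)
        obtain ⟨s, hs⟩ := ih x (by omega)
        obtain ⟨t, ht⟩ := ih y (by omega)
        refine ⟨.app s t, ?_⟩
        simp only [CTerm.code, PR.ap_eval, hs, ht]
        omega

/-- The code of the numeral `sN (⋯ (sN 0))`. -/
def PR.num : PR 1 :=
  .prec (.const FConst.zero.code) (.comp2 .ap (.const FConst.sN.code) (.proj 1))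

namespace NTerm

/-- The interpretation of a constant: the numeral of its code. -/
def cst (c : FConst) : NTerm := numeral c.code
/-- The interpretation of application: the bracket `{x}(y)` in which the code `x` of a closed term `s`
indexes the (total) function from the code of `t` to the code of `s t`. -/
def ap (s t : NTerm) : NTerm := fn .ap ![s, t]
def ap2 (r s t : NTerm) : NTerm := ap (ap r s) t
def fnPart (t : NTerm) : NTerm := fn .fnPart ![t]
def argPart (t : NTerm) : NTerm := fn .argPart ![t]
/-- The code of the `n`-th numeral of the term model. -/
def num (t : NTerm) : NTerm := fn .num ![t]

def tpair (s t : NTerm) : NTerm := ap2 (cst .p) s t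
def dEq (s t : NTerm) : NTerm := ap (cst .eqd) (tpair s t)
def dNeg (s : NTerm) : NTerm := ap (cst .negd) s
def dAnd (s t : NTerm) : NTerm := ap (cst .andd) (tpair s t)
def dImp (s t : NTerm) : NTerm := ap (cst .impd) (tpair s t)
def dAll (s : NTerm) : NTerm := ap (cst .alld) s
def dNat (s : NTerm) : NTerm := ap (cst .natd) s
/-- `l f b`. -/
def lim (f b : NTerm) : NTerm := ap2 (cst .l) f b
/-- The terms `0 =̇ 0` and `Ṅ 0`. -/
def zeroEq : NTerm := dEq (cst .zero) (cst .zero)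
def natZero : NTerm := dNat (cst .zero)

end NTerm

/-! ## Arithmetical formulas with a set variable -/

/-- Formulas of arithmetic with an additional unary predicate `t ∈ X`. -/
inductive OpForm : Type
  | eq (s t : NTerm)
  | mem (t : NTerm)
  | neg (A : OpForm)
  | and (A B : OpForm)
  | imp (A B : OpForm)
  | all (A : OpForm)

namespace OpForm
open NTerm

def or (A B : OpForm) : OpForm := neg (and (neg A) (neg B))
def ex (A : OpForm) : OpForm := neg (all (neg A))
def ne (s t : NTerm) : OpForm := neg (eq s t)
/-- `s < t`. -/
def lt (s t : NTerm) : OpForm := ne (NTerm.sub t s) zero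

def subst (σ : ℕ → NTerm) : OpForm → OpForm
  | eq s t => eq (s.subst σ) (t.subst σ)
  | mem t => mem (t.subst σ)
  | neg A => neg (A.subst σ)
  | and A B => and (A.subst σ) (B.subst σ)
  | imp A B => imp (A.subst σ) (B.subst σ)
  | all A => all (A.subst (up σ))

/-- `A(s)` for a formula `A` in the variable `0`. -/
def inst1 (A : OpForm) (s : NTerm) : OpForm :=
  A.subst (fun i => match i with
    | 0 => s
    | i + 1 => var i)

/-- `A(s, t)` for a formula `A` in the variables `0, 1`. -/
def inst2 (A : OpForm) (s t : NTerm) : OpForm :=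
  A.subst (fun i => match i with
    | 0 => s
    | 1 => t
    | i + 2 => var i)

/-- All free variables are `< n`. -/
def FreeBelow : ℕ → OpForm → Prop
  | n, eq s t => s.VarsBelow n ∧ t.VarsBelow n
  | n, mem t => t.VarsBelow n
  | n, neg A => A.FreeBelow n
  | n, and A B => A.FreeBelow n ∧ B.FreeBelow n
  | n, imp A B => A.FreeBelow n ∧ B.FreeBelow n
  | n, all A => A.FreeBelow (n + 1)

/-- `X` occurs only positively (`b = true`), resp. only negatively (`b = false`). -/
def Polarity : Bool → OpForm → Prop
  | _, eq _ _ => True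
  | b, mem _ => b = true
  | b, neg A => A.Polarity (!b)
  | b, and A B => A.Polarity b ∧ B.Polarity b
  | b, imp A B => A.Polarity (!b) ∧ B.Polarity b
  | b, all A => A.Polarity b

def QuantifierFree : OpForm → Prop
  | eq _ _ => True
  | mem _ => True
  | neg A => A.QuantifierFree
  | and A B => A.QuantifierFree ∧ B.QuantifierFree
  | imp A B => A.QuantifierFree ∧ B.QuantifierFree
  | all _ => False

/-- Positive operator forms, and quantifier-free operator forms. -/
def IsPOS (A : OpForm) : Prop := A.FreeBelow 1 ∧ A.Polarity true
def IsQF (A : OpForm) : Prop := A.FreeBelow 1 ∧ A.QuantifierFree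

/-- The combined operator form `𝔄(X, u)`, that is
`A₀(X, u) ∨ ([∀ x, A₀(X, x) → x ∈ X] ∧ A₁(X, u))`. -/
def combine (A₀ A₁ : OpForm) : OpForm :=
  or A₀ (and (all (imp A₀ (mem (var 0)))) A₁)

/-! ### Reduction in the term model -/

/-- The code `0` contracts to the code `1` (variables): the defining equations of the combinators,
the projections, the predecessor, and the numerical case distinction, read from left to right. -/
def contr : OpForm :=
  or (ex (ex (and (eq (var 2) (ap2 (cst .k) (var 1) (var 0))) (eq (var 3) (var 1))))) <|
  or (ex (ex (ex (and (eq (var 3) (ap (ap2 (cst .s) (var 2) (var 1)) (var 0)))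
      (eq (var 4) (ap (ap (var 2) (var 0)) (ap (var 1) (var 0)))))))) <|
  or (ex (ex (and (eq (var 2) (ap (cst .p0) (tpair (var 1) (var 0)))) (eq (var 3) (var 1))))) <|
  or (ex (ex (and (eq (var 2) (ap (cst .p1) (tpair (var 1) (var 0)))) (eq (var 3) (var 0))))) <|
  or (ex (and (eq (var 1) (ap (cst .pN) (ap (cst .sN) (var 0)))) (eq (var 2) (var 0)))) <|
  or (ex (ex (ex (and
      (eq (var 3) (ap2 (ap2 (cst .dN) (var 2) (var 1)) (num (var 0)) (num (var 0))))
      (eq (var 4) (var 2))))))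
  (ex (ex (ex (ex (and (ne (var 1) (var 0)) (and
      (eq (var 4) (ap2 (ap2 (cst .dN) (var 3) (var 2)) (num (var 1)) (num (var 0))))
      (eq (var 5) (var 2))))))))

/-- The two components of the `i`-th entry of the sequence `w` of pairs. -/
def src (w i : NTerm) : NTerm := NTerm.left (NTerm.nth i w)
def tgt (w i : NTerm) : NTerm := NTerm.right (NTerm.nth i w)

/-- The `i`-th entry `(a, b)` of the sequence `w` of length `n` is justified as a reduction of `a`
to `b`: by reflexivity, by contraction, by compatibility with application from two later entries,
or by transitivity from two later entries. The variables `0, 1, 2` are `i, n, w`. -/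
def justified : OpForm :=
  or (eq (src (var 2) (var 0)) (tgt (var 2) (var 0))) <|
  or (contr.inst2 (src (var 2) (var 0)) (tgt (var 2) (var 0))) <|
  ex (ex (and (and (and (lt (var 2) (var 1)) (lt (var 1) (var 3)))
      (and (lt (var 2) (var 0)) (lt (var 0) (var 3))))
    (or
      (and (eq (src (var 4) (var 2)) (ap (src (var 4) (var 1)) (src (var 4) (var 0))))
        (eq (tgt (var 4) (var 2)) (ap (tgt (var 4) (var 1)) (tgt (var 4) (var 0)))))
      (and (eq (src (var 4) (var 2)) (src (var 4) (var 1)))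
        (and (eq (tgt (var 4) (var 1)) (src (var 4) (var 0)))
          (eq (tgt (var 4) (var 0)) (tgt (var 4) (var 2))))))))

/-- The code `0` reduces to the code `1` (variables): there is a sequence `w`, of length `n > 0`,
of justified pairs, that begins with the pair `(0, 1)`. -/
def red : OpForm :=
  ex (ex (and (lt zero (var 0))
    (and (eq (NTerm.nth zero (var 1)) (NTerm.pair (var 2) (var 3)))
      (all (imp (lt (var 0) (var 1)) justified)))))

/-- Equality of the term model: `s` and `t` have a common reduct. -/
def eqv (s t : NTerm) : OpForm :=
  inst2 (ex (and (red.inst2 (var 1) (var 0)) (red.inst2 (var 2) (var 0)))) s t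

/-- Natural numbers of the term model: `t` reduces to a numeral. -/
def isNat (t : NTerm) : OpForm := inst1 (ex (red.inst2 (var 1) (num (var 0)))) t

/-! ### The two operator forms -/

/-- The positive operator form `A₀(X, a)`, with `a` the variable `0`. Equality is equality of the
term model; by the last clause, `X` is treated as a set of elements of that model. -/
def opA₀ : OpForm :=
  or (ex (ex (and (eqv (var 2) (dEq (var 1) (var 0))) (eqv (var 1) (var 0))))) <|
  or (ex (ex (and (eqv (var 2) (dNeg (dEq (var 1) (var 0)))) (neg (eqv (var 1) (var 0)))))) <|
  or (ex (and (eqv (var 1) (dNat (var 0))) (isNat (var 0)))) <|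
  or (ex (and (eqv (var 1) (dNeg (dNat (var 0)))) (neg (isNat (var 0))))) <|
  or (ex (and (eqv (var 1) (dNeg (dNeg (var 0)))) (mem (var 0)))) <|
  or (ex (ex (and (eqv (var 2) (dAnd (var 1) (var 0))) (and (mem (var 1)) (mem (var 0)))))) <|
  or (ex (ex (and (eqv (var 2) (dNeg (dAnd (var 1) (var 0))))
      (or (mem (dNeg (var 1))) (mem (dNeg (var 0))))))) <|
  or (ex (ex (and (eqv (var 2) (dImp (var 1) (var 0)))
      (or (mem (dNeg (var 1))) (mem (var 0)))))) <|
  or (ex (ex (and (eqv (var 2) (dNeg (dImp (var 1) (var 0))))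
      (and (mem (var 1)) (mem (dNeg (var 0))))))) <|
  or (ex (and (eqv (var 1) (dAll (var 0))) (all (mem (ap (var 1) (var 0)))))) <|
  or (ex (and (eqv (var 1) (dNeg (dAll (var 0)))) (ex (mem (dNeg (ap (var 1) (var 0))))))) <|
  or (ex (and (eqv (var 1) (lim (var 0) zeroEq))
      (all (or (mem (ap (var 1) (var 0))) (mem (dNeg (ap (var 1) (var 0)))))))) <|
  ex (and (eqv (var 1) (var 0)) (mem (var 0)))

/-- `s` is (the code of) a term `l f b` whose `f` is marked in `X` as a class that has not been
treated yet: `s = l f b`, `l f (0 =̇ 0) ∈ X` and `l f (Ṅ 0) ∉ X`, where `f` and `b` are read off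
from `s`. -/
def limReady (s : NTerm) : OpForm :=
  and (eq s (lim (argPart (fnPart s)) (argPart s)))
    (and (mem (lim (argPart (fnPart s)) zeroEq)) (neg (mem (lim (argPart (fnPart s)) natZero))))

/-- The quantifier-free operator form `A₁(X, a)`, with `a` the variable `0`: either `a = l f b` with
`b ∈ X`, or `a = ¬̇ (l f b)` with `b ∉ X`, both under the condition of `limReady`. Here `a` is compared
with `l f b` as a code, so that no quantifier is needed; closure under the equality of the term
model is provided by `A₀`. -/
def opA₁ : OpForm :=
  or (and (limReady (var 0)) (mem (argPart (var 0))))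
    (and (eq (var 0) (dNeg (argPart (var 0))))
      (and (limReady (argPart (var 0))) (neg (mem (argPart (argPart (var 0)))))))

end OpForm

/-! ## The two-sorted language and the theory FID -/

/-- Formulas of the two-sorted language of numbers and ordinals. Ordinal terms are just ordinal
variables, with their own numbering; `P α t` is the stage predicate. `allN` binds the number
variable `0`, `allO` binds the ordinal variable `0`. -/
inductive KForm : Type
  | eqN (s t : NTerm)
  | eqO (α β : ℕ)
  | lt (α β : ℕ)
  | P (α : ℕ) (t : NTerm)
  | neg (A : KForm)
  | and (A B : KForm)
  | imp (A B : KForm)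
  | allN (A : KForm)
  | allO (A : KForm)

/-- A renaming of ordinal variables pushed under one ordinal quantifier. -/
def upO (ρ : ℕ → ℕ) : ℕ → ℕ
  | 0 => 0
  | i + 1 => ρ i + 1

namespace KForm
open NTerm

def or (A B : KForm) : KForm := neg (and (neg A) (neg B))
def iff (A B : KForm) : KForm := and (imp A B) (imp B A)
def exN (A : KForm) : KForm := neg (allN (neg A))
def exO (A : KForm) : KForm := neg (allO (neg A))

def subst (σ : ℕ → NTerm) (ρ : ℕ → ℕ) : KForm → KForm
  | eqN s t => eqN (s.subst σ) (t.subst σ)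
  | eqO α β => eqO (ρ α) (ρ β)
  | lt α β => lt (ρ α) (ρ β)
  | P α t => P (ρ α) (t.subst σ)
  | neg A => neg (A.subst σ ρ)
  | and A B => and (A.subst σ ρ) (B.subst σ ρ)
  | imp A B => imp (A.subst σ ρ) (B.subst σ ρ)
  | allN A => allN (A.subst (up σ) ρ)
  | allO A => allO (A.subst σ (upO ρ))

/-- `A(t)` with number variable `0` distinguished, the parameter `i + 1` becoming `i + m`. -/
def atN (A : KForm) (m : ℕ) (t : NTerm) : KForm :=
  A.subst (fun i => match i with
    | 0 => t
    | i + 1 => var (i + m)) id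

/-- `A(β)` with ordinal variable `0` distinguished, the parameter `i + 1` becoming `i + m`. -/
def atO (A : KForm) (m : ℕ) (β : ℕ) : KForm :=
  A.subst var (fun i => match i with
    | 0 => β
    | i + 1 => i + m)

def shiftN (A : KForm) : KForm := A.subst (fun i => var (i + 1)) id
def shiftO (A : KForm) : KForm := A.subst var (fun i => i + 1)

/-- `∃ ξ < α, P ξ t`. -/
def Pbelow (α : ℕ) (t : NTerm) : KForm := exO (and (lt 0 (α + 1)) (P 0 t))
/-- `∃ α, P α t`. -/
def Pinf (t : NTerm) : KForm := exO (P 0 t)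

end KForm

/-- The result of replacing each `t ∈ X` by `F t`, where `F t` has no number variables besides
those of `t`. -/
def OpForm.toK (F : NTerm → KForm) : OpForm → KForm
  | .eq s t => .eqN s t
  | .mem t => F t
  | .neg A => .neg (A.toK F)
  | .and A B => .and (A.toK F) (B.toK F)
  | .imp A B => .imp (A.toK F) (B.toK F)
  | .all A => .allN (A.toK F)

/-- Derivability from the non-logical axioms `T` in classical two-sorted first-order logic with
equality (Hilbert-style). -/
inductive KProv (T : KForm → Prop) : KForm → Prop
  | ax {A} : T A → KProv T A
  | mp {A B} : KProv T (.imp A B) → KProv T A → KProv T B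
  | genN {A} : KProv T A → KProv T (.allN A)
  | genO {A} : KProv T A → KProv T (.allO A)
  | imp_k (A B) : KProv T (.imp A (.imp B A))
  | imp_s (A B C) : KProv T (.imp (.imp A (.imp B C)) (.imp (.imp A B) (.imp A C)))
  | contra (A B) : KProv T (.imp (.imp (.neg A) (.neg B)) (.imp B A))
  | and_left (A B) : KProv T (.imp (.and A B) A)
  | and_right (A B) : KProv T (.imp (.and A B) B)
  | and_intro (A B) : KProv T (.imp A (.imp B (.and A B)))
  | allN_elim (A : KForm) (t) : KProv T (.imp (.allN A) (A.atN 0 t))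
  | allN_distr (A B : KForm) : KProv T (.imp (.allN (.imp A.shiftN B)) (.imp A (.allN B)))
  | allO_elim (A : KForm) (β) : KProv T (.imp (.allO A) (A.atO 0 β))
  | allO_distr (A B : KForm) : KProv T (.imp (.allO (.imp A.shiftO B)) (.imp A (.allO B)))
  | eqN_refl (t) : KProv T (.eqN t t)
  | eqN_subst (A : KForm) (s t) : KProv T (.imp (.eqN s t) (.imp (A.atN 0 s) (A.atN 0 t)))
  | eqO_refl (α) : KProv T (.eqO α α)
  | eqO_subst (A : KForm) (α β) : KProv T (.imp (.eqO α β) (.imp (A.atO 0 α) (A.atO 0 β)))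

section FID
open NTerm KForm

/-- Peano arithmetic with the defining equations of all primitive recursive function symbols and
induction for all formulas of the two-sorted language. -/
inductive PA : KForm → Prop
  | succ_ne_zero : PA (neg (eqN (succ (var 0)) zero))
  | succ_inj : PA (imp (eqN (succ (var 0)) (succ (var 1))) (eqN (var 0) (var 1)))
  | proj {n : ℕ} (i : Fin n) : PA (eqN (fn (.proj i) (fun j => var j)) (var i))
  | comp {m n : ℕ} (f : PR m) (g : Fin m → PR n) :
      PA (eqN (fn (.comp f g) (fun j => var j)) (fn f (fun i => fn (g i) (fun j => var j))))
  | prec_zero {n : ℕ} (f : PR n) (g : PR (n + 2)) :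
      PA (eqN (fn (.prec f g) (Fin.cons zero (fun j => var j))) (fn f (fun j => var j)))
  | prec_succ {n : ℕ} (f : PR n) (g : PR (n + 2)) :
      PA (eqN (fn (.prec f g) (Fin.cons (succ (var 0)) (fun j => var (j + 1))))
        (fn g (Fin.cons (var 0) (Fin.cons
          (fn (.prec f g) (Fin.cons (var 0) (fun j => var (j + 1)))) (fun j => var (j + 1))))))
  | ind (A : KForm) :
      PA (imp (and (A.atN 0 zero) (allN (imp A (A.atN 1 (succ (var 0)))))) (allN A))

/-- The non-logical axioms of `FID` for the operator form combined from `A₀` and `A₁`. -/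
inductive FID (A₀ A₁ : OpForm) : KForm → Prop
  | pa {A} : PA A → FID A₀ A₁ A
  | lt_irrefl : FID A₀ A₁ (neg (lt 0 0))
  | lt_trans : FID A₀ A₁ (imp (and (lt 0 1) (lt 1 2)) (lt 0 2))
  | lt_total : FID A₀ A₁ (or (lt 0 1) (or (eqO 0 1) (lt 1 0)))
  | op1 : FID A₀ A₁ (iff (P 0 (var 0))
      (or (Pbelow 0 (var 0)) ((OpForm.combine A₀ A₁).toK (Pbelow 0))))
  | op2 : FID A₀ A₁ (imp ((OpForm.combine A₀ A₁).toK Pinf) (Pinf (var 0)))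
  | tind (A : KForm) : FID A₀ A₁
      (imp (allO (imp (allO (imp (lt 0 1) (A.atO 2 0))) A)) (allO A))

end FID

/-! ## The translation -/

def FTerm.star : FTerm → NTerm
  | .var i => .var i
  | .const c => .cst c
  | .app s t => .ap s.star t.star

/-- The translation. Every natural number codes a closed term (`CTerm.code_bijective`), so
quantifiers range over the whole sort of numbers. -/
def FForm.star : FForm → KForm
  | .eq s t => (OpForm.eqv s.star t.star).toK KForm.Pinf
  | .nat t => (OpForm.isNat t.star).toK KForm.Pinf
  | .tr t => KForm.Pinf t.star
  | .univ t =>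
      ((OpForm.ex (.and (.eqv (.var 1) (.ap (.cst .l) (.var 0)))
        (.all (.or (.mem (.ap (.var 1) (.var 0))) (.mem (.dNeg (.ap (.var 1) (.var 0)))))))).inst1
          t.star).toK KForm.Pinf
  | .neg A => .neg A.star
  | .and A B => .and A.star B.star
  | .imp A B => .imp A.star B.star
  | .all A => .allN A.star

/-! The argument is semantic. A completeness theorem for the two-sorted calculus (`KProv.of_models`,
by a Henkin construction) reduces derivability of `A.star` to its truth in every model `M` of `FID`.
Such a model may be nonstandard, so every induction on numbers or ordinals inside `M` is restricted
to definable sets. The class `Def` supplies the definability proofs by instance search.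

Inside `M` the numbers are codes of terms. Reduction is an inductive definition by coded
derivations, and it is confluent: parallel reduction has complete developments
(`Par.exists_development`). Hence having a common reduct is a congruence `Eqv`, under which numerals
are distinct and terms with a dotted head decompose uniquely. This validates `TON` and `UG`.

For truth, let `X_α` be the union of the stages below `α`. The operator first closes off under the
positive clauses, and these mark a class `f` by putting `l f (0 =̇ 0)` into the set. Once `X_α` is
closed under `A₀`, the second operator acts on every marked `f` not yet treated: it adds `l f b` for
`b` in `X_α` and the negation of `l f b` for the other `b`. Since `Ṅ 0` lies in every closed set, `l
f (Ṅ 0)` is then added and blocks a second treatment. So each `f` is treated at no more than one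
stage (`Ready.unique`), and each class is treated at some stage (`exists_ready`). Therefore `l f` is
the characteristic function of a closed `X_α` (`Ready.isStageOf`).

A closed `X_α` satisfies the clauses of truth from right to left by closure. From left to right, an
element outside the range of `l` and its negations can enter only by a clause (`exists_enters`,
`stage_iff_clause`). These are the universe axioms. Consistency and proposition induction are proved
by induction on the stage; when `f` is treated, its mark shows that all `f b` were decided before.
Finally, truth in the interpretation is invariant under `Eqv` (`fsat_congr`), so the equality axioms
and all schemata hold, and soundness follows by induction on derivations. -/

/-! ## Substitution -/

/-- The sequence `a, f 0, f 1, …`. -/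
def scons {α : Type*} (a : α) (f : ℕ → α) : ℕ → α
  | 0 => a
  | i + 1 => f i

namespace NTerm

theorem subst_subst (σ τ : ℕ → NTerm) (t : NTerm) :
    (t.subst σ).subst τ = t.subst (fun i => (σ i).subst τ) := by
  induction t with
  | var i => rfl
  | fn f ts ih => simp only [subst, ih]

theorem subst_var (t : NTerm) : t.subst var = t := by
  induction t with
  | var i => rfl
  | fn f ts ih => simp only [subst, ih]

theorem up_var : up var = var := by
  funext i; cases i <;> rfl

theorem up_subst (σ τ : ℕ → NTerm) :
    (fun i => (up σ i).subst (up τ)) = up (fun i => (σ i).subst τ) := by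
  funext i
  cases i with
  | zero => rfl
  | succ i => simp only [up, subst_subst, subst]

/-- Instantiating the bound variable after `σ` has been pushed under the quantifier; this is the
quantifier step of the truth lemma `Henkin.model_sat`. -/
theorem up_scons (t : NTerm) (σ : ℕ → NTerm) :
    (fun i => (up σ i).subst (scons t var)) = scons t σ := by
  funext i
  cases i with
  | zero => rfl
  | succ i => exact (subst_subst _ _ _).trans (subst_var _)

theorem exists_support (t : NTerm) :
    ∃ n, ∀ σ τ : ℕ → NTerm, (∀ i < n, σ i = τ i) → t.subst σ = t.subst τ := by
  induction t with
  | var i => exact ⟨i + 1, fun σ τ h => h i (Nat.lt_succ_self i)⟩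
  | fn f ts ih =>
    choose n hn using ih
    refine ⟨Finset.univ.sup n, fun σ τ h => ?_⟩
    simp only [subst, fn.injEq, heq_eq_eq, true_and]
    funext i
    exact hn i σ τ fun j hj => h j (hj.trans_le (Finset.le_sup (Finset.mem_univ i)))

end NTerm

theorem upO_id : upO id = id := by
  funext i; cases i <;> rfl

theorem upO_comp (ρ ρ' : ℕ → ℕ) : upO ρ' ∘ upO ρ = upO (ρ' ∘ ρ) := by
  funext i; cases i <;> rfl

namespace KForm
open NTerm

theorem subst_subst (A : KForm) (σ τ : ℕ → NTerm) (ρ ρ' : ℕ → ℕ) :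
    (A.subst σ ρ).subst τ ρ' = A.subst (fun i => (σ i).subst τ) (ρ' ∘ ρ) := by
  induction A generalizing σ τ ρ ρ' with
  | eqN s t => simp only [subst, NTerm.subst_subst]
  | eqO α β => rfl
  | lt α β => rfl
  | P α t => simp only [subst, NTerm.subst_subst, Function.comp_apply]
  | neg A ih => simp only [subst, ih]
  | and A B ih₁ ih₂ => simp only [subst, ih₁, ih₂]
  | imp A B ih₁ ih₂ => simp only [subst, ih₁, ih₂]
  | allN A ih => simp only [subst, ih, up_subst]
  | allO A ih => simp only [subst, ih, upO_comp]

theorem subst_id (A : KForm) : A.subst var id = A := by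
  induction A with
  | eqN s t => simp only [subst, subst_var]
  | eqO α β => rfl
  | lt α β => rfl
  | P α t => simp only [subst, subst_var, id]
  | neg A ih => simp only [subst, ih]
  | and A B ih₁ ih₂ => simp only [subst, ih₁, ih₂]
  | imp A B ih₁ ih₂ => simp only [subst, ih₁, ih₂]
  | allN A ih => simp only [subst, up_var, ih]
  | allO A ih => simp only [subst, upO_id, ih]

theorem atN_eq (A : KForm) (m : ℕ) (t : NTerm) :
    A.atN m t = A.subst (scons t fun i => var (i + m)) id := by
  unfold atN; congr 1

theorem atO_eq (A : KForm) (m β : ℕ) :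
    A.atO m β = A.subst var (scons β fun i => i + m) := by
  unfold atO; congr 1

/-- A formula depends on finitely many variables of either sort. The bound provides fresh variables
for generalization, and it lets an infinite substitution be replaced by finitely many
instantiations. -/
theorem exists_support (A : KForm) :
    ∃ n, ∀ (σ τ : ℕ → NTerm) (ρ ρ' : ℕ → ℕ), (∀ i < n, σ i = τ i) → (∀ i < n, ρ i = ρ' i) →
      A.subst σ ρ = A.subst τ ρ' := by
  induction A with
  | eqN s t =>
    obtain ⟨n, hn⟩ := s.exists_support
    obtain ⟨m, hm⟩ := t.exists_support
    refine ⟨max n m, fun σ τ ρ ρ' h _ => ?_⟩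
    simp only [subst, hn σ τ fun i hi => h i (lt_max_of_lt_left hi),
      hm σ τ fun i hi => h i (lt_max_of_lt_right hi)]
  | eqO α β =>
    refine ⟨max α β + 1, fun σ τ ρ ρ' _ h => ?_⟩
    simp only [subst, h α (by omega), h β (by omega)]
  | lt α β =>
    refine ⟨max α β + 1, fun σ τ ρ ρ' _ h => ?_⟩
    simp only [subst, h α (by omega), h β (by omega)]
  | P α t =>
    obtain ⟨n, hn⟩ := t.exists_support
    refine ⟨max n (α + 1), fun σ τ ρ ρ' h h' => ?_⟩
    simp only [subst, hn σ τ fun i hi => h i (lt_max_of_lt_left hi), h' α (by omega)]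
  | neg A ih =>
    obtain ⟨n, hn⟩ := ih
    exact ⟨n, fun σ τ ρ ρ' h h' => congrArg neg (hn σ τ ρ ρ' h h')⟩
  | and A B ih₁ ih₂ =>
    obtain ⟨n, hn⟩ := ih₁
    obtain ⟨m, hm⟩ := ih₂
    exact ⟨max n m, fun σ τ ρ ρ' h h' => congrArg₂ and
      (hn σ τ ρ ρ' (fun i hi => h i (by omega)) fun i hi => h' i (by omega))
      (hm σ τ ρ ρ' (fun i hi => h i (by omega)) fun i hi => h' i (by omega))⟩
  | imp A B ih₁ ih₂ =>
    obtain ⟨n, hn⟩ := ih₁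
    obtain ⟨m, hm⟩ := ih₂
    exact ⟨max n m, fun σ τ ρ ρ' h h' => congrArg₂ imp
      (hn σ τ ρ ρ' (fun i hi => h i (by omega)) fun i hi => h' i (by omega))
      (hm σ τ ρ ρ' (fun i hi => h i (by omega)) fun i hi => h' i (by omega))⟩
  | allN A ih =>
    obtain ⟨n, hn⟩ := ih
    refine ⟨n, fun σ τ ρ ρ' h h' => congrArg allN (hn _ _ ρ ρ' (fun i hi => ?_) h')⟩
    cases i with
    | zero => rfl
    | succ i => simp only [up, h i (by omega)]
  | allO A ih =>
    obtain ⟨n, hn⟩ := ih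
    refine ⟨n, fun σ τ ρ ρ' h h' => congrArg allO (hn σ τ _ _ h fun i hi => ?_)⟩
    cases i with
    | zero => rfl
    | succ i => simp only [upO, h' i (by omega)]

end KForm

/-! ## Countability of the formulas -/

/-- An injective coding of the function symbols by natural numbers. -/
def PR.toNat : {n : ℕ} → PR n → ℕ
  | _, zero => Nat.pair 0 0
  | _, succ => Nat.pair 1 0
  | _, proj i => Nat.pair 2 i
  | _, @comp m _ f g =>
    Nat.pair 3 (Nat.pair m (Nat.pair f.toNat (Encodable.encode (List.ofFn fun i => (g i).toNat))))
  | _, prec f g => Nat.pair 4 (Nat.pair f.toNat g.toNat)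

theorem PR.toNat_injective {n : ℕ} (f g : PR n) (h : f.toNat = g.toNat) : f = g := by
  induction f with
  | zero => cases g <;> simp_all [toNat, Nat.pair_eq_pair]
  | succ => cases g <;> simp_all [toNat, Nat.pair_eq_pair]
  | proj i => cases g <;> simp_all [toNat, Nat.pair_eq_pair, Fin.ext_iff]
  | @comp m n f u ih₁ ih₂ =>
    cases g with
    | @comp m' _ g v =>
      simp only [toNat, Nat.pair_eq_pair, true_and] at h
      obtain ⟨rfl, h₁, h₂⟩ := h
      have h₃ := List.ofFn_injective (Encodable.encode_injective h₂)
      rw [ih₁ g h₁, funext fun i => ih₂ i (v i) (congrFun h₃ i)]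
    | _ => simp [toNat, Nat.pair_eq_pair] at h
  | prec f u ih₁ ih₂ =>
    cases g with
    | prec g v =>
      simp only [toNat, Nat.pair_eq_pair, true_and] at h
      rw [ih₁ g h.1, ih₂ v h.2]
    | _ => simp [toNat, Nat.pair_eq_pair] at h

/-- An injective coding of the terms by natural numbers. -/
def NTerm.toNat : NTerm → ℕ
  | var i => Nat.pair 0 i
  | @fn n f ts =>
    Nat.pair 1 (Nat.pair n (Nat.pair f.toNat (Encodable.encode (List.ofFn fun i => (ts i).toNat))))

theorem NTerm.toNat_injective : Function.Injective NTerm.toNat := by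
  intro s
  induction s with
  | var i =>
    intro t h
    cases t <;> simp_all [toNat, Nat.pair_eq_pair]
  | @fn n f ss ih =>
    intro t h
    cases t with
    | var i => simp [toNat, Nat.pair_eq_pair] at h
    | @fn m g ts =>
      simp only [toNat, Nat.pair_eq_pair, true_and] at h
      obtain ⟨rfl, h₁, h₂⟩ := h
      have h₃ := List.ofFn_injective (Encodable.encode_injective h₂)
      rw [PR.toNat_injective f g h₁, funext fun i => ih i (congrFun h₃ i)]

/-- An injective coding of the formulas by natural numbers. -/
def KForm.toNat : KForm → ℕ
  | eqN s t => Nat.pair 0 (Nat.pair s.toNat t.toNat)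
  | eqO α β => Nat.pair 1 (Nat.pair α β)
  | lt α β => Nat.pair 2 (Nat.pair α β)
  | P α t => Nat.pair 3 (Nat.pair α t.toNat)
  | neg A => Nat.pair 4 A.toNat
  | and A B => Nat.pair 5 (Nat.pair A.toNat B.toNat)
  | imp A B => Nat.pair 6 (Nat.pair A.toNat B.toNat)
  | allN A => Nat.pair 7 A.toNat
  | allO A => Nat.pair 8 A.toNat

theorem KForm.toNat_injective : Function.Injective KForm.toNat := by
  intro A
  induction A <;> intro B h <;> cases B <;>
    simp only [toNat, Nat.pair_eq_pair, NTerm.toNat_injective.eq_iff] at h <;> grind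

/-- The Henkin construction decides all formulas one after the other along an enumeration. -/
instance : Countable KForm := KForm.toNat_injective.countable

/-! ## Derivations -/

namespace KProv
open KForm NTerm
variable {T : KForm → Prop} {A B C D : KForm}

theorem imp_of (h : KProv T B) (D : KForm) : KProv T (.imp D B) := mp (imp_k _ _) h

theorem mp' (h : KProv T (.imp D (.imp A B))) (h' : KProv T (.imp D A)) : KProv T (.imp D B) :=
  mp (mp (imp_s _ _ _) h) h'

theorem imp_self (A : KForm) : KProv T (.imp A A) :=
  mp' (imp_k A (.imp A A)) (imp_k A A)

theorem trans (h : KProv T (.imp A B)) (h' : KProv T (.imp B C)) : KProv T (.imp A C) :=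
  mp' (imp_of h' A) h

theorem curry (h : KProv T (.imp (.and D A) B)) : KProv T (.imp D (.imp A B)) :=
  mp' (mp' (imp_of (imp_s A (.and D A) B) D) (imp_of (imp_of h A) D)) (and_intro D A)

theorem efq (A B : KForm) : KProv T (.imp (.neg A) (.imp A B)) :=
  trans (imp_k (.neg A) (.neg B)) (contra _ _)

theorem dne (A : KForm) : KProv T (.imp (.neg (.neg A)) A) :=
  mp' (trans (efq (.neg A) (.neg (.neg (.neg A)))) (contra _ _)) (imp_self _)

theorem dni (A : KForm) : KProv T (.imp A (.neg (.neg A))) := mp (contra _ _) (dne _)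

theorem contrapose (A B : KForm) :
    KProv T (.imp (.imp A B) (.imp (.neg B) (.neg A))) := by
  refine trans ?_ (contra (.neg A) (.neg B))
  refine curry ?_
  refine trans (mp' (and_left _ _) ?_) (dni B)
  exact trans (and_right _ _) (dne A)

theorem imp_neg_of_not_and (h : KProv T (.neg (.and D B))) : KProv T (.imp D (.neg B)) :=
  mp' (trans (and_intro D B) (contrapose _ _)) (imp_of h D)

theorem imp_of_not_and_neg (h : KProv T (.neg (.and D (.neg B)))) : KProv T (.imp D B) :=
  trans (imp_neg_of_not_and h) (dne B)

theorem not_of_imp (h : KProv T (.imp D B)) (h' : KProv T (.imp D (.neg B))) :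
    KProv T (.neg D) := by
  have h₁ : KProv T (.imp D (.neg (.imp D D))) :=
    mp' (mp' (imp_of (efq B (.neg (.imp D D))) D) h') h
  exact mp (mp (contra (.neg D) (.imp D D)) (trans (dne D) h₁)) (imp_self D)

theorem instN (h : KProv T A) (t : NTerm) : KProv T (A.subst (scons t var) id) := by
  have := mp (allN_elim A t) (genN h)
  rwa [atN_eq] at this

theorem instO (h : KProv T A) (β : ℕ) : KProv T (A.subst var (scons β id)) := by
  have := mp (allO_elim A β) (genO h)
  rwa [atO_eq] at this

/-- The calculus instantiates one variable at a time, so the simultaneous substitution is built by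
treating the variables `0, 1, …` in turn up to the support of the formula. -/
theorem substN (h : KProv T A) (σ : ℕ → NTerm) : KProv T (A.subst σ id) := by
  have main : ∀ (n : ℕ) (σ : ℕ → NTerm) (A : KForm), KProv T A →
      KProv T (A.subst (fun i => if i < n then σ i else var (i - n)) id) := by
    intro n
    induction n with
    | zero => intro σ A h; simpa [subst_id] using h
    | succ n ih =>
      intro σ A h
      -- The remaining `n` instantiations lower the other variables by `n`, so the term inserted now
      -- is raised by `n` in advance.
      have := ih (fun i => σ (i + 1)) _ (h.instN ((σ 0).subst fun j => var (j + n)))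
      rw [KForm.subst_subst, Function.comp_id] at this
      convert this using 2
      funext i
      cases i with
      | zero => simp [scons, NTerm.subst_subst, NTerm.subst, subst_var]
      | succ i => simp [scons, NTerm.subst]
  obtain ⟨n, hn⟩ := A.exists_support
  rw [hn σ _ id id (fun i hi => (if_pos hi).symm) fun _ _ => rfl]
  exact main n σ A h

theorem substO (h : KProv T A) (ρ : ℕ → ℕ) : KProv T (A.subst var ρ) := by
  have main : ∀ (n : ℕ) (ρ : ℕ → ℕ) (A : KForm), KProv T A →
      KProv T (A.subst var (fun i => if i < n then ρ i else i - n)) := by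
    intro n
    induction n with
    | zero =>
      intro ρ A h
      simpa using (subst_id A).symm ▸ h
    | succ n ih =>
      intro ρ A h
      have := ih (fun i => ρ (i + 1)) _ (h.instO (ρ 0 + n))
      rw [KForm.subst_subst] at this
      convert this using 1
      congr 1
      funext i
      cases i with
      | zero => simp [scons]
      | succ i => simp [scons]; rfl
  obtain ⟨n, hn⟩ := A.exists_support
  rw [hn var var ρ _ (fun _ _ => rfl) fun i hi => (if_pos hi).symm]
  exact main n ρ A h

theorem substNO (h : KProv T A) (σ : ℕ → NTerm) (ρ : ℕ → ℕ) : KProv T (A.subst σ ρ) := by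
  have := (h.substN σ).substO ρ
  rw [KForm.subst_subst] at this
  simpa only [subst_var, Function.comp_id] using this

/-- Generalization over a fresh number variable. -/
theorem exists_freshN (D C : KForm) :
    ∃ i, KProv T (.imp D (C.atN 0 (var i))) → KProv T (.imp D (.allN C)) := by
  obtain ⟨n, hn⟩ := D.exists_support
  obtain ⟨m, hm⟩ := C.exists_support
  -- The index `n + m` lies beyond both supports. Renaming it to `0` and shifting all other
  -- variables turns the instance into `C` itself, ready for generalization.
  refine ⟨n + m, fun h => mp (allN_distr _ _) (genN ?_)⟩
  have := h.substN fun j => if j = n + m then var 0 else var (j + 1)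
  convert this using 1
  simp only [KForm.subst, atN_eq, KForm.subst_subst, Function.comp_id, shiftN]
  congr 1
  · refine hn _ _ _ _ (fun i hi => ?_) fun _ _ => rfl
    rw [if_neg (by omega)]
  · refine (subst_id C).symm.trans (hm _ _ _ _ (fun i hi => ?_) fun _ _ => rfl)
    cases i with
    | zero => simp [scons, NTerm.subst]
    | succ i =>
      have : i ≠ n + m := by omega
      simp [scons, NTerm.subst, this]

/-- Generalization over a fresh ordinal variable. -/
theorem exists_freshO (D C : KForm) :
    ∃ i, KProv T (.imp D (C.atO 0 i)) → KProv T (.imp D (.allO C)) := by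
  obtain ⟨n, hn⟩ := D.exists_support
  obtain ⟨m, hm⟩ := C.exists_support
  refine ⟨n + m, fun h => mp (allO_distr _ _) (genO ?_)⟩
  have := h.substO fun j => if j = n + m then 0 else j + 1
  convert this using 1
  simp only [KForm.subst, atO_eq, KForm.subst_subst, subst_var, shiftO]
  congr 1
  · refine hn _ _ _ _ (fun _ _ => rfl) fun i hi => ?_
    rw [if_neg (by omega)]
  · refine (subst_id C).symm.trans (hm _ _ _ _ (fun _ _ => rfl) fun i hi => ?_)
    cases i with
    | zero => simp [scons]
    | succ i =>
      have : i ≠ n + m := by omega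
      simp [scons, this]

end KProv

/-! ## Models and completeness -/

theorem scons_comp {α β : Type*} (f : α → β) (a : α) (σ : ℕ → α) :
    (scons (f a) fun i => f (σ i)) = fun i => f (scons a σ i) := by
  funext i; cases i <;> rfl

/-- Structures for the two-sorted language, with standard equality on both sorts. -/
structure KModel where
  N : Type
  O : Type
  fn : {n : ℕ} → PR n → (Fin n → N) → N
  lt : O → O → Prop
  P : O → N → Prop

namespace KModel

def eval (M : KModel) (v : ℕ → M.N) : NTerm → M.N
  | .var i => v i
  | .fn f ts => M.fn f (fun i => M.eval v (ts i))

def sat (M : KModel) : KForm → (ℕ → M.N) → (ℕ → M.O) → Prop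
  | .eqN s t, v, _ => M.eval v s = M.eval v t
  | .eqO α β, _, o => o α = o β
  | .lt α β, _, o => M.lt (o α) (o β)
  | .P α t, v, o => M.P (o α) (M.eval v t)
  | .neg A, v, o => ¬ M.sat A v o
  | .and A B, v, o => M.sat A v o ∧ M.sat B v o
  | .imp A B, v, o => M.sat A v o → M.sat B v o
  | .allN A, v, o => ∀ x, M.sat A (scons x v) o
  | .allO A, v, o => ∀ α, M.sat A v (scons α o)

/-- `M` is a model of the universal closures of the formulas in `T`. -/
def Models (M : KModel) (T : KForm → Prop) : Prop :=
  ∀ A, T A → ∀ v o, M.sat A v o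

end KModel

/-- Complete theories in which each false universal formula has a variable as a counterexample. -/
structure Henkin (T Φ : KForm → Prop) : Prop where
  prov {A} : KProv T A → Φ A
  mp {A B} : Φ (.imp A B) → Φ A → Φ B
  not_both {A} : Φ A → ¬ Φ (.neg A)
  total (A) : Φ A ∨ Φ (.neg A)
  allN {A} : (∀ i, Φ (A.atN 0 (.var i))) → Φ (.allN A)
  allO {A} : (∀ i, Φ (A.atO 0 i)) → Φ (.allO A)

namespace KProv
variable {T : KForm → Prop}

/-- One step in the construction of a Henkin theory: decide `B`, with a witness. -/
theorem exists_decide {D : KForm} (hD : ¬ KProv T (.neg D)) (B : KForm) :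
    ∃ D', ¬ KProv T (.neg D') ∧ KProv T (.imp D' D) ∧ (KProv T (.imp D' B) ∨
      (KProv T (.imp D' (.neg B)) ∧
        (∀ C, B = .allN C → ∃ i, KProv T (.imp D' (.neg (C.atN 0 (.var i))))) ∧
        ∀ C, B = .allO C → ∃ i, KProv T (.imp D' (.neg (C.atO 0 i))))) := by
  by_cases h : KProv T (.neg (.and D B))
  -- `D` already refutes `B`. If `B` is universal, a counterexample at a fresh variable is added;
  -- were this inconsistent, `D` would prove the instance at a fresh variable, hence `B`.
  · have h' := imp_neg_of_not_and h
    by_cases hN : ∃ C, B = .allN C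
    · obtain ⟨C, rfl⟩ := hN
      obtain ⟨i, hi⟩ := exists_freshN (T := T) D C
      refine ⟨.and D (.neg (C.atN 0 (.var i))), fun hh => ?_, and_left _ _,
        .inr ⟨trans (and_left _ _) h', ?_, ?_⟩⟩
      · exact hD (not_of_imp (hi (imp_of_not_and_neg hh)) h')
      · rintro C' ⟨⟩; exact ⟨i, and_right _ _⟩
      · rintro C' ⟨⟩
    · by_cases hO : ∃ C, B = .allO C
      · obtain ⟨C, rfl⟩ := hO
        obtain ⟨i, hi⟩ := exists_freshO (T := T) D C
        refine ⟨.and D (.neg (C.atO 0 i)), fun hh => ?_, and_left _ _,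
          .inr ⟨trans (and_left _ _) h', ?_, ?_⟩⟩
        · exact hD (not_of_imp (hi (imp_of_not_and_neg hh)) h')
        · rintro C' ⟨⟩
        · rintro C' ⟨⟩; exact ⟨i, and_right _ _⟩
      · exact ⟨D, hD, imp_self D, .inr ⟨h', fun C hC => (hN ⟨C, hC⟩).elim,
          fun C hC => (hO ⟨C, hC⟩).elim⟩⟩
  · exact ⟨.and D B, h, and_left _ _, .inl (and_right _ _)⟩

theorem exists_henkin {A : KForm} (hA : ¬ KProv T A) : ∃ Φ, Henkin T Φ ∧ Φ (.neg A) := by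
  have : Nonempty KForm := ⟨A⟩
  obtain ⟨e, he⟩ := exists_surjective_nat KForm
  choose next hcon himp hdec using
    fun (D : {D : KForm // ¬ KProv T (.neg D)}) (B : KForm) => exists_decide D.2 B
  -- Each step of the construction is a single formula consistent with `T`: it starts from the
  -- negation of `A`, and step `n` decides the formula `e n`.
  let D : ℕ → {D : KForm // ¬ KProv T (.neg D)} := fun n =>
    Nat.rec ⟨.neg A, fun h => hA (mp (dne A) h)⟩ (fun n D => ⟨next D (e n), hcon D (e n)⟩) n
  have hle : ∀ m n, m ≤ n → KProv T (.imp (D n).1 (D m).1) := by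
    intro m n hmn
    induction n, hmn using Nat.le_induction with
    | base => exact imp_self _
    | succ n _ ih => exact trans (himp (D n) (e n)) ih
  have hmp : ∀ {B C}, (∃ n, KProv T (.imp (D n).1 (.imp B C))) →
      (∃ n, KProv T (.imp (D n).1 B)) → ∃ n, KProv T (.imp (D n).1 C) := by
    rintro B C ⟨m, hm⟩ ⟨n, hn⟩
    exact ⟨max m n, mp' (trans (hle _ _ (le_max_left _ _)) hm)
      (trans (hle _ _ (le_max_right _ _)) hn)⟩
  have hnb : ∀ {B}, (∃ n, KProv T (.imp (D n).1 B)) → ¬ ∃ n, KProv T (.imp (D n).1 (.neg B)) := by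
    rintro B ⟨m, hm⟩ ⟨n, hn⟩
    exact (D (max m n)).2 (not_of_imp (trans (hle _ _ (le_max_left _ _)) hm)
      (trans (hle _ _ (le_max_right _ _)) hn))
  refine ⟨fun B => ∃ n, KProv T (.imp (D n).1 B),
    ⟨fun h => ⟨0, imp_of h _⟩, hmp, hnb, fun B => ?_, fun {B} h => ?_, fun {B} h => ?_⟩,
    0, imp_self _⟩
  · obtain ⟨n, rfl⟩ := he B
    exact (hdec (D n) (e n)).imp (fun h => ⟨n + 1, h⟩) fun h => ⟨n + 1, h.1⟩
  · obtain ⟨n, hn⟩ := he (.allN B)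
    rcases hdec (D n) (e n) with h' | h'
    · exact ⟨n + 1, hn ▸ h'⟩
    · obtain ⟨i, hi⟩ := h'.2.1 B hn
      exact (hnb (h i) ⟨n + 1, hi⟩).elim
  · obtain ⟨n, hn⟩ := he (.allO B)
    rcases hdec (D n) (e n) with h' | h'
    · exact ⟨n + 1, hn ▸ h'⟩
    · obtain ⟨i, hi⟩ := h'.2.2 B hn
      exact (hnb (h i) ⟨n + 1, hi⟩).elim

end KProv

/-! ### The term model of a Henkin theory and the truth lemma -/

namespace Henkin
open KForm NTerm
variable {T Φ : KForm → Prop} (H : Henkin T Φ)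
include H

theorem neg_iff (A : KForm) : Φ (.neg A) ↔ ¬ Φ A :=
  ⟨fun h h' => H.not_both h' h, fun h => (H.total A).resolve_left h⟩

theorem imp_iff (A B : KForm) : Φ (.imp A B) ↔ (Φ A → Φ B) := by
  refine ⟨H.mp, fun h => ?_⟩
  rcases H.total A with hA | hA
  · exact H.mp (H.prov (.imp_k _ _)) (h hA)
  · exact H.mp (H.prov (.efq _ _)) hA

theorem and_iff (A B : KForm) : Φ (.and A B) ↔ Φ A ∧ Φ B :=
  ⟨fun h => ⟨H.mp (H.prov (.and_left _ _)) h, H.mp (H.prov (.and_right _ _)) h⟩,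
    fun h => H.mp (H.mp (H.prov (.and_intro _ _)) h.1) h.2⟩

theorem allN_iff (A : KForm) : Φ (.allN A) ↔ ∀ t, Φ (A.atN 0 t) :=
  ⟨fun h t => H.mp (H.prov (.allN_elim A t)) h, fun h => H.allN fun i => h (.var i)⟩

theorem allO_iff (A : KForm) : Φ (.allO A) ↔ ∀ i, Φ (A.atO 0 i) :=
  ⟨fun h t => H.mp (H.prov (.allO_elim A t)) h, fun h => H.allO fun i => h i⟩

theorem rewriteN {s t : NTerm} (h : Φ (.eqN s t)) (A : KForm)
    (hs : Φ (A.subst (scons s var) id)) : Φ (A.subst (scons t var) id) := by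
  have := H.mp (H.mp (H.prov (.eqN_subst A s t)) h) (by rwa [atN_eq])
  rwa [atN_eq] at this

theorem rewriteO {α β : ℕ} (h : Φ (.eqO α β)) (A : KForm)
    (hs : Φ (A.subst var (scons α id))) : Φ (A.subst var (scons β id)) := by
  have := H.mp (H.mp (H.prov (.eqO_subst A α β)) h) (by rwa [atO_eq])
  rwa [atO_eq] at this

theorem symmN {s t : NTerm} (h : Φ (.eqN s t)) : Φ (.eqN t s) := by
  have := H.rewriteN h (.eqN (.var 0) (s.subst fun i => .var (i + 1)))
  simp only [KForm.subst, NTerm.subst_subst, NTerm.subst, scons, subst_var] at this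
  exact this (H.prov (.eqN_refl s))

theorem transN {r s t : NTerm} (h : Φ (.eqN r s)) (h' : Φ (.eqN s t)) : Φ (.eqN r t) := by
  have := H.rewriteN h' (.eqN (r.subst fun i => .var (i + 1)) (.var 0))
  simp only [KForm.subst, NTerm.subst_subst, NTerm.subst, scons, subst_var] at this
  exact this h

theorem symmO {α β : ℕ} (h : Φ (.eqO α β)) : Φ (.eqO β α) :=
  H.rewriteO h (.eqO 0 (α + 1)) (H.prov (.eqO_refl α))

theorem transO {α β γ : ℕ} (h : Φ (.eqO α β)) (h' : Φ (.eqO β γ)) : Φ (.eqO α γ) :=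
  H.rewriteO h' (.eqO (α + 1) 0) h

/-- The equality axiom replaces one variable at a time, so the arguments are exchanged successively:
in `main` the first `k` of them have been replaced. -/
theorem congr_fn {n : ℕ} (f : PR n) (ss ts : Fin n → NTerm) (h : ∀ i, Φ (.eqN (ss i) (ts i))) :
    Φ (.eqN (.fn f ss) (.fn f ts)) := by
  have main : ∀ k ≤ n, Φ (.eqN (.fn f ss) (.fn f fun i => if i.1 < k then ts i else ss i)) := by
    intro k
    induction k with
    | zero => intro _; simpa using H.prov (.eqN_refl (.fn f ss))
    | succ k ih =>
      intro hk
      have := H.rewriteN (h ⟨k, hk⟩) (.eqN ((fn f ss).subst fun i => .var (i + 1))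
        (.fn f fun i => if i.1 < k then (ts i).subst (fun i => .var (i + 1)) else
          if i.1 = k then .var 0 else (ss i).subst (fun i => .var (i + 1))))
      simp only [KForm.subst, NTerm.subst_subst, NTerm.subst, scons, subst_var,
        apply_ite (NTerm.subst _)] at this
      have h₁ := this (by
        convert ih (by omega) using 3
        funext i
        split_ifs with h₁ h₂
        · rfl
        · exact congrArg ss (Fin.ext h₂.symm)
        · rfl)
      convert h₁ using 3
      funext i
      by_cases h₁ : i.1 < k
      · simp [h₁, Nat.lt_succ_of_lt h₁]
      · by_cases h₂ : i.1 = k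
        · have : i = ⟨k, hk⟩ := Fin.ext h₂
          simp [this]
        · have : ¬ i.1 < k + 1 := by omega
          simp [*]
  simpa using main n le_rfl

def setoidN : Setoid NTerm :=
  ⟨fun s t => Φ (.eqN s t), fun t => H.prov (.eqN_refl t), H.symmN, H.transN⟩

def setoidO : Setoid ℕ :=
  ⟨fun s t => Φ (.eqO s t), fun t => H.prov (.eqO_refl t), H.symmO, H.transO⟩

/-- The term model of a Henkin theory. -/
noncomputable def model : KModel where
  N := Quotient H.setoidN
  O := Quotient H.setoidO
  fn f v := Quotient.mk H.setoidN (.fn f fun i => (v i).out)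
  lt α β := Φ (.lt α.out β.out)
  P α x := Φ (.P α.out x.out)

/-- The elements of the term model named by terms, and by ordinal variables. -/
def clsN (t : NTerm) : H.model.N := Quotient.mk H.setoidN t
def clsO (α : ℕ) : H.model.O := Quotient.mk H.setoidO α

theorem exists_clsN (x : H.model.N) : ∃ t, H.clsN t = x := Quotient.exists_rep x

theorem exists_clsO (x : H.model.O) : ∃ α, H.clsO α = x := Quotient.exists_rep x

theorem clsN_eq {s t : NTerm} : H.clsN s = H.clsN t ↔ Φ (.eqN s t) :=
  Quotient.eq (r := H.setoidN)

theorem clsO_eq {α β : ℕ} : H.clsO α = H.clsO β ↔ Φ (.eqO α β) :=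
  Quotient.eq (r := H.setoidO)

theorem outN (t : NTerm) : Φ (.eqN (Quotient.out (H.clsN t)) t) :=
  Quotient.exact (s := H.setoidN) (Quotient.out_eq _)

theorem outO (α : ℕ) : Φ (.eqO (Quotient.out (H.clsO α)) α) :=
  Quotient.exact (s := H.setoidO) (Quotient.out_eq _)

theorem model_eval (σ : ℕ → NTerm) (t : NTerm) :
    H.model.eval (fun i => H.clsN (σ i)) t = H.clsN (t.subst σ) := by
  induction t with
  | var i => rfl
  | fn f ts ih =>
    refine Quotient.sound (s := H.setoidN) (H.congr_fn f _ _ fun i => ?_)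
    simp only [ih i]
    exact H.outN _

theorem lt_congr {α α' β β' : ℕ} (h : Φ (.eqO α α')) (h' : Φ (.eqO β β')) (hl : Φ (.lt α β)) :
    Φ (.lt α' β') :=
  H.rewriteO h' (.lt (α' + 1) 0) (H.rewriteO h (.lt 0 (β + 1)) hl)

theorem P_congr {α α' : ℕ} {s t : NTerm} (h : Φ (.eqO α α')) (h' : Φ (.eqN s t))
    (hl : Φ (.P α s)) : Φ (.P α' t) := by
  have h₁ := H.rewriteN h' (.P α (.var 0)) hl
  have h₂ := H.rewriteO h (.P 0 t)
  simp only [KForm.subst, subst_var] at h₂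
  exact h₂ h₁

/-- The truth lemma. Every element of the term model is the class of a term or of an ordinal
variable, so assignments may be given as substitutions, and the quantifier cases reduce to the
Henkin property. -/
theorem model_sat (A : KForm) (σ : ℕ → NTerm) (ρ : ℕ → ℕ) :
    H.model.sat A (fun i => H.clsN (σ i)) (fun i => H.clsO (ρ i)) ↔
      Φ (A.subst σ ρ) := by
  induction A generalizing σ ρ with
  | eqN s t =>
    simp only [KModel.sat, model_eval, clsN_eq, KForm.subst]
  | eqO α β => exact H.clsO_eq
  | lt α β =>
    exact ⟨H.lt_congr (H.outO _) (H.outO _), H.lt_congr (H.symmO (H.outO _)) (H.symmO (H.outO _))⟩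
  | P α t =>
    simp only [KModel.sat, model_eval]
    exact ⟨H.P_congr (H.outO _) (H.outN _), H.P_congr (H.symmO (H.outO _)) (H.symmN (H.outN _))⟩
  | neg A ih => simp only [KModel.sat, KForm.subst, H.neg_iff, ih]
  | and A B ih₁ ih₂ => simp only [KModel.sat, KForm.subst, H.and_iff, ih₁, ih₂]
  | imp A B ih₁ ih₂ => simp only [KModel.sat, KForm.subst, H.imp_iff, ih₁, ih₂]
  | allN A ih =>
    simp only [KModel.sat, KForm.subst, H.allN_iff, atN_eq, KForm.subst_subst, Function.id_comp]
    refine ⟨fun h t => ?_, fun h x => ?_⟩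
    · have := h (H.clsN t)
      rw [scons_comp, ih] at this
      rwa [← up_scons] at this
    · obtain ⟨t, rfl⟩ := H.exists_clsN x
      rw [scons_comp, ih, ← up_scons]
      exact h t
  | allO A ih =>
    have key : ∀ β, (scons β fun i => i + 0) ∘ upO ρ = scons β ρ := by
      intro β; funext i; cases i <;> rfl
    simp only [KModel.sat, KForm.subst, H.allO_iff, atO_eq, KForm.subst_subst, subst_var, key]
    refine ⟨fun h t => ?_, fun h x => ?_⟩
    · have := h (H.clsO t)
      rwa [scons_comp, ih] at this
    · obtain ⟨t, rfl⟩ := H.exists_clsO x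
      rw [scons_comp, ih]
      exact h t

/-- An arbitrary assignment is named by a substitution, and derivability is closed under
substitution. -/
theorem model_models : H.model.Models T := by
  intro A hA v o
  choose σ hσ using fun i => H.exists_clsN (v i)
  choose ρ hρ using fun i => H.exists_clsO (o i)
  rw [← funext hσ, ← funext hρ, H.model_sat]
  exact H.prov (KProv.substNO (.ax hA) _ _)

end Henkin

/-- Completeness: a formula that holds in all models of `T` is derivable from `T`. -/
theorem KProv.of_models {T : KForm → Prop} {A : KForm}
    (h : ∀ M : KModel, M.Models T → ∀ v o, M.sat A v o) : KProv T A := by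
  by_contra hA
  obtain ⟨Φ, H, hΦ⟩ := KProv.exists_henkin hA
  have := (H.model_sat A .var id).1 (h H.model H.model_models _ _)
  rw [KForm.subst_id] at this
  exact H.not_both this hΦ

/-! ## Definability in a model -/

namespace KModel
variable {M : KModel}

theorem eval_subst (σ : ℕ → NTerm) (v : ℕ → M.N) (t : NTerm) :
    M.eval v (t.subst σ) = M.eval (fun i => M.eval v (σ i)) t := by
  induction t with
  | var i => rfl
  | fn f ts ih => simp only [NTerm.subst, eval, ih]

theorem sat_subst (A : KForm) (σ : ℕ → NTerm) (ρ : ℕ → ℕ) (v : ℕ → M.N) (o : ℕ → M.O) :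
    M.sat (A.subst σ ρ) v o ↔ M.sat A (fun i => M.eval v (σ i)) (fun i => o (ρ i)) := by
  induction A generalizing σ ρ v o with
  | eqN s t => simp only [KForm.subst, sat, eval_subst]
  | eqO α β => rfl
  | lt α β => rfl
  | P α t => simp only [KForm.subst, sat, eval_subst]
  | neg A ih => simp only [KForm.subst, sat, ih]
  | and A B ih₁ ih₂ => simp only [KForm.subst, sat, ih₁, ih₂]
  | imp A B ih₁ ih₂ => simp only [KForm.subst, sat, ih₁, ih₂]
  | allN A ih =>
    simp only [KForm.subst, sat, ih]
    refine forall_congr' fun x => iff_of_eq (congrArg₂ _ (funext fun i => ?_) rfl)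
    cases i with
    | zero => rfl
    | succ i => exact eval_subst _ _ _
  | allO A ih =>
    simp only [KForm.subst, sat, ih]
    refine forall_congr' fun x => iff_of_eq (congrArg₂ _ rfl (funext fun i => ?_))
    cases i <;> rfl

/-- The valuation that reads variables through `f`, which assigns to each variable either a variable
or a parameter. -/
def env {α : Type} (f : ℕ → ℕ ⊕ α) (v : ℕ → α) (i : ℕ) : α := Sum.elim v id (f i)

/-- Keeps the variables of several formulas or terms apart: `Nat.pair i j` plays the variable `j` of
the `i`-th one. -/
def joinEnv {α : Type} (f : ℕ → ℕ → ℕ ⊕ α) (k : ℕ) : ℕ ⊕ α := f k.unpair.1 k.unpair.2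

theorem env_joinEnv {α : Type} (f : ℕ → ℕ → ℕ ⊕ α) (v : ℕ → α) (i : ℕ) :
    (fun j => env (joinEnv f) v (Nat.pair i j)) = env (f i) v := by
  funext j; simp [env, joinEnv]

open Classical in
/-- Turning variable `0` from a variable read through `f` into a variable in its own right. -/
noncomputable def freeRen {α : Type} (f : ℕ → ℕ ⊕ α) (i : ℕ) : ℕ := if f i = .inl 0 then 0 else i + 1

/-- Once variable `0` has been freed, the other variables move down by one. The value where `f i` is
variable `0` is immaterial, since `freeRen` diverts those indices to `0`. -/
def freeEnv {α : Type} (f : ℕ → ℕ ⊕ α) (i : ℕ) : ℕ ⊕ α := (f i).map Nat.pred id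

theorem env_free {α : Type} (f : ℕ → ℕ ⊕ α) (v : ℕ → α) (x : α) :
    (fun i => scons x (env (freeEnv f) v) (freeRen f i)) = env f (scons x v) := by
  funext i
  unfold freeRen env freeEnv
  split_ifs with h
  · simp [h, scons]
  · rcases h' : f i with (_ | j) | a
    · exact (h h').elim
    · simp [scons, h']
    · simp [scons, h']

/-- Terms with parameters. -/
class DefTerm (t : (ℕ → M.N) → M.N) : Prop where
  out : ∃ s f, ∀ v, t v = M.eval (env f v) s

/-- Ordinal variables and parameters. -/
class DefOrd (a : (ℕ → M.O) → M.O) : Prop where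
  out : ∃ f : ℕ ⊕ M.O, ∀ o, a o = Sum.elim o id f

/-- Relations definable with parameters. -/
class Def (R : (ℕ → M.N) → (ℕ → M.O) → Prop) : Prop where
  out : ∃ A f g, ∀ v o, R v o ↔ M.sat A (env f v) (env g o)

instance (i : ℕ) : DefTerm (M := M) fun v => v i :=
  ⟨.var 0, fun _ => .inl i, fun _ => rfl⟩

instance (x : M.N) : DefTerm fun _ => x :=
  ⟨.var 0, fun _ => .inr x, fun _ => rfl⟩

instance (i : ℕ) : DefOrd (M := M) fun o => o i := ⟨.inl i, fun _ => rfl⟩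

instance (α : M.O) : DefOrd fun _ => α := ⟨.inr α, fun _ => rfl⟩

theorem DefTerm.fn {n : ℕ} (f : PR n) (ts : Fin n → (ℕ → M.N) → M.N) (h : ∀ i, DefTerm (ts i)) :
    DefTerm fun v => M.fn f fun i => ts i v := by
  choose s e hs using fun i => (h i).out
  refine ⟨.fn f fun i => (s i).subst fun j => .var (Nat.pair i j),
    joinEnv fun k => if hk : k < n then e ⟨k, hk⟩ else fun _ => .inl 0, fun v => ?_⟩
  simp only [eval, eval_subst, env_joinEnv, hs, Fin.is_lt, dif_pos, Fin.eta]

instance (f : PR 1) (s : (ℕ → M.N) → M.N) [hs : DefTerm s] : DefTerm fun v => M.fn f ![s v] := by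
  have := DefTerm.fn f ![s] (by simpa using hs)
  convert this using 3 with v
  funext i; fin_cases i; rfl

instance (f : PR 2) (s t : (ℕ → M.N) → M.N) [hs : DefTerm s] [ht : DefTerm t] :
    DefTerm fun v => M.fn f ![s v, t v] := by
  have := DefTerm.fn f ![s, t] (by simpa [Fin.forall_fin_two] using ⟨hs, ht⟩)
  convert this using 3 with v
  funext i; fin_cases i <;> rfl

section
variable {R S : (ℕ → M.N) → (ℕ → M.O) → Prop}

theorem Def.congr (h : ∀ v o, R v o ↔ S v o) [hR : Def R] : Def S := by
  obtain ⟨A, f, g, hA⟩ := hR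
  exact ⟨A, f, g, fun v o => (h v o).symm.trans (hA v o)⟩

instance (p : Prop) : Def (M := M) fun _ _ => p := by
  by_cases hp : p
  · exact ⟨.eqN (.var 0) (.var 0), .inl, .inl, fun v o => by simp [sat, hp]⟩
  · exact ⟨.neg (.eqN (.var 0) (.var 0)), .inl, .inl, fun v o => by simp [sat, hp]⟩

instance (s t : (ℕ → M.N) → M.N) [hs : DefTerm s] [ht : DefTerm t] :
    Def (M := M) fun v _ => s v = t v := by
  obtain ⟨s', f, hs⟩ := hs
  obtain ⟨t', g, ht⟩ := ht
  refine ⟨.eqN (s'.subst fun j => .var (Nat.pair 0 j)) (t'.subst fun j => .var (Nat.pair 1 j)),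
    joinEnv (scons f fun _ => g), .inl, fun v o => ?_⟩
  simp only [sat, eval, eval_subst, env_joinEnv, scons, hs, ht]

instance (a b : (ℕ → M.O) → M.O) [ha : DefOrd a] [hb : DefOrd b] :
    Def (M := M) fun _ o => a o = b o := by
  obtain ⟨f, hf⟩ := ha
  obtain ⟨g, hg⟩ := hb
  refine ⟨.eqO 0 1, .inl, scons f fun _ => g, fun v o => ?_⟩
  simp only [sat, env, scons, hf, hg]

instance (a b : (ℕ → M.O) → M.O) [ha : DefOrd a] [hb : DefOrd b] :
    Def (M := M) fun _ o => M.lt (a o) (b o) := by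
  obtain ⟨f, hf⟩ := ha
  obtain ⟨g, hg⟩ := hb
  refine ⟨.lt 0 1, .inl, scons f fun _ => g, fun v o => ?_⟩
  simp only [sat, env, scons, hf, hg]

instance (a : (ℕ → M.O) → M.O) (t : (ℕ → M.N) → M.N) [ha : DefOrd a] [ht : DefTerm t] :
    Def (M := M) fun v o => M.P (a o) (t v) := by
  obtain ⟨f, hf⟩ := ha
  obtain ⟨t', g, ht⟩ := ht
  exact ⟨.P 0 t', g, fun _ => f, fun v o => by simp only [sat, env, hf, ht]⟩

instance Def.not [hR : Def R] : Def fun v o => ¬ R v o := by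
  obtain ⟨A, f, g, hA⟩ := hR
  exact ⟨.neg A, f, g, fun v o => not_congr (hA v o)⟩

instance Def.and [hR : Def R] [hS : Def S] : Def fun v o => R v o ∧ S v o := by
  obtain ⟨A, f, g, hA⟩ := hR
  obtain ⟨B, f', g', hB⟩ := hS
  refine ⟨.and (A.subst (fun j => .var (Nat.pair 0 j)) fun j => Nat.pair 0 j)
    (B.subst (fun j => .var (Nat.pair 1 j)) fun j => Nat.pair 1 j),
    joinEnv (scons f fun _ => f'), joinEnv (scons g fun _ => g'), fun v o => ?_⟩
  simp only [sat, sat_subst, eval, env_joinEnv, scons, hA, hB]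

instance Def.imp [Def R] [Def S] : Def fun v o => R v o → S v o :=
  Def.congr (R := fun v o => ¬ (R v o ∧ ¬ S v o)) fun _ _ => not_and_not_right

instance Def.or [Def R] [Def S] : Def fun v o => R v o ∨ S v o :=
  Def.congr (R := fun v o => ¬ R v o → S v o) fun _ _ => or_iff_not_imp_left.symm

theorem Def.exists_formN (R : (ℕ → M.N) → (ℕ → M.O) → Prop) [hR : Def R] : ∃ A f g, ∀ x v o,
    R (scons x v) o ↔ M.sat A (scons x (env f v)) (env g o) := by
  obtain ⟨A, f, g, hA⟩ := hR
  refine ⟨A.subst (fun i => .var (freeRen f i)) id, freeEnv f, g, fun x v o => ?_⟩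
  simp only [sat_subst, hA, eval, id, env_free]

theorem Def.exists_formO (R : (ℕ → M.N) → (ℕ → M.O) → Prop) [hR : Def R] : ∃ A f g, ∀ α v o,
    R v (scons α o) ↔ M.sat A (env f v) (scons α (env g o)) := by
  obtain ⟨A, f, g, hA⟩ := hR
  refine ⟨A.subst .var (freeRen g), f, freeEnv g, fun x v o => ?_⟩
  simp only [sat_subst, hA, eval, env_free]

instance Def.allN (R : M.N → (ℕ → M.N) → (ℕ → M.O) → Prop)
    [Def fun v o => R (v 0) (fun i => v (i + 1)) o] : Def fun v o => ∀ x, R x v o := by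
  obtain ⟨A, f, g, hA⟩ := Def.exists_formN fun v o => R (v 0) (fun i => v (i + 1)) o
  exact ⟨.allN A, f, g, fun v o => forall_congr' fun x => hA x v o⟩

instance Def.allO (R : M.O → (ℕ → M.N) → (ℕ → M.O) → Prop)
    [Def fun v o => R (o 0) v (fun i => o (i + 1))] : Def fun v o => ∀ α, R α v o := by
  obtain ⟨A, f, g, hA⟩ := Def.exists_formO fun v o => R (o 0) v (fun i => o (i + 1))
  exact ⟨.allO A, f, g, fun v o => forall_congr' fun x => hA x v o⟩

instance Def.exN (R : M.N → (ℕ → M.N) → (ℕ → M.O) → Prop)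
    [Def fun v o => R (v 0) (fun i => v (i + 1)) o] : Def fun v o => ∃ x, R x v o :=
  Def.congr (R := fun v o => ¬ ∀ x, ¬ R x v o) fun _ _ => by push Not; rfl

instance Def.exO (R : M.O → (ℕ → M.N) → (ℕ → M.O) → Prop)
    [Def fun v o => R (o 0) v (fun i => o (i + 1))] : Def fun v o => ∃ α, R α v o :=
  Def.congr (R := fun v o => ¬ ∀ α, ¬ R α v o) fun _ _ => by push Not; rfl

/-- Definability survives substitution of definable terms; this yields the instances below for `Q (t
v)` with a named set or relation `Q`. -/
theorem Def.comp [hR : Def R] (σ : ℕ → (ℕ → M.N) → M.N) (τ : ℕ → (ℕ → M.O) → M.O)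
    (hσ : ∀ i, DefTerm (σ i)) (hτ : ∀ i, DefOrd (τ i)) :
    Def fun v o => R (fun i => σ i v) (fun i => τ i o) := by
  obtain ⟨A, f, g, hA⟩ := hR
  choose s e hs using fun i => (hσ i).out
  choose e' ht using fun i => (hτ i).out
  -- Block `0` of the joined environment holds the parameters of `A`, and block `j + 1` the
  -- environment of the term that replaces variable `j`.
  refine ⟨A.subst (fun i => (f i).elim (fun j => (s j).subst fun k => .var (Nat.pair (j + 1) k))
    fun _ => .var (Nat.pair 0 i)) id, joinEnv (scons f e),
    fun i => (g i).elim e' .inr, fun v o => (hA _ _).trans ?_⟩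
  rw [sat_subst]
  refine iff_of_eq (congrArg₂ _ (funext fun i => ?_) (funext fun i => ?_))
  · rcases h : f i with j | x
    · simp only [env, h, Sum.elim_inl, eval_subst, eval, hs]
      congr 1
      exact (env_joinEnv (scons f e) v (j + 1)).symm
    · simp [env, h, eval, joinEnv, scons]
  · rcases h : g i with j | x
    · simp [env, h, ht]
    · simp [env, h]

/-- Definable sets and relations. -/
class DefSet (Q : M.N → Prop) : Prop where
  out : Def fun v (_ : ℕ → M.O) => Q (v 0)

class DefRel (Q : M.N → M.N → Prop) : Prop where
  out : Def fun v (_ : ℕ → M.O) => Q (v 0) (v 1)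

class DefRel₃ (Q : M.N → M.N → M.N → Prop) : Prop where
  out : Def fun v (_ : ℕ → M.O) => Q (v 0) (v 1) (v 2)

instance (priority := low) (Q : M.N → Prop) [hQ : DefSet Q] (t : (ℕ → M.N) → M.N)
    [ht : DefTerm t] : Def (M := M) fun v _ => Q (t v) :=
  @Def.comp _ _ hQ.out (fun _ => t) (fun i o => o i) (fun _ => ht) inferInstance

instance (priority := low) (Q : M.N → M.N → Prop) [hQ : DefRel Q] (s t : (ℕ → M.N) → M.N)
    [hs : DefTerm s] [ht : DefTerm t] : Def (M := M) fun v _ => Q (s v) (t v) :=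
  @Def.comp _ _ hQ.out (scons s fun _ => t) (fun i o => o i)
    (fun i => by cases i <;> assumption) inferInstance

instance (priority := low) (Q : M.N → M.N → M.N → Prop) [hQ : DefRel₃ Q]
    (r s t : (ℕ → M.N) → M.N) [hr : DefTerm r] [hs : DefTerm s] [ht : DefTerm t] :
    Def (M := M) fun v _ => Q (r v) (s v) (t v) :=
  @Def.comp _ _ hQ.out (scons r (scons s fun _ => t)) (fun i o => o i)
    (fun i => by rcases i with _ | _ | i <;> assumption) inferInstance

end

/-! ## Induction -/

/-- Models of arithmetic. -/
class IsPA (M : KModel) : Prop where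
  nonempty : Nonempty M.O
  models : M.Models PA

instance : Zero M.N := ⟨M.fn .zero ![]⟩

def succ (x : M.N) : M.N := M.fn .succ ![x]

instance (t : (ℕ → M.N) → M.N) [DefTerm t] : DefTerm fun v => succ (t v) :=
  inferInstanceAs (DefTerm fun v => M.fn .succ ![t v])

theorem eval_zero (v : ℕ → M.N) : M.eval v .zero = 0 := by
  simp only [NTerm.zero, eval]
  exact congrArg _ (funext fun i => i.elim0)

theorem eval_succ (v : ℕ → M.N) (t : NTerm) : M.eval v t.succ = succ (M.eval v t) := by
  simp only [NTerm.succ, eval, succ]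
  congr 1; funext i; fin_cases i; rfl

/-- The valuation that extends a finite one by `0`. -/
def extend {n : ℕ} (v : Fin n → M.N) (i : ℕ) : M.N := if h : i < n then v ⟨i, h⟩ else 0

theorem extend_val {n : ℕ} (v : Fin n → M.N) (i : Fin n) : extend v i = v i := by
  simp [extend]

variable [hM : IsPA M]

/-- The induction axiom only covers sets definable with parameters. The parameters of `Q` are values
of variables of the defining formula `A`; the rest of the assignment is filled with arbitrary
dummies. -/
theorem ind {Q : M.N → Prop} [Def fun v (_ : ℕ → M.O) => Q (v 0)] (h0 : Q 0)
    (hs : ∀ x, Q x → Q (succ x)) (x : M.N) : Q x := by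
  obtain ⟨A, f, g, hA⟩ := Def.exists_formN fun v (_ : ℕ → M.O) => Q (v 0)
  have o := Classical.choice hM.nonempty
  have := hM.models _ (.ind A) (env f fun _ => 0) (env g fun _ => o)
  simp only [sat, KForm.atN_eq, sat_subst, id] at this
  refine (hA x (fun _ => 0) fun _ => o).2 (this ⟨?_, fun y hy => ?_⟩ x)
  · convert (hA 0 (fun _ => 0) fun _ => o).1 h0 using 1
    funext i
    cases i with
    | zero => exact eval_zero _
    | succ i => rfl
  · convert (hA (succ y) (fun _ => 0) fun _ => o).1 (hs y ((hA y (fun _ => 0) fun _ => o).2 hy))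
      using 1
    funext i
    cases i with
    | zero => exact eval_succ _ _
    | succ i => rfl

theorem succ_ne_zero (x : M.N) : succ x ≠ 0 := by
  have := hM.models _ .succ_ne_zero (fun _ => x) (fun _ => Classical.choice hM.nonempty)
  simpa only [sat, eval_zero, eval_succ, eval] using this

theorem succ_inj {x y : M.N} : succ x = succ y ↔ x = y := by
  refine ⟨fun h => ?_, fun h => h ▸ rfl⟩
  have := hM.models _ .succ_inj (scons x fun _ => y) (fun _ => Classical.choice hM.nonempty)
  simp only [sat, eval_succ, eval, scons] at this
  exact this h

theorem eq_zero_or_succ (x : M.N) : x = 0 ∨ ∃ y, x = succ y :=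
  ind (Q := fun x => x = 0 ∨ ∃ y, x = succ y) (.inl rfl) (fun x _ => .inr ⟨x, rfl⟩) x

/-! ## Defining equations -/

theorem fn_proj {n : ℕ} (i : Fin n) (v : Fin n → M.N) : M.fn (.proj i) v = v i := by
  have := hM.models _ (.proj i) (extend v) (fun _ => Classical.choice hM.nonempty)
  simpa only [sat, eval, extend_val] using this

theorem fn_comp {m n : ℕ} (f : PR m) (g : Fin m → PR n) (v : Fin n → M.N) :
    M.fn (.comp f g) v = M.fn f fun i => M.fn (g i) v := by
  have := hM.models _ (.comp f g) (extend v) (fun _ => Classical.choice hM.nonempty)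
  simpa only [sat, eval, extend_val] using this

theorem fn_prec_zero {n : ℕ} (f : PR n) (g : PR (n + 2)) (v : Fin n → M.N) :
    M.fn (.prec f g) (Fin.cons 0 v) = M.fn f v := by
  have := hM.models _ (.prec_zero f g) (extend v) (fun _ => Classical.choice hM.nonempty)
  simp only [sat, eval, extend_val] at this
  rw [← this]
  congr 1; funext i
  refine Fin.cases ?_ (fun i => ?_) i
  · exact (eval_zero _).symm
  · exact (extend_val v i).symm

theorem fn_prec_succ {n : ℕ} (f : PR n) (g : PR (n + 2)) (x : M.N) (v : Fin n → M.N) :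
    M.fn (.prec f g) (Fin.cons (succ x) v) =
      M.fn g (Fin.cons x (Fin.cons (M.fn (.prec f g) (Fin.cons x v)) v)) := by
  have := hM.models _ (.prec_succ f g) (scons x (extend v))
    (fun _ => Classical.choice hM.nonempty)
  simp only [sat, eval] at this
  have key : ∀ (s : NTerm) (y : M.N), M.eval (scons x (extend v)) s = y →
      (fun i => M.eval (scons x (extend v))
        ((Fin.cons s fun j => .var (j.1 + 1) : Fin (n + 1) → NTerm) i)) = Fin.cons y v := by
    intro s y h
    funext i
    refine Fin.cases h (fun i => ?_) i
    exact extend_val v i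
  rw [key _ (succ x) (eval_succ _ _)] at this
  rw [this]
  congr 1; funext i
  refine Fin.cases rfl (fun i => ?_) i
  refine Fin.cases ?_ (fun i => extend_val v i) i
  simp only [Fin.cons_succ, Fin.cons_zero, eval]
  rw [key (.var 0) x rfl]

theorem fn_comp1 {n : ℕ} (f : PR 1) (g : PR n) (v : Fin n → M.N) :
    M.fn (.comp1 f g) v = M.fn f ![M.fn g v] := by
  rw [PR.comp1, fn_comp]
  congr 1; funext i; fin_cases i; rfl

theorem fn_comp2 {n : ℕ} (f : PR 2) (g h : PR n) (v : Fin n → M.N) :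
    M.fn (.comp2 f g h) v = M.fn f ![M.fn g v, M.fn h v] := by
  rw [PR.comp2, fn_comp]
  congr 1; funext i; fin_cases i <;> rfl

/-- The standard natural numbers of `M`. -/
def ofNat (M : KModel) [IsPA M] : ℕ → M.N
  | 0 => 0
  | n + 1 => succ (M.ofNat n)

theorem fn_const {n : ℕ} (k : ℕ) (v : Fin n → M.N) : M.fn (.const k) v = M.ofNat k := by
  induction k with
  | zero =>
    rw [PR.const, fn_comp]
    exact congrArg _ (funext fun i => i.elim0)
  | succ k ih => rw [PR.const, fn_comp1, ih]; rfl

theorem eval_numeral (v : ℕ → M.N) (k : ℕ) : M.eval v (.numeral k) = M.ofNat k := by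
  induction k with
  | zero => exact eval_zero v
  | succ k ih => rw [NTerm.numeral, eval_succ, ih]; rfl

theorem fn_prec1_zero (f : PR 0) (g : PR 2) : M.fn (.prec f g) ![0] = M.fn f ![] :=
  fn_prec_zero f g ![]

theorem fn_prec1_succ (f : PR 0) (g : PR 2) (x : M.N) :
    M.fn (.prec f g) ![succ x] = M.fn g ![x, M.fn (.prec f g) ![x]] :=
  fn_prec_succ f g x ![]

theorem fn_prec2_zero (f : PR 1) (g : PR 3) (y : M.N) : M.fn (.prec f g) ![0, y] = M.fn f ![y] :=
  fn_prec_zero f g ![y]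

theorem fn_prec2_succ (f : PR 1) (g : PR 3) (x y : M.N) :
    M.fn (.prec f g) ![succ x, y] = M.fn g ![x, M.fn (.prec f g) ![x, y], y] :=
  fn_prec_succ f g x ![y]

end KModel

/-! ## Arithmetic in a model -/

namespace KModel
variable {M : KModel} [hM : IsPA M]

instance : Add M.N := ⟨fun x y => M.fn .add ![x, y]⟩

def sub (x y : M.N) : M.N := M.fn .sub ![x, y]
def tri (x : M.N) : M.N := M.fn .tri ![x]
def pair (x y : M.N) : M.N := M.fn .pair ![x, y]
def row (x : M.N) : M.N := M.fn .row ![x]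
def left (x : M.N) : M.N := M.fn .left ![x]
def right (x : M.N) : M.N := M.fn .right ![x]
def ap (x y : M.N) : M.N := M.fn .ap ![x, y]
def fnPart (x : M.N) : M.N := M.fn .fnPart ![x]
def argPart (x : M.N) : M.N := M.fn .argPart ![x]
def nth (i w : M.N) : M.N := M.fn .nth ![i, w]
def num (x : M.N) : M.N := M.fn .num ![x]

section
variable (s t : (ℕ → M.N) → M.N) [DefTerm s] [DefTerm t]

instance : DefTerm fun v => s v + t v := inferInstanceAs (DefTerm fun v => M.fn .add ![s v, t v])
instance : DefTerm fun v => sub (s v) (t v) :=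
  inferInstanceAs (DefTerm fun v => M.fn .sub ![s v, t v])
instance : DefTerm fun v => tri (s v) := inferInstanceAs (DefTerm fun v => M.fn .tri ![s v])
instance : DefTerm fun v => pair (s v) (t v) :=
  inferInstanceAs (DefTerm fun v => M.fn .pair ![s v, t v])
instance : DefTerm fun v => row (s v) := inferInstanceAs (DefTerm fun v => M.fn .row ![s v])
instance : DefTerm fun v => left (s v) := inferInstanceAs (DefTerm fun v => M.fn .left ![s v])
instance : DefTerm fun v => right (s v) := inferInstanceAs (DefTerm fun v => M.fn .right ![s v])
instance : DefTerm fun v => ap (s v) (t v) :=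
  inferInstanceAs (DefTerm fun v => M.fn .ap ![s v, t v])
instance : DefTerm fun v => nth (s v) (t v) :=
  inferInstanceAs (DefTerm fun v => M.fn .nth ![s v, t v])
instance : DefTerm fun v => num (s v) := inferInstanceAs (DefTerm fun v => M.fn .num ![s v])

end

theorem zero_add' (x : M.N) : 0 + x = x := (fn_prec2_zero _ _ x).trans (fn_proj _ _)

theorem succ_add' (x y : M.N) : succ x + y = succ (x + y) :=
  (fn_prec2_succ _ _ x y).trans ((fn_comp1 _ _ _).trans (by rw [fn_proj]; rfl))

theorem add_zero' (x : M.N) : x + 0 = x :=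
  ind (Q := fun x => x + 0 = x) (zero_add' 0) (fun x h => by rw [succ_add', h]) x

theorem add_succ' (x y : M.N) : x + succ y = succ (x + y) :=
  ind (Q := fun x => ∀ y, x + succ y = succ (x + y)) (fun y => by simp only [zero_add'])
    (fun x h y => by simp only [succ_add', h]) x y

theorem add_comm' (x y : M.N) : x + y = y + x :=
  ind (Q := fun x => ∀ y, x + y = y + x) (fun y => by rw [zero_add', add_zero'])
    (fun x h y => by rw [succ_add', h, add_succ']) x y

theorem add_assoc' (x y z : M.N) : x + y + z = x + (y + z) :=
  ind (Q := fun x => ∀ y z, x + y + z = x + (y + z)) (fun y z => by simp only [zero_add'])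
    (fun x h y z => by simp only [succ_add', h]) x y z

instance : AddCommMonoid M.N where
  add_assoc := add_assoc'
  zero_add := zero_add'
  add_zero := add_zero'
  add_comm := add_comm'
  nsmul := nsmulRec

instance : One M.N := ⟨succ 0⟩

theorem succ_eq (x : M.N) : succ x = x + 1 := by
  rw [show (1 : M.N) = succ 0 from rfl, add_succ', add_zero]

theorem add_left_cancel' {x y z : M.N} : x + y = x + z → y = z :=
  ind (Q := fun x => ∀ y z, x + y = x + z → y = z) (fun y z h => by rwa [zero_add, zero_add] at h)
    (fun x h y z e => h y z (by rwa [succ_add', succ_add', succ_inj] at e)) x y z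

theorem fn_pred_zero : M.fn .pred ![0] = 0 := fn_prec1_zero _ _

theorem fn_pred_succ (x : M.N) : M.fn .pred ![succ x] = x :=
  (fn_prec1_succ _ _ x).trans (fn_proj _ _)

theorem sub_eq (x y : M.N) : sub x y = M.fn .rsub ![y, x] := by
  rw [sub, PR.sub, fn_comp2, fn_proj, fn_proj]; rfl

theorem sub_zero' (x : M.N) : sub x 0 = x := by
  rw [sub_eq]; exact (fn_prec2_zero _ _ x).trans (fn_proj _ _)

theorem sub_succ (x y : M.N) : sub x (succ y) = M.fn .pred ![sub x y] := by
  rw [sub_eq, sub_eq]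
  exact (fn_prec2_succ _ _ y x).trans ((fn_comp1 _ _ _).trans (by rw [fn_proj]; rfl))

theorem succ_sub_succ (x y : M.N) : sub (succ x) (succ y) = sub x y :=
  ind (Q := fun y => sub (succ x) (succ y) = sub x y)
    (by rw [sub_succ, sub_zero', sub_zero', fn_pred_succ])
    (fun y h => by rw [sub_succ, h, sub_succ]) y

theorem zero_sub' (x : M.N) : sub 0 x = 0 :=
  ind (Q := fun x => sub 0 x = 0) (sub_zero' 0)
    (fun x h => by rw [sub_succ, h, fn_pred_zero]) x

theorem add_sub_cancel_left' (x y : M.N) : sub (x + y) x = y :=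
  ind (Q := fun x => sub (x + y) x = y) (by rw [zero_add, sub_zero'])
    (fun x h => by rw [succ_add', succ_sub_succ, h]) x

theorem sub_add_self (x y : M.N) : sub x (x + y) = 0 :=
  ind (Q := fun x => sub x (x + y) = 0) (zero_sub' _)
    (fun x h => by rw [succ_add', succ_sub_succ, h]) x

theorem le_or_lt (x y : M.N) : (∃ d, y = x + d) ∨ ∃ d, x = y + succ d :=
  ind (Q := fun x => ∀ y, (∃ d, y = x + d) ∨ ∃ d, x = y + succ d) (fun y => .inl ⟨y, by simp⟩)
    (fun x h y => by
      rcases eq_zero_or_succ y with rfl | ⟨y, rfl⟩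
      · exact .inr ⟨x, by simp⟩
      · simpa only [succ_add', succ_inj] using h y) x y

theorem add_succ_ne (x d : M.N) : x + succ d ≠ x := fun h => by
  have : x + succ d = x + 0 := by rw [h, add_zero]
  exact succ_ne_zero d (add_left_cancel' this)

/-- The strict order is given by truncated subtraction, exactly as in `OpForm.lt`. It is thus
definable by an atom and its negation, and the semantics of `OpForm.lt` is immediate. -/
noncomputable instance : LinearOrder M.N where
  le x y := ∃ d, y = x + d
  lt x y := sub y x ≠ 0
  le_refl x := ⟨0, (add_zero x).symm⟩
  le_trans := by
    rintro x _ _ ⟨d, rfl⟩ ⟨e, rfl⟩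
    exact ⟨d + e, add_assoc _ _ _⟩
  lt_iff_le_not_ge x y := by
    constructor
    · intro h
      rcases le_or_lt y x with ⟨d, rfl⟩ | ⟨d, rfl⟩
      · exact (h (sub_add_self _ _)).elim
      · refine ⟨⟨_, rfl⟩, ?_⟩
        rintro ⟨e, he⟩
        rw [add_assoc, succ_add'] at he
        exact add_succ_ne x _ he.symm
    · rintro ⟨⟨d, rfl⟩, h⟩ h'
      rw [add_sub_cancel_left'] at h'
      exact h ⟨0, by rw [h', add_zero, add_zero]⟩
  le_antisymm := by
    rintro x _ ⟨d, rfl⟩ ⟨e, he⟩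
    rcases eq_zero_or_succ d with rfl | ⟨d, rfl⟩
    · exact (add_zero x).symm
    · rw [add_assoc, succ_add'] at he
      exact (add_succ_ne x _ he.symm).elim
  le_total x y := (le_or_lt x y).imp_right fun ⟨d, hd⟩ => ⟨_, hd⟩
  toDecidableLE := Classical.decRel _

instance : IsOrderedCancelAddMonoid M.N where
  add_le_add_left := by
    rintro x _ ⟨d, rfl⟩ z
    exact ⟨d, by abel⟩
  le_of_add_le_add_left := by
    rintro x y z ⟨d, hd⟩
    exact ⟨d, add_left_cancel' (by rw [hd, add_assoc])⟩

instance (s t : (ℕ → M.N) → M.N) [DefTerm s] [DefTerm t] : Def (M := M) fun v _ => s v < t v :=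
  inferInstanceAs (Def fun v _ => ¬ sub (t v) (s v) = 0)

instance (s t : (ℕ → M.N) → M.N) [DefTerm s] [DefTerm t] : Def (M := M) fun v _ => s v ≤ t v :=
  Def.congr (R := fun v _ => ¬ t v < s v) fun _ _ => not_lt

theorem lt_iff_sub (x y : M.N) : x < y ↔ sub y x ≠ 0 := Iff.rfl

theorem zero_le' (x : M.N) : 0 ≤ x := ⟨x, (zero_add x).symm⟩

theorem le_self_add' (x y : M.N) : x ≤ x + y := ⟨y, rfl⟩

theorem lt_iff_add_one_le (x y : M.N) : x < y ↔ x + 1 ≤ y := by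
  have h1 : x < x + 1 := by
    rw [← succ_eq, lt_iff_sub, succ_eq, add_sub_cancel_left']; exact succ_ne_zero 0
  refine ⟨fun h => ?_, fun h => h1.trans_le h⟩
  rcases le_or_lt (x + 1) y with h' | ⟨d, hd⟩
  · exact h'
  · obtain ⟨e, rfl⟩ : x ≤ y := h.le
    rw [add_assoc, succ_eq] at hd
    have : (1 : M.N) = e + d + 1 := add_left_cancel' (hd.trans (by abel))
    have h2 : e + d = 0 := by
      have h3 : (1 : M.N) + 0 = 1 + (e + d) := by rw [add_zero, add_comm 1]; exact this
      exact (add_left_cancel' h3).symm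
    have h4 : e = 0 := le_antisymm (h2 ▸ le_self_add' e d) (zero_le' e)
    rw [h4, add_zero] at h
    exact (lt_irrefl _ h).elim

theorem lt_add_one_iff (x y : M.N) : x < y + 1 ↔ x ≤ y := by
  rw [lt_iff_add_one_le]; exact add_le_add_iff_right 1

theorem zero_lt_one' : (0 : M.N) < 1 := (lt_iff_add_one_le 0 1).2 (by rw [zero_add])

theorem pos_of_ne {x : M.N} (h : x ≠ 0) : 0 < x := lt_of_le_of_ne (zero_le' x) h.symm

/-- Course-of-values induction. -/
theorem ind_lt {Q : M.N → Prop} [hQ : Def fun v (_ : ℕ → M.O) => Q (v 0)]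
    (h : ∀ x, (∀ y < x, Q y) → Q x) (x : M.N) : Q x := by
  have : DefSet Q := ⟨hQ⟩
  refine h x (ind (Q := fun x => ∀ y, y < x → Q y) (fun y hy => ?_) (fun x ih y hy => ?_) x)
  · exact (not_lt_of_ge (zero_le' y) hy).elim
  · rw [succ_eq, lt_add_one_iff] at hy
    exact h y fun z hz => ih z (hz.trans_le hy)

/-! ### Pairing -/

theorem tri_zero : tri (0 : M.N) = 0 := fn_prec1_zero _ _

theorem tri_succ (x : M.N) : tri (x + 1) = tri x + x + 1 := by
  rw [← succ_eq]
  refine (fn_prec1_succ _ _ x).trans ((fn_comp2 _ _ _ _).trans ?_)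
  rw [fn_comp1, fn_proj, fn_proj]
  change succ x + tri x = _
  rw [succ_eq]; abel

theorem pair_eq (x y : M.N) : pair x y = tri (x + y) + y := by
  rw [pair, PR.pair, fn_comp2, fn_comp1, fn_comp2, fn_proj, fn_proj]; rfl

theorem row_zero : row (0 : M.N) = 0 := fn_prec1_zero _ _

theorem row_succ (x : M.N) :
    row (x + 1) = row x + sub 1 (sub (tri (row x + 1)) (x + 1)) := by
  rw [← succ_eq x, ← succ_eq]
  refine (fn_prec1_succ _ _ x).trans ?_
  rw [fn_comp2, fn_comp2, fn_comp2, fn_comp1, fn_comp1, fn_comp1, fn_const, fn_proj, fn_proj]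
  rfl

theorem tri_mono {x y : M.N} (h : x ≤ y) : tri x ≤ tri y := by
  obtain ⟨d, rfl⟩ := h
  refine ind (Q := fun d => tri x ≤ tri (x + d)) (by rw [add_zero]) (fun d h => ?_) d
  rw [succ_eq, ← add_assoc, tri_succ]
  have := zero_le' (x + d); have := zero_lt_one' (M := M)
  grind

theorem le_tri (x : M.N) : x ≤ tri x := by
  refine ind (Q := fun x => x ≤ tri x) (zero_le' _) (fun x h => ?_) x
  rw [succ_eq, tri_succ]
  have := zero_le' x
  grind

theorem row_spec (x : M.N) : tri (row x) ≤ x ∧ x < tri (row x + 1) := by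
  refine ind (Q := fun x => tri (row x) ≤ x ∧ x < tri (row x + 1)) ?_ (fun x h => ?_) x
  · rw [row_zero, tri_succ, tri_zero]
    exact ⟨le_rfl, by rw [add_zero, zero_add]; exact zero_lt_one'⟩
  · rw [succ_eq, row_succ]
    obtain ⟨h1, h2⟩ := h
    -- The nested truncated subtraction in `row_succ` is a case switch: it contributes `0` while `x
    -- + 1` is still below the next triangular number, and `1` when that number is reached.
    rcases lt_or_ge (x + 1) (tri (row x + 1)) with h | h
    · obtain ⟨d, hd⟩ : ∃ d, sub (tri (row x + 1)) (x + 1) = succ d :=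
        (eq_zero_or_succ _).resolve_left h
      rw [hd, show (1 : M.N) = succ 0 from rfl, succ_sub_succ, zero_sub', add_zero]
      exact ⟨h1.trans (le_self_add' x _), h⟩
    · obtain ⟨d, hd⟩ := h
      rw [hd, sub_add_self, sub_zero', ← hd]
      refine ⟨⟨d, hd⟩, ?_⟩
      rw [tri_succ]
      have := zero_le' (row x); have := zero_lt_one' (M := M)
      grind

theorem row_unique {x r : M.N} (h : tri r ≤ x) (h' : x < tri (r + 1)) : row x = r := by
  obtain ⟨h1, h2⟩ := row_spec x
  rcases lt_trichotomy (row x) r with h3 | h3 | h3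
  · exact (not_lt_of_ge ((tri_mono ((lt_iff_add_one_le _ _).1 h3)).trans h) h2).elim
  · exact h3
  · exact (not_lt_of_ge ((tri_mono ((lt_iff_add_one_le _ _).1 h3)).trans h1) h').elim

theorem right_eq (x : M.N) : right x = sub x (tri (row x)) := by
  rw [right, PR.right, fn_comp2, fn_comp1, fn_proj]; rfl

theorem left_eq (x : M.N) : left x = sub (row x) (right x) := by
  rw [left, PR.left, fn_comp2]; rfl

theorem row_pair (x y : M.N) : row (pair x y) = x + y := by
  rw [pair_eq]
  refine row_unique (le_self_add' _ _) ?_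
  rw [tri_succ]
  have := zero_le' x; have := zero_lt_one' (M := M)
  grind

theorem right_pair (x y : M.N) : right (pair x y) = y := by
  rw [right_eq, row_pair, pair_eq, add_sub_cancel_left']

theorem left_pair (x y : M.N) : left (pair x y) = x := by
  rw [left_eq, right_pair, row_pair, add_comm, add_sub_cancel_left']

theorem pair_left_right (x : M.N) : pair (left x) (right x) = x := by
  obtain ⟨⟨d, hd⟩, h2⟩ := row_spec x
  have h3 : right x = d := by
    rw [right_eq]; nth_rw 1 [hd]; exact add_sub_cancel_left' _ _
  obtain ⟨e, he⟩ : d ≤ row x := by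
    rw [tri_succ] at h2
    rw [← lt_add_one_iff]
    grind
  rw [pair_eq, left_eq, h3]
  nth_rw 1 [he]
  rw [add_sub_cancel_left', add_comm e d, ← he, ← hd]

theorem pair_inj {x y x' y' : M.N} : pair x y = pair x' y' ↔ x = x' ∧ y = y' := by
  refine ⟨fun h => ?_, fun h => by rw [h.1, h.2]⟩
  constructor
  · rw [← left_pair x y, h, left_pair]
  · rw [← right_pair x y, h, right_pair]

theorem left_le_pair (x y : M.N) : x ≤ pair x y := by
  rw [pair_eq]
  exact ((le_self_add' x y).trans (le_tri _)).trans (le_self_add' _ _)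

theorem right_le_pair (x y : M.N) : y ≤ pair x y := by
  rw [pair_eq, add_comm]
  exact le_self_add' _ _

/-! ### Codes of closed terms -/

theorem ofNat_or (k : ℕ) (x : M.N) : (∃ j < k, x = M.ofNat j) ∨ ∃ d, x = M.ofNat k + d := by
  induction k with
  | zero => exact .inr ⟨x, (zero_add x).symm⟩
  | succ k ih =>
    rcases ih with ⟨j, hj, rfl⟩ | ⟨d, rfl⟩
    · exact .inl ⟨j, by omega, rfl⟩
    · rcases eq_zero_or_succ d with rfl | ⟨d, rfl⟩
      · exact .inl ⟨k, by omega, add_zero _⟩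
      · exact .inr ⟨d, by rw [ofNat, add_succ', succ_add']⟩

theorem ofNat_ne_add {j k : ℕ} (h : j < k) (d : M.N) : M.ofNat j ≠ M.ofNat k + d := by
  induction k generalizing j with
  | zero => omega
  | succ k ih =>
    rw [ofNat, succ_add']
    cases j with
    | zero => exact (succ_ne_zero _).symm
    | succ j => rw [ofNat, Ne, succ_inj]; exact ih (by omega)

theorem ofNat_injective : Function.Injective M.ofNat := by
  intro j k h
  rcases lt_trichotomy j k with h' | h' | h'
  · exact (ofNat_ne_add h' 0 (by rw [h, add_zero])).elim
  · exact h'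
  · exact (ofNat_ne_add h' 0 (by rw [h, add_zero])).elim

def cst (M : KModel) [IsPA M] (c : FConst) : M.N := M.ofNat c.code

theorem code_injective : Function.Injective FConst.code := by
  intro c d h
  cases c <;> cases d <;> first | rfl | (simp [FConst.code] at h)

theorem cst_inj {c d : FConst} : M.cst c = M.cst d ↔ c = d :=
  (ofNat_injective.comp code_injective).eq_iff

theorem ap_eq (x y : M.N) : ap x y = M.ofNat 16 + pair x y := by
  rw [ap, PR.ap, fn_comp2, fn_const]; rfl

theorem code_lt (c : FConst) : c.code < 16 := by cases c <;> decide

theorem exists_code {k : ℕ} (h : k < 16) : ∃ c : FConst, c.code = k := by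
  interval_cases k
  exacts [⟨.k, rfl⟩, ⟨.s, rfl⟩, ⟨.p, rfl⟩, ⟨.p0, rfl⟩, ⟨.p1, rfl⟩, ⟨.zero, rfl⟩, ⟨.sN, rfl⟩,
    ⟨.pN, rfl⟩, ⟨.dN, rfl⟩, ⟨.eqd, rfl⟩, ⟨.negd, rfl⟩, ⟨.andd, rfl⟩, ⟨.impd, rfl⟩, ⟨.alld, rfl⟩,
    ⟨.natd, rfl⟩, ⟨.l, rfl⟩]

theorem cst_ne_ap (c : FConst) (x y : M.N) : M.cst c ≠ ap x y := by
  rw [ap_eq]; exact ofNat_ne_add (code_lt c) _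

theorem ap_inj {x y x' y' : M.N} : ap x y = ap x' y' ↔ x = x' ∧ y = y' := by
  rw [ap_eq, ap_eq, add_right_inj, pair_inj]

theorem fnPart_ap (x y : M.N) : fnPart (ap x y) = x := by
  rw [fnPart, PR.fnPart, fn_comp1, fn_comp2, fn_const, fn_proj]
  change left (sub (ap x y) _) = x
  rw [ap_eq, add_sub_cancel_left', left_pair]

theorem argPart_ap (x y : M.N) : argPart (ap x y) = y := by
  rw [argPart, PR.argPart, fn_comp1, fn_comp2, fn_const, fn_proj]
  change right (sub (ap x y) _) = y
  rw [ap_eq, add_sub_cancel_left', right_pair]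

/-- Holds for nonstandard elements too: below the standard number `16` there are only standard ones,
and everything from `16` on is `16` plus a pair. -/
theorem cst_or_ap (x : M.N) : (∃ c, x = M.cst c) ∨ ∃ a b, x = ap a b := by
  rcases ofNat_or 16 x with ⟨j, hj, rfl⟩ | ⟨d, rfl⟩
  · obtain ⟨c, rfl⟩ := exists_code hj
    exact .inl ⟨c, rfl⟩
  · exact .inr ⟨left d, right d, by rw [ap_eq, pair_left_right]⟩

/-- The offset `16` makes immediate subterms strictly smaller than an application, so
course-of-values induction on codes serves as induction on terms. -/
theorem pair_lt_ap (x y : M.N) : pair x y < ap x y := by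
  rw [ap_eq, ofNat, succ_add', succ_eq, lt_add_one_iff, add_comm]
  exact le_self_add' _ _

theorem num_zero : num (0 : M.N) = M.cst .zero := (fn_prec1_zero _ _).trans (fn_const _ _)

theorem num_succ (x : M.N) : num (succ x) = ap (M.cst .sN) (num x) :=
  (fn_prec1_succ _ _ x).trans ((fn_comp2 _ _ _ _).trans (by rw [fn_const, fn_proj]; rfl))

theorem num_inj {x y : M.N} : num x = num y ↔ x = y := by
  refine ⟨?_, fun h => h ▸ rfl⟩
  refine ind (Q := fun x => ∀ y, num x = num y → x = y) (fun y h => ?_) (fun x ih y h => ?_) x y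
  · rcases eq_zero_or_succ y with rfl | ⟨y, rfl⟩
    · rfl
    · rw [num_zero, num_succ] at h
      exact (cst_ne_ap _ _ _ h).elim
  · rcases eq_zero_or_succ y with rfl | ⟨y, rfl⟩
    · rw [num_zero, num_succ] at h
      exact (cst_ne_ap _ _ _ h.symm).elim
    · rw [num_succ, num_succ, ap_inj] at h
      rw [ih y h.2]

/-! ### Sequences -/

def drop (i w : M.N) : M.N := M.fn (.prec (.proj 0) (.comp1 .right (.proj 1))) ![i, w]

instance (s t : (ℕ → M.N) → M.N) [DefTerm s] [DefTerm t] : DefTerm fun v => drop (s v) (t v) :=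
  inferInstanceAs (DefTerm fun v => M.fn _ ![s v, t v])

theorem drop_zero (w : M.N) : drop 0 w = w := (fn_prec2_zero _ _ w).trans (fn_proj _ _)

theorem drop_succ (i w : M.N) : drop (succ i) w = right (drop i w) :=
  (fn_prec2_succ _ _ i w).trans ((fn_comp1 _ _ _).trans (by rw [fn_proj]; rfl))

theorem nth_eq (i w : M.N) : nth i w = left (drop i w) := by
  rw [nth, PR.nth, fn_comp1]; rfl

theorem drop_succ' (i w : M.N) : drop (succ i) w = drop i (right w) :=
  ind (Q := fun i => drop (succ i) w = drop i (right w))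
    (by rw [drop_succ, drop_zero, drop_zero])
    (fun i h => by rw [drop_succ, h, drop_succ]) i

theorem nth_zero_pair (x w : M.N) : nth 0 (pair x w) = x := by
  rw [nth_eq, drop_zero, left_pair]

theorem nth_succ (i w : M.N) : nth (succ i) w = nth i (right w) := by
  rw [nth_eq, nth_eq, drop_succ']

theorem nth_succ_pair (i x w : M.N) : nth (succ i) (pair x w) = nth i w := by
  rw [nth_succ, right_pair]

/-- Unpairing turns every number into an infinite sequence, so only the length `n` of the first part
matters. The induction on `n` peels off the head and must therefore generalize `w`. -/
theorem exists_append (n w w' : M.N) :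
    ∃ u, (∀ i < n, nth i u = nth i w) ∧ ∀ i, nth (n + i) u = nth i w' := by
  refine ind (Q := fun n => ∀ w, ∃ u, (∀ i, i < n → nth i u = nth i w) ∧
    ∀ i, nth (n + i) u = nth i w') (fun w => ?_) (fun n ih w => ?_) n w
  · exact ⟨w', fun i hi => (not_lt_of_ge (zero_le' i) hi).elim, fun i => by rw [zero_add]⟩
  · obtain ⟨u, h1, h2⟩ := ih (right w)
    refine ⟨pair (left w) u, fun i hi => ?_, fun i => ?_⟩
    · rcases eq_zero_or_succ i with rfl | ⟨i, rfl⟩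
      · rw [nth_zero_pair, nth_eq, drop_zero]
      · rw [nth_succ_pair, nth_succ, h1]
        rw [succ_eq, succ_eq] at hi
        exact lt_of_add_lt_add_right hi
    · rw [succ_add', nth_succ_pair, h2]

end KModel

/-! ## Inductive definitions by coded derivations -/

namespace KModel
variable {M : KModel} [hM : IsPA M]

section Der
variable (Ax : M.N → Prop) (Rule : M.N → M.N → M.N → Prop)

/-- `x` has a coded derivation from the axioms `Ax` by means of `Rule`, where `Rule x y z` allows one
to infer `x` from `y` and `z`. -/
def Der (x : M.N) : Prop := ∃ w n, 0 < n ∧ nth 0 w = x ∧ ∀ i, i < n → (Ax (nth i w) ∨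
  ∃ j k, ((i < j ∧ j < n) ∧ i < k ∧ k < n) ∧ Rule (nth i w) (nth j w) (nth k w))

instance [DefSet Ax] [DefRel₃ Rule] : DefSet (Der Ax Rule) := ⟨by unfold Der; infer_instance⟩

variable {Ax Rule}

theorem Der.ax {x : M.N} (h : Ax x) : Der Ax Rule x := by
  refine ⟨pair x 0, 1, zero_lt_one', nth_zero_pair _ _, fun i hi => .inl ?_⟩
  rw [show (1 : M.N) = 0 + 1 from (zero_add _).symm, lt_add_one_iff] at hi
  rwa [le_antisymm hi (zero_le' _), nth_zero_pair]

theorem Der.rule {x y z : M.N} (h : Rule x y z) (hy : Der Ax Rule y) (hz : Der Ax Rule z) :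
    Der Ax Rule x := by
  obtain ⟨w, n, hn, rfl, hw⟩ := hy
  obtain ⟨w', n', hn', rfl, hw'⟩ := hz
  obtain ⟨u, h1, h2⟩ := exists_append n w w'
  have hpos : (0 : M.N) < 1 := zero_lt_one'
  refine ⟨pair x u, succ (n + n'), pos_of_ne (succ_ne_zero _), nth_zero_pair _ _, fun i hi => ?_⟩
  rcases eq_zero_or_succ i with rfl | ⟨i, rfl⟩
  -- The new derivation is the conclusion followed by the two given ones, so the premises stand at
  -- positions `1` and `1 + n`.
  · refine .inr ⟨succ 0, succ n, ⟨⟨?_, ?_⟩, ?_, ?_⟩, ?_⟩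
    iterate 4 simp only [succ_eq]; grind
    rw [nth_zero_pair, nth_succ_pair, nth_succ_pair, h1 0 hn]
    have := h2 0
    rw [add_zero] at this
    rwa [this]
  · have hi' : i < n + n' := by simp only [succ_eq] at hi; grind
    rw [nth_succ_pair]
    rcases lt_or_ge i n with h3 | ⟨d, rfl⟩
    · rw [h1 i h3]
      refine (hw i h3).imp_right ?_
      rintro ⟨j, k, ⟨⟨h4, h5⟩, h6, h7⟩, h8⟩
      refine ⟨succ j, succ k, ⟨⟨?_, ?_⟩, ?_, ?_⟩, ?_⟩
      iterate 4 simp only [succ_eq]; grind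
      rwa [nth_succ_pair, nth_succ_pair, h1 j h5, h1 k h7]
    · rw [h2]
      refine (hw' d (by grind)).imp_right ?_
      rintro ⟨j, k, ⟨⟨h4, h5⟩, h6, h7⟩, h8⟩
      refine ⟨succ (n + j), succ (n + k), ⟨⟨?_, ?_⟩, ?_, ?_⟩, ?_⟩
      iterate 4 simp only [succ_eq]; grind
      rwa [nth_succ_pair, nth_succ_pair, h2, h2]

theorem Der.least {Q : M.N → Prop} [hQ : Def fun v (_ : ℕ → M.O) => Q (v 0)]
    (h1 : ∀ x, Ax x → Q x) (h2 : ∀ x y z, Rule x y z → Q y → Q z → Q x) {x : M.N}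
    (h : Der Ax Rule x) : Q x := by
  have : DefSet Q := ⟨hQ⟩
  obtain ⟨w, n, hn, rfl, hw⟩ := h
  -- Premises stand later in the sequence, so the induction is on a bound `m` for the number of
  -- entries from `i` to the end.
  have main : ∀ m i : M.N, i < n → n ≤ i + m → Q (nth i w) := by
    intro m
    refine ind (Q := fun m => ∀ i, i < n → n ≤ i + m → Q (nth i w)) (fun i hi hm => ?_)
      (fun m ih i hi hm => ?_) m
    · rw [add_zero] at hm
      exact (not_lt_of_ge hm hi).elim
    · rcases hw i hi with h | ⟨j, k, ⟨⟨h4, h5⟩, h6, h7⟩, h8⟩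
      · exact h1 _ h
      · have key : ∀ j, i < j → n ≤ j + m := fun j hj => by
          rw [succ_eq] at hm
          have := (lt_iff_add_one_le _ _).1 hj
          grind
        exact h2 _ _ _ h8 (ih j h5 (key j h4)) (ih k h7 (key k h6))
  exact main n 0 hn (by rw [zero_add])

/-- Inversion follows from leastness: the right-hand side is definable, contains the axioms, and is
closed under the rule because it implies derivability. -/
theorem Der.cases [DefSet Ax] [DefRel₃ Rule] {x : M.N} (h : Der Ax Rule x) :
    Ax x ∨ ∃ y z, Rule x y z ∧ Der Ax Rule y ∧ Der Ax Rule z := by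
  have aux : ∀ {y}, (Ax y ∨ ∃ z z', Rule y z z' ∧ Der Ax Rule z ∧ Der Ax Rule z') →
      Der Ax Rule y := by
    rintro y (h | ⟨z, z', h, h', h''⟩)
    · exact .ax h
    · exact .rule h h' h''
  exact h.least (Q := fun x => Ax x ∨ ∃ y z, Rule x y z ∧ Der Ax Rule y ∧ Der Ax Rule z)
    (fun x => .inl) (fun x y z h hy hz => .inr ⟨y, z, h, aux hy, aux hz⟩)

end Der

/-! ## Reduction -/

def ap2 (x y z : M.N) : M.N := ap (ap x y) z

instance (r s t : (ℕ → M.N) → M.N) [DefTerm r] [DefTerm s] [DefTerm t] :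
    DefTerm fun v => ap2 (r v) (s v) (t v) :=
  inferInstanceAs (DefTerm fun v => ap (ap (r v) (s v)) (t v))

/-- Coded terms `p x y`. -/
def tpair (x y : M.N) : M.N := ap2 (M.cst .p) x y

instance (s t : (ℕ → M.N) → M.N) [DefTerm s] [DefTerm t] :
    DefTerm fun v => tpair (s v) (t v) :=
  inferInstanceAs (DefTerm fun v => ap2 (M.cst .p) (s v) (t v))

/-- `a` contracts to its subterm `b`. -/
def Proj (a b : M.N) : Prop :=
  (∃ y, a = ap2 (M.cst .k) b y) ∨ (∃ y, a = ap (M.cst .p0) (tpair b y)) ∨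
  (∃ x, a = ap (M.cst .p1) (tpair x b)) ∨ a = ap (M.cst .pN) (ap (M.cst .sN) b) ∨
  (∃ y n, a = ap2 (ap2 (M.cst .dN) b y) (num n) (num n)) ∨
  ∃ x m n, m ≠ n ∧ a = ap2 (ap2 (M.cst .dN) x b) (num m) (num n)

/-- `a` is a redex of the combinator `s`, with contractum `b`. -/
def SContr (a b : M.N) : Prop :=
  ∃ x y z, a = ap (ap2 (M.cst .s) x y) z ∧ b = ap (ap x z) (ap y z)

/-- The split isolates the redexes of `s`, the only ones whose contractum is not a subterm. Parallel
reduction and its developments treat the two kinds differently. -/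
def Contr (a b : M.N) : Prop := Proj a b ∨ SContr a b

instance : DefRel (Proj (M := M)) := ⟨by unfold Proj; infer_instance⟩
instance : DefRel (SContr (M := M)) := ⟨by unfold SContr; infer_instance⟩
instance : DefRel (Contr (M := M)) := ⟨by unfold Contr; infer_instance⟩

/-- `RedAx` and `RedRule` reproduce the disjuncts of `OpForm.justified`, so that `OpForm.red`
unfolds to `Red` in every model. -/
def RedAx (e : M.N) : Prop := left e = right e ∨ Contr (left e) (right e)

def CompatRule (e f g : M.N) : Prop :=
  left e = ap (left f) (left g) ∧ right e = ap (right f) (right g)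

def TransRule (e f g : M.N) : Prop :=
  left e = left f ∧ right f = left g ∧ right g = right e

def RedRule (e f g : M.N) : Prop := CompatRule e f g ∨ TransRule e f g

instance : DefSet (RedAx (M := M)) := ⟨by unfold RedAx; infer_instance⟩
instance : DefRel₃ (CompatRule (M := M)) := ⟨by unfold CompatRule; infer_instance⟩
instance : DefRel₃ (TransRule (M := M)) := ⟨by unfold TransRule; infer_instance⟩
instance : DefRel₃ (RedRule (M := M)) := ⟨by unfold RedRule; infer_instance⟩

/-- Reduction of coded terms. -/
def Red (a b : M.N) : Prop := Der RedAx RedRule (pair a b)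

instance : DefRel (Red (M := M)) := ⟨by unfold Red; infer_instance⟩

theorem Red.refl (a : M.N) : Red a a := .ax (.inl (by rw [left_pair, right_pair]))

theorem Red.contr {a b : M.N} (h : Contr a b) : Red a b :=
  .ax (.inr (by rwa [left_pair, right_pair]))

theorem Red.trans {a b c : M.N} (h : Red a b) (h' : Red b c) : Red a c :=
  .rule (.inr ⟨by simp only [left_pair], by rw [left_pair, right_pair],
    by simp only [right_pair]⟩) h h'

theorem Red.ap {a b a' b' : M.N} (h : Red a a') (h' : Red b b') : Red (ap a b) (ap a' b') :=
  .rule (.inl ⟨by simp only [left_pair], by simp only [right_pair]⟩) h h'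

theorem Red.least {Q : M.N → M.N → Prop} [hQ : Def fun v (_ : ℕ → M.O) => Q (v 0) (v 1)]
    (h1 : ∀ a, Q a a) (h2 : ∀ a b, Contr a b → Q a b)
    (h3 : ∀ a b a' b', Q a a' → Q b b' → Q (KModel.ap a b) (KModel.ap a' b'))
    (h4 : ∀ a b c, Q a b → Q b c → Q a c) {a b : M.N} (h : Red a b) : Q a b := by
  have : DefRel Q := ⟨hQ⟩
  have := Der.least (Q := fun e => Q (left e) (right e)) ?_ ?_ h
  · simpa only [left_pair, right_pair] using this
  · rintro e (he | he)
    · rw [he]; exact h1 _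
    · exact h2 _ _ he
  · rintro e f g (⟨h5, h6⟩ | ⟨h5, h6, h7⟩) hf hg
    · rw [h5, h6]; exact h3 _ _ _ _ hf hg
    · rw [h5, ← h7]; exact h4 _ _ _ hf (h6 ▸ hg)

/-! ### Parallel reduction -/

def ParAx (e : M.N) : Prop := left e = right e

/-- A projection redex is contracted first and its contractum reduced afterwards: whatever is
discarded need not be reduced at all. -/
def ProjRule (e f : M.N) : Prop := Proj (left e) (left f) ∧ right e = right f

/-- A rule has only two premises, so the reductions of `x` and `y` are packed into one reduction of
`s x y` to `s x' y'`. -/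
def SRule (e f g : M.N) : Prop := ∃ x y x' y', left f = ap2 (M.cst .s) x y ∧
  right f = ap2 (M.cst .s) x' y' ∧ left e = ap (left f) (left g) ∧
  right e = ap (ap x' (right g)) (ap y' (right g))

def ParRule (e f g : M.N) : Prop := CompatRule e f g ∨ ProjRule e f ∨ SRule e f g

instance : DefSet (ParAx (M := M)) := ⟨by unfold ParAx; infer_instance⟩
instance : DefRel (ProjRule (M := M)) := ⟨by unfold ProjRule; infer_instance⟩
instance : DefRel₃ (SRule (M := M)) := ⟨by unfold SRule; infer_instance⟩
instance : DefRel₃ (ParRule (M := M)) := ⟨by unfold ParRule; infer_instance⟩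

/-- Parallel reduction of coded terms. -/
def Par (a b : M.N) : Prop := Der ParAx ParRule (pair a b)

instance : DefRel (Par (M := M)) := ⟨by unfold Par; infer_instance⟩

theorem Par.refl (a : M.N) : Par a a := .ax (by rw [ParAx, left_pair, right_pair])

theorem Par.ap {a b a' b' : M.N} (h : Par a a') (h' : Par b b') : Par (ap a b) (ap a' b') :=
  .rule (.inl ⟨by simp only [left_pair], by simp only [right_pair]⟩) h h'

theorem Par.proj {a b c : M.N} (h : Proj a c) (h' : Par c b) : Par a b :=
  .rule (.inr (.inl ⟨by simpa only [left_pair] using h, by simp only [right_pair]⟩)) h' h'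

theorem Par.s {x y z x' y' z' : M.N} (h : Par (ap2 (M.cst .s) x y) (ap2 (M.cst .s) x' y'))
    (h' : Par z z') :
    Par (KModel.ap (ap2 (M.cst .s) x y) z) (KModel.ap (KModel.ap x' z') (KModel.ap y' z')) :=
  .rule (.inr (.inr ⟨x, y, x', y', by simp only [left_pair], by simp only [right_pair],
    by simp only [left_pair], by simp only [right_pair]⟩)) h h'

theorem Par.contr {a b : M.N} (h : Contr a b) : Par a b := by
  rcases h with h | ⟨x, y, z, rfl, rfl⟩
  · exact .proj h (.refl _)
  · exact .s (.refl _) (.refl _)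

theorem Par.cases {a b : M.N} (h : Par a b) : a = b ∨
    (∃ a₁ a₂ b₁ b₂, a = KModel.ap a₁ a₂ ∧ b = KModel.ap b₁ b₂ ∧ Par a₁ b₁ ∧ Par a₂ b₂) ∨
    (∃ c, Proj a c ∧ Par c b) ∨
    ∃ x y z x' y' z', a = KModel.ap (ap2 (M.cst .s) x y) z ∧
      b = KModel.ap (KModel.ap x' z') (KModel.ap y' z') ∧
      Par (ap2 (M.cst .s) x y) (ap2 (M.cst .s) x' y') ∧ Par z z' := by
  rcases Der.cases h with h | ⟨f, g, h, hf, hg⟩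
  · rw [ParAx, left_pair, right_pair] at h
    exact .inl h
  · rw [← pair_left_right f] at hf
    rw [← pair_left_right g] at hg
    simp only [ParRule, CompatRule, ProjRule, SRule, left_pair, right_pair] at h
    rcases h with ⟨h1, h2⟩ | ⟨h1, h2⟩ | ⟨x, y, x', y', h1, h2, h3, h4⟩
    · exact .inr (.inl ⟨_, _, _, _, h1, h2, hf, hg⟩)
    · exact .inr (.inr (.inl ⟨_, h1, h2 ▸ hf⟩))
    · rw [h1, h2] at hf
      rw [h1] at h3
      exact .inr (.inr (.inr ⟨_, _, _, _, _, _, h3, h4, hf, hg⟩))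

theorem Par.red {a b : M.N} (h : Par a b) : Red a b := by
  have := Der.least (Q := fun e => Red (left e) (right e)) ?_ ?_ h
  · simpa only [left_pair, right_pair] using this
  · intro e he
    rw [he]; exact .refl _
  · rintro e f g (⟨h5, h6⟩ | ⟨h5, h6⟩ | ⟨x, y, x', y', h1, h2, h3, h4⟩) hf hg
    · rw [h5, h6]; exact .ap hf hg
    · rw [h6]; exact (Red.contr (.inl h5)).trans hf
    · rw [h3, h4]
      refine (Red.ap hf hg).trans ?_
      rw [h2]
      exact .contr (.inr ⟨_, _, _, rfl, rfl⟩)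

/-- The term is not itself a redex. -/
def NotRoot (a : M.N) : Prop := (∀ b, ¬ Proj a b) ∧ ∀ b, ¬ SContr a b

theorem ap_ne_cst (c : FConst) (x y : M.N) : ap x y ≠ M.cst c := (cst_ne_ap c x y).symm

theorem Par.of_notRoot {a b y : M.N} (h : NotRoot (KModel.ap a b)) (h' : Par (KModel.ap a b) y) :
    ∃ a' b', y = KModel.ap a' b' ∧ Par a a' ∧ Par b b' := by
  rcases h'.cases with rfl | ⟨a₁, a₂, b₁, b₂, h1, rfl, h2, h3⟩ | ⟨c, h1, _⟩ |
    ⟨x, y, z, x', y', z', h1, _⟩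
  · exact ⟨a, b, rfl, .refl _, .refl _⟩
  · rw [ap_inj] at h1
    rw [h1.1, h1.2]
    exact ⟨_, _, rfl, h2, h3⟩
  · exact (h.1 _ h1).elim
  · exact (h.2 _ ⟨_, _, _, h1, rfl⟩).elim

theorem Par.of_cst {c : FConst} {y : M.N} (h : Par (M.cst c) y) : y = M.cst c := by
  rcases h.cases with rfl | ⟨a₁, a₂, b₁, b₂, h1, _⟩ | ⟨c, h1, _⟩ | ⟨x, y, z, x', y', z', h1, _⟩
  · rfl
  · exact (cst_ne_ap _ _ _ h1).elim
  · simp [Proj, ap2, cst_ne_ap] at h1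
  · exact (cst_ne_ap _ _ _ h1).elim

/-- The constants that never form a redex with a single argument. -/
def Inert (c : FConst) : Prop := c ≠ .p0 ∧ c ≠ .p1 ∧ c ≠ .pN

theorem notRoot_cst_ap {c : FConst} (hc : Inert c) (a : M.N) : NotRoot (ap (M.cst c) a) := by
  obtain ⟨h1, h2, h3⟩ := hc
  simp [NotRoot, Proj, SContr, ap2, tpair, ap_inj, cst_inj, cst_ne_ap, h1, h2, h3]

theorem notRoot_cst_ap2 {c : FConst} (hc : c ≠ .k) (a b : M.N) : NotRoot (ap2 (M.cst c) a b) := by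
  simp [NotRoot, Proj, SContr, ap2, tpair, ap_inj, cst_inj, cst_ne_ap, ap_ne_cst, hc]

theorem notRoot_cst_ap3 {c : FConst} (hc : c ≠ .s) (a b d : M.N) :
    NotRoot (ap (ap2 (M.cst c) a b) d) := by
  simp [NotRoot, Proj, SContr, ap2, tpair, ap_inj, cst_inj, cst_ne_ap, ap_ne_cst, hc]

theorem Par.of_cst_ap {c : FConst} (hc : Inert c) {a y : M.N} (h : Par (KModel.ap (M.cst c) a) y) :
    ∃ a', y = KModel.ap (M.cst c) a' ∧ Par a a' := by
  obtain ⟨_, a', rfl, h1, h2⟩ := h.of_notRoot (notRoot_cst_ap hc a)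
  exact ⟨a', by rw [h1.of_cst], h2⟩

theorem Par.of_cst_ap2 {c : FConst} (hc : Inert c) (hk : c ≠ .k) {a b y : M.N}
    (h : Par (ap2 (M.cst c) a b) y) : ∃ a' b', y = ap2 (M.cst c) a' b' ∧ Par a a' ∧ Par b b' := by
  obtain ⟨_, b', rfl, h1, h2⟩ := h.of_notRoot (notRoot_cst_ap2 hk a b)
  obtain ⟨a', rfl, h3⟩ := h1.of_cst_ap hc
  exact ⟨a', b', rfl, h3, h2⟩

theorem Par.of_num {n y : M.N} (h : Par (num n) y) : y = num n := by
  refine ind (Q := fun n => ∀ y, Par (num n) y → y = num n) (fun y h => ?_) (fun n ih y h => ?_)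
    n y h
  · rw [num_zero] at h ⊢
    exact h.of_cst
  · rw [num_succ] at h ⊢
    obtain ⟨a, rfl, h'⟩ := h.of_cst_ap (by simp [Inert])
    rw [ih a h']

/-- The kinds of redexes have different head constants, except for the two rules of `dN`, which
exclude each other because `num` is injective. -/
theorem Proj.unique {a b c : M.N} (h : Proj a b) (h' : Proj a c) : b = c := by
  rcases h with ⟨y, rfl⟩ | ⟨y, rfl⟩ | ⟨y, rfl⟩ | rfl | ⟨y, n, rfl⟩ | ⟨y, m, n, hmn, rfl⟩ <;>
    simp [Proj, ap2, tpair, ap_inj, cst_inj, num_inj, cst_ne_ap, ap_ne_cst] at h' <;> grind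

theorem SContr.not_proj {a b c : M.N} (h : SContr a b) (h' : Proj a c) : False := by
  obtain ⟨x, y, z, rfl, rfl⟩ := h
  simp [Proj, ap2, tpair, ap_inj, cst_ne_ap, ap_ne_cst] at h'

theorem lt_ap_left (x y : M.N) : x < ap x y := (left_le_pair x y).trans_lt (pair_lt_ap x y)

theorem lt_ap_right (x y : M.N) : y < ap x y := (right_le_pair x y).trans_lt (pair_lt_ap x y)

theorem Proj.lt {a b : M.N} (h : Proj a b) : b < a := by
  have hl := lt_ap_left (M := M); have hr := lt_ap_right (M := M)
  rcases h with ⟨y, rfl⟩ | ⟨y, rfl⟩ | ⟨y, rfl⟩ | rfl | ⟨y, n, rfl⟩ | ⟨y, m, n, hmn, rfl⟩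
  · exact (hr _ _).trans (hl _ _)
  · exact ((hr _ _).trans (hl _ _)).trans (hr _ _)
  · exact (hr _ _).trans (hr _ _)
  · exact (hr _ _).trans (hr _ _)
  · exact (((hr _ _).trans (hl _ _)).trans (hl _ _)).trans (hl _ _)
  · exact ((hr _ _).trans (hl _ _)).trans (hl _ _)

/-- Reducing the two parts of a projection redex cannot destroy it. Its function part and argument
are not themselves redexes where the pattern is fixed, and numerals are normal, so the pattern
survives and the contractum is merely reduced. -/
theorem Proj.ap_par {a b c a' b' : M.N} (h : Proj (ap a b) c) (ha : Par a a') (hb : Par b b') :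
    ∃ c', Proj (ap a' b') c' ∧ Par c c' := by
  have inv4 : ∀ {x y n : M.N}, Par (ap (ap2 (M.cst .dN) x y) (num n)) a' →
      ∃ x' y', a' = ap (ap2 (M.cst .dN) x' y') (num n) ∧ Par x x' ∧ Par y y' := by
    intro x y n h
    obtain ⟨_, _, rfl, h1, h2⟩ := h.of_notRoot (notRoot_cst_ap3 (by simp) _ _ _)
    obtain ⟨x', y', rfl, h1, h3⟩ := h1.of_cst_ap2 (by simp [Inert]) (by simp)
    exact ⟨x', y', by rw [h2.of_num], h1, h3⟩
  rcases h with ⟨y, h⟩ | ⟨y, h⟩ | ⟨y, h⟩ | h | ⟨y, n, h⟩ | ⟨y, m, n, hmn, h⟩ <;>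
    obtain ⟨rfl, rfl⟩ := ap_inj.1 h
  · obtain ⟨c', rfl, h1⟩ := ha.of_cst_ap (by simp [Inert])
    exact ⟨c', .inl ⟨_, rfl⟩, h1⟩
  · obtain ⟨c', y', rfl, h1, -⟩ := hb.of_cst_ap2 (by simp [Inert]) (by simp)
    rw [ha.of_cst]
    exact ⟨c', .inr (.inl ⟨_, rfl⟩), h1⟩
  · obtain ⟨y', c', rfl, -, h1⟩ := hb.of_cst_ap2 (by simp [Inert]) (by simp)
    rw [ha.of_cst]
    exact ⟨c', .inr (.inr (.inl ⟨_, rfl⟩)), h1⟩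
  · obtain ⟨c', rfl, h1⟩ := hb.of_cst_ap (by simp [Inert])
    rw [ha.of_cst]
    exact ⟨c', .inr (.inr (.inr (.inl rfl))), h1⟩
  · obtain ⟨c', y', rfl, h1, -⟩ := inv4 ha
    rw [hb.of_num]
    exact ⟨c', .inr (.inr (.inr (.inr (.inl ⟨_, _, rfl⟩)))), h1⟩
  · obtain ⟨y', c', rfl, -, h1⟩ := inv4 ha
    rw [hb.of_num]
    exact ⟨c', .inr (.inr (.inr (.inr (.inr ⟨_, _, _, hmn, rfl⟩)))), h1⟩

/-- Every term has a complete development. -/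
theorem Par.exists_development (x : M.N) : ∃ d, ∀ y, Par x y → Par y d := by
  refine ind_lt (Q := fun x => ∃ d, ∀ y, Par x y → Par y d) (fun x ih => ?_) x
  -- A projection redex takes over the development of its contractum, which has a smaller code.
  by_cases hp : ∃ c, Proj x c
  · obtain ⟨c, hc⟩ := hp
    obtain ⟨d, hd⟩ := ih c hc.lt
    refine ⟨d, fun y hy => ?_⟩
    rcases hy.cases with rfl | ⟨a₁, a₂, b₁, b₂, rfl, rfl, h2, h3⟩ | ⟨c', h1, h2⟩ |
      ⟨_, _, _, _, _, _, h1, _⟩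
    · exact .proj hc (hd c (.refl c))
    · obtain ⟨c', h4, h5⟩ := hc.ap_par h2 h3
      exact .proj h4 (hd c' h5)
    · rw [h1.unique hc] at h2
      exact hd _ h2
    · exact (SContr.not_proj ⟨_, _, _, h1, rfl⟩ hc).elim
  -- The contractum of an `s`-redex may be larger than the redex, so here the induction hypothesis
  -- is applied to the three arguments, whose developments are assembled afterwards.
  by_cases hs : ∃ b, SContr x b
  · obtain ⟨_, a, b, c, rfl, rfl⟩ := hs
    obtain ⟨da, ha⟩ := ih a (((lt_ap_right _ _).trans (lt_ap_left _ _)).trans (lt_ap_left _ _))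
    obtain ⟨db, hb⟩ := ih b ((lt_ap_right _ _).trans (lt_ap_left _ _))
    obtain ⟨dc, hc⟩ := ih c (lt_ap_right _ _)
    have key : ∀ {a' b'}, Par a a' → Par b b' →
        Par (ap2 (M.cst .s) a' b') (ap2 (M.cst .s) da db) := fun h h' =>
      .ap (.ap (.refl _) (ha _ h)) (hb _ h')
    refine ⟨KModel.ap (KModel.ap da dc) (KModel.ap db dc), fun y hy => ?_⟩
    rcases hy.cases with rfl | ⟨a₁, a₂, b₁, b₂, h1, rfl, h2, h3⟩ | ⟨c', h1, h2⟩ |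
      ⟨x, y, z, x', y', z', h1, rfl, h2, h3⟩
    · exact .s (key (.refl _) (.refl _)) (hc _ (.refl _))
    · obtain ⟨rfl, rfl⟩ := ap_inj.1 h1
      obtain ⟨a', b', rfl, h4, h5⟩ := h2.of_cst_ap2 (by simp [Inert]) (by simp)
      exact .s (key h4 h5) (hc _ h3)
    · exact (hp ⟨_, h1⟩).elim
    · obtain ⟨h4, rfl⟩ := ap_inj.1 h1
      rw [← h4] at h2
      obtain ⟨a', b', h5, h6, h7⟩ := h2.of_cst_ap2 (by simp [Inert]) (by simp)
      simp only [ap2, ap_inj, true_and] at h5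
      obtain ⟨rfl, rfl⟩ := h5
      exact .ap (.ap (ha _ h6) (hc _ h3)) (.ap (hb _ h7) (hc _ h3))
  -- Without a redex at the root, function and argument are developed separately.
  rcases cst_or_ap x with ⟨c, rfl⟩ | ⟨a, b, rfl⟩
  · exact ⟨M.cst c, fun y hy => by rw [hy.of_cst]; exact .refl _⟩
  · obtain ⟨da, ha⟩ := ih a (lt_ap_left _ _)
    obtain ⟨db, hb⟩ := ih b (lt_ap_right _ _)
    refine ⟨KModel.ap da db, fun y hy => ?_⟩
    obtain ⟨a', b', rfl, h1, h2⟩ := hy.of_notRoot ⟨fun c h => hp ⟨c, h⟩, fun c h => hs ⟨c, h⟩⟩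
    exact .ap (ha _ h1) (hb _ h2)

/-! ### Confluence -/

def StarAx (e : M.N) : Prop := Par (left e) (right e)

instance : DefSet (StarAx (M := M)) := ⟨by unfold StarAx; infer_instance⟩

/-- The transitive closure of parallel reduction. -/
def Star (a b : M.N) : Prop := Der StarAx TransRule (pair a b)

instance : DefRel (Star (M := M)) := ⟨by unfold Star; infer_instance⟩

theorem Star.par {a b : M.N} (h : Par a b) : Star a b :=
  .ax (by rwa [StarAx, left_pair, right_pair])

theorem Star.trans {a b c : M.N} (h : Star a b) (h' : Star b c) : Star a c :=
  .rule ⟨by simp only [left_pair], by rw [left_pair, right_pair], by simp only [right_pair]⟩ h h'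

theorem Star.least {Q : M.N → M.N → Prop} [hQ : Def fun v (_ : ℕ → M.O) => Q (v 0) (v 1)]
    (h1 : ∀ a b, Par a b → Q a b) (h2 : ∀ a b c, Q a b → Q b c → Q a c) {a b : M.N}
    (h : Star a b) : Q a b := by
  have : DefRel Q := ⟨hQ⟩
  have := Der.least (Q := fun e => Q (left e) (right e)) (fun e he => h1 _ _ he) ?_ h
  · simpa only [left_pair, right_pair] using this
  · rintro e f g ⟨h5, h6, h7⟩ hf hg
    rw [h5, ← h7]; exact h2 _ _ _ hf (h6 ▸ hg)

theorem Star.red {a b : M.N} (h : Star a b) : Red a b :=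
  h.least (Q := Red) (fun _ _ => Par.red) fun _ _ _ => Red.trans

theorem Star.ap {a b a' b' : M.N} (h : Star a a') (h' : Star b b') : Star (ap a b) (ap a' b') := by
  have h1 : Star (KModel.ap a b) (KModel.ap a' b) :=
    h.least (Q := fun a a' => ∀ b, Star (KModel.ap a b) (KModel.ap a' b))
      (fun a a' h b => .par (.ap h (.refl b))) (fun _ _ _ h h' b => (h b).trans (h' b)) b
  have h2 : Star (KModel.ap a' b) (KModel.ap a' b') :=
    h'.least (Q := fun b b' => ∀ a, Star (KModel.ap a b) (KModel.ap a b'))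
      (fun b b' h a => .par (.ap (.refl a) h)) (fun _ _ _ h h' a => (h a).trans (h' a)) a'
  exact h1.trans h2

theorem Red.star {a b : M.N} (h : Red a b) : Star a b :=
  h.least (Q := Star) (fun a => .par (.refl a)) (fun _ _ h => .par (.contr h))
    (fun _ _ _ _ => Star.ap) fun _ _ _ => Star.trans

/-- A complete development closes each single divergence of two parallel steps in one further step
on both sides; such squares are pasted along the reduction from `x` to `y`. -/
theorem Star.strip {x y z : M.N} (h : Star x y) (h' : Par x z) : ∃ w, Par y w ∧ Star z w := by
  refine h.least (Q := fun x y => ∀ z, Par x z → ∃ w, Par y w ∧ Star z w) (fun x y h z h' => ?_)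
    (fun x y y' h1 h2 z h' => ?_) z h'
  · obtain ⟨d, hd⟩ := Par.exists_development x
    exact ⟨d, hd _ h, .par (hd _ h')⟩
  · obtain ⟨w, h3, h4⟩ := h1 z h'
    obtain ⟨w', h5, h6⟩ := h2 w h3
    exact ⟨w', h5, h4.trans h6⟩

theorem Star.confluent {x y z : M.N} (h : Star x y) (h' : Star x z) : ∃ w, Star y w ∧ Star z w := by
  refine h.least (Q := fun x y => ∀ z, Star x z → ∃ w, Star y w ∧ Star z w) (fun x y h z h' => ?_)
    (fun x y y' h1 h2 z h' => ?_) z h'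
  · obtain ⟨w, h1, h2⟩ := h'.strip h
    exact ⟨w, h2, .par h1⟩
  · obtain ⟨w, h3, h4⟩ := h1 z h'
    obtain ⟨w', h5, h6⟩ := h2 w h3
    exact ⟨w', h5, h4.trans h6⟩

theorem Red.confluent {x y z : M.N} (h : Red x y) (h' : Red x z) : ∃ w, Red y w ∧ Red z w := by
  obtain ⟨w, h1, h2⟩ := h.star.confluent h'.star
  exact ⟨w, h1.red, h2.red⟩

/-- A definable set that is closed under parallel reduction is closed under reduction. -/
theorem Red.invariant {Q : M.N → Prop} [hQ : Def fun v (_ : ℕ → M.O) => Q (v 0)]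
    (h : ∀ a b, Q a → Par a b → Q b) {a b : M.N} (hr : Red a b) (ha : Q a) : Q b := by
  have : DefSet Q := ⟨hQ⟩
  exact hr.star.least (Q := fun a b => Q a → Q b) (fun a b h1 h2 => h a b h2 h1)
    (fun _ _ _ h1 h2 h3 => h2 (h1 h3)) ha

end KModel

/-! ## The term model -/

namespace KModel
variable {M : KModel} [hM : IsPA M]

@[simp] theorem inert_simps : Inert .eqd ∧ Inert .negd ∧ Inert .andd ∧ Inert .impd ∧ Inert .alld ∧
    Inert .natd ∧ Inert .l ∧ Inert .sN := by simp [Inert]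

theorem Red.of_cst {c : FConst} {y : M.N} (h : Red (M.cst c) y) : y = M.cst c :=
  h.invariant (Q := fun y => y = M.cst c) (fun a b ha h => by subst ha; exact h.of_cst) rfl

theorem Red.of_num {n y : M.N} (h : Red (num n) y) : y = num n :=
  h.invariant (Q := fun y => y = num n) (fun a b ha h => by subst ha; exact h.of_num) rfl

/-- No redex can arise at the root under an inert head, so the shape is invariant under parallel
reduction. -/
theorem Red.of_cst_ap {c : FConst} (hc : Inert c) {a y : M.N} (h : Red (KModel.ap (M.cst c) a) y) :
    ∃ a', y = KModel.ap (M.cst c) a' ∧ Red a a' := by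
  refine h.invariant (Q := fun y => ∃ a', y = KModel.ap (M.cst c) a' ∧ Red a a') ?_
    ⟨a, rfl, .refl a⟩
  rintro _ z ⟨a', rfl, h1⟩ h2
  obtain ⟨a'', rfl, h3⟩ := h2.of_cst_ap hc
  exact ⟨a'', rfl, h1.trans h3.red⟩

theorem Red.of_cst_ap2 {c : FConst} (hc : Inert c) (hk : c ≠ .k) {a b y : M.N}
    (h : Red (ap2 (M.cst c) a b) y) : ∃ a' b', y = ap2 (M.cst c) a' b' ∧ Red a a' ∧ Red b b' := by
  refine h.invariant (Q := fun y => ∃ a' b', y = ap2 (M.cst c) a' b' ∧ Red a a' ∧ Red b b') ?_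
    ⟨a, b, rfl, .refl a, .refl b⟩
  rintro _ z ⟨a', b', rfl, h1, h1'⟩ h2
  obtain ⟨a'', b'', rfl, h3, h4⟩ := h2.of_cst_ap2 hc hk
  exact ⟨a'', b'', rfl, h1.trans h3.red, h1'.trans h4.red⟩

/-- Equality of the term model: having a common reduct. -/
def Eqv (x y : M.N) : Prop := ∃ z, Red x z ∧ Red y z

instance : DefRel (Eqv (M := M)) := ⟨by unfold Eqv; infer_instance⟩

/-- The numbers of the term model. -/
def IsNum (x : M.N) : Prop := ∃ n, Red x (num n)

theorem Red.eqv {x y : M.N} (h : Red x y) : Eqv x y := ⟨y, h, .refl y⟩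

@[refl] theorem Eqv.refl (x : M.N) : Eqv x x := (Red.refl x).eqv

theorem Eqv.symm {x y : M.N} (h : Eqv x y) : Eqv y x := h.imp fun _ => And.symm

/-- Here confluence is needed: the two reducts of `y` have a common reduct. -/
theorem Eqv.trans {x y z : M.N} (h : Eqv x y) (h' : Eqv y z) : Eqv x z := by
  obtain ⟨u, h1, h2⟩ := h
  obtain ⟨v, h3, h4⟩ := h'
  obtain ⟨w, h5, h6⟩ := h2.confluent h3
  exact ⟨w, h1.trans h5, h4.trans h6⟩

theorem Eqv.ap {x y x' y' : M.N} (h : Eqv x x') (h' : Eqv y y') : Eqv (ap x y) (ap x' y') := by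
  obtain ⟨u, h1, h2⟩ := h
  obtain ⟨v, h3, h4⟩ := h'
  exact ⟨KModel.ap u v, h1.ap h3, h2.ap h4⟩

theorem Eqv.ap2 {x y z x' y' z' : M.N} (h : Eqv x x') (h' : Eqv y y') (h'' : Eqv z z') :
    Eqv (ap2 x y z) (ap2 x' y' z') := (h.ap h').ap h''

theorem Eqv.proj {a b : M.N} (h : Proj a b) : Eqv a b := (Red.contr (.inl h)).eqv

theorem eqv_k (x y : M.N) : Eqv (ap2 (M.cst .k) x y) x := .proj (.inl ⟨_, rfl⟩)

theorem eqv_s (x y z : M.N) : Eqv (ap (ap2 (M.cst .s) x y) z) (ap (ap x z) (ap y z)) :=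
  (Red.contr (.inr ⟨_, _, _, rfl, rfl⟩)).eqv

theorem eqv_p0 (x y : M.N) : Eqv (ap (M.cst .p0) (tpair x y)) x := .proj (.inr (.inl ⟨_, rfl⟩))

theorem eqv_p1 (x y : M.N) : Eqv (ap (M.cst .p1) (tpair x y)) y :=
  .proj (.inr (.inr (.inl ⟨_, rfl⟩)))

theorem eqv_pN (x : M.N) : Eqv (ap (M.cst .pN) (ap (M.cst .sN) x)) x :=
  .proj (.inr (.inr (.inr (.inl rfl))))

theorem eqv_dN_eq (x y n : M.N) : Eqv (ap2 (ap2 (M.cst .dN) x y) (num n) (num n)) x :=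
  .proj (.inr (.inr (.inr (.inr (.inl ⟨_, _, rfl⟩)))))

theorem eqv_dN_ne (x y : M.N) {m n : M.N} (h : m ≠ n) :
    Eqv (ap2 (ap2 (M.cst .dN) x y) (num m) (num n)) y :=
  .proj (.inr (.inr (.inr (.inr (.inr ⟨_, _, _, h, rfl⟩)))))

-- No analysis of reducts is needed: the projections recover the components.
@[simp] theorem eqv_tpair {x y x' y' : M.N} : Eqv (tpair x y) (tpair x' y') ↔ Eqv x x' ∧ Eqv y y' := by
  refine ⟨fun h => ⟨?_, ?_⟩, fun h => .ap2 (.refl _) h.1 h.2⟩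
  · exact ((eqv_p0 x y).symm.trans (Eqv.ap (.refl _) h)).trans (eqv_p0 x' y')
  · exact ((eqv_p1 x y).symm.trans (Eqv.ap (.refl _) h)).trans (eqv_p1 x' y')

@[simp] theorem eqv_cst {c d : FConst} : Eqv (M.cst c) (M.cst d) ↔ c = d := by
  refine ⟨fun ⟨z, h1, h2⟩ => ?_, fun h => h ▸ .refl _⟩
  rw [h1.of_cst] at h2
  exact cst_inj.1 h2.of_cst

@[simp] theorem eqv_app {c d : FConst} (hc : Inert c) (hd : Inert d) {x y : M.N} :
    Eqv (ap (M.cst c) x) (ap (M.cst d) y) ↔ c = d ∧ Eqv x y := by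
  refine ⟨fun ⟨z, h1, h2⟩ => ?_, fun h => h.1 ▸ .ap (.refl _) h.2⟩
  obtain ⟨x', rfl, h3⟩ := h1.of_cst_ap hc
  obtain ⟨y', h4, h5⟩ := h2.of_cst_ap hd
  obtain ⟨h6, rfl⟩ := ap_inj.1 h4
  exact ⟨cst_inj.1 h6, _, h3, h5⟩

@[simp] theorem eqv_cst_app {c d : FConst} (hd : Inert d) {y : M.N} :
    ¬ Eqv (M.cst c) (ap (M.cst d) y) := fun ⟨z, h1, h2⟩ => by
  obtain ⟨y', h4, h5⟩ := h2.of_cst_ap hd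
  rw [h1.of_cst] at h4
  exact cst_ne_ap _ _ _ h4

/-- Coded terms `l f b`. -/
def lim (f b : M.N) : M.N := ap2 (M.cst .l) f b

@[simp] theorem eqv_lim {f b f' b' : M.N} : Eqv (lim f b) (lim f' b') ↔ Eqv f f' ∧ Eqv b b' := by
  refine ⟨fun ⟨z, h1, h2⟩ => ?_, fun h => .ap2 (.refl _) h.1 h.2⟩
  obtain ⟨x, y, rfl, h3, h4⟩ := h1.of_cst_ap2 (by simp [Inert]) (by simp)
  obtain ⟨x', y', h5, h6, h7⟩ := h2.of_cst_ap2 (by simp [Inert]) (by simp)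
  simp only [ap2, ap_inj, true_and] at h5
  obtain ⟨rfl, rfl⟩ := h5
  exact ⟨⟨_, h3, h6⟩, _, h4, h7⟩

@[simp] theorem eqv_lim_app {c : FConst} (hc : Inert c) {f b x : M.N} :
    ¬ Eqv (lim f b) (ap (M.cst c) x) := fun ⟨z, h1, h2⟩ => by
  obtain ⟨x, y, rfl, h3, h4⟩ := h1.of_cst_ap2 (by simp [Inert]) (by simp)
  obtain ⟨x', h5, h6⟩ := h2.of_cst_ap hc
  simp only [ap2, ap_inj, ap_ne_cst, false_and] at h5

@[simp] theorem eqv_app_lim {c : FConst} (hc : Inert c) {f b x : M.N} :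
    ¬ Eqv (ap (M.cst c) x) (lim f b) := fun h => eqv_lim_app hc h.symm

@[simp] theorem eqv_lim_cst {c : FConst} {f b : M.N} : ¬ Eqv (lim f b) (M.cst c) := fun ⟨z, h1, h2⟩ => by
  obtain ⟨x, y, rfl, h3, h4⟩ := h1.of_cst_ap2 (by simp [Inert]) (by simp)
  exact cst_ne_ap _ _ _ h2.of_cst.symm

theorem IsNum.exists_eqv {x : M.N} (h : IsNum x) : ∃ n, Eqv x (num n) := h.imp fun _ => Red.eqv

/-- Numerals are normal, so a common reduct with a numeral is that numeral. -/
theorem IsNum.of_eqv {x n : M.N} (h : Eqv x (num n)) : IsNum x := by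
  obtain ⟨z, h1, h2⟩ := h
  exact ⟨n, h2.of_num ▸ h1⟩

theorem IsNum.congr {x y : M.N} (h : IsNum x) (h' : Eqv x y) : IsNum y := by
  obtain ⟨n, hn⟩ := h.exists_eqv
  exact .of_eqv (h'.symm.trans hn)

theorem isNum_zero : IsNum (M.cst .zero) := ⟨0, num_zero (M := M) ▸ .refl _⟩

/-! ## The operator -/

abbrev dEq (x y : M.N) : M.N := ap (M.cst .eqd) (tpair x y)
abbrev dNeg (x : M.N) : M.N := ap (M.cst .negd) x
abbrev dAnd (x y : M.N) : M.N := ap (M.cst .andd) (tpair x y)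
abbrev dImp (x y : M.N) : M.N := ap (M.cst .impd) (tpair x y)
abbrev dAll (x : M.N) : M.N := ap (M.cst .alld) x
abbrev dNat (x : M.N) : M.N := ap (M.cst .natd) x
abbrev zeroEq (M : KModel) [IsPA M] : M.N := dEq (M.cst .zero) (M.cst .zero)
abbrev natZero (M : KModel) [IsPA M] : M.N := dNat (M.cst .zero)

instance (s : (ℕ → M.N) → M.N) [DefTerm s] : DefTerm fun v => dNeg (s v) :=
  inferInstanceAs (DefTerm fun v => ap (M.cst .negd) (s v))

theorem Eqv.dNeg {x y : M.N} (h : Eqv x y) : Eqv (dNeg x) (dNeg y) := .ap (.refl _) h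

/-- The clauses of the positive operator form, except for closure under equality. -/
inductive Clause (X : M.N → Prop) (a : M.N) : Prop
  | eq (b c : M.N) (h : Eqv a (dEq b c)) (h' : Eqv b c)
  | neg_eq (b c : M.N) (h : Eqv a (dNeg (dEq b c))) (h' : ¬ Eqv b c)
  | nat (b : M.N) (h : Eqv a (dNat b)) (h' : IsNum b)
  | neg_nat (b : M.N) (h : Eqv a (dNeg (dNat b))) (h' : ¬ IsNum b)
  | neg_neg (b : M.N) (h : Eqv a (dNeg (dNeg b))) (h' : X b)
  | and (b c : M.N) (h : Eqv a (dAnd b c)) (h' : X b ∧ X c)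
  | neg_and (b c : M.N) (h : Eqv a (dNeg (dAnd b c))) (h' : X (dNeg b) ∨ X (dNeg c))
  | imp (b c : M.N) (h : Eqv a (dImp b c)) (h' : X (dNeg b) ∨ X c)
  | neg_imp (b c : M.N) (h : Eqv a (dNeg (dImp b c))) (h' : X b ∧ X (dNeg c))
  | all (f : M.N) (h : Eqv a (dAll f)) (h' : ∀ b, X (ap f b))
  | neg_all (f : M.N) (h : Eqv a (dNeg (dAll f))) (h' : ∃ b, X (dNeg (ap f b)))
  | lim (f : M.N) (h : Eqv a (lim f M.zeroEq)) (h' : ∀ b, X (ap f b) ∨ X (dNeg (ap f b)))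

/-- The positive operator form. -/
def OpA₀ (X : M.N → Prop) (a : M.N) : Prop := Clause X a ∨ ∃ b, Eqv a b ∧ X b

/-- Both `zeroEq` and `natZero` belong to every closed set. Hence the early mark `l f zeroEq` agrees
with what the treatment of `f` would add anyway, and the treatment is certain to add `l f natZero`,
which switches the condition off. -/
def LimReady (X : M.N → Prop) (f : M.N) : Prop := X (lim f M.zeroEq) ∧ ¬ X (lim f M.natZero)

/-- The quantifier-free operator form. -/
def OpA₁ (X : M.N → Prop) (a : M.N) : Prop :=
  ∃ f b, LimReady X f ∧ ((a = lim f b ∧ X b) ∨ (a = dNeg (lim f b) ∧ ¬ X b))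

def Closed (X : M.N → Prop) : Prop := ∀ a, OpA₀ X a → X a

def Op (X : M.N → Prop) (a : M.N) : Prop := OpA₀ X a ∨ (Closed X ∧ OpA₁ X a)

theorem Clause.mono {X Y : M.N → Prop} (hXY : ∀ x, X x → Y x) {a : M.N} (h : Clause X a) :
    Clause Y a := by
  cases h with
  | eq b c h h' => exact .eq b c h h'
  | neg_eq b c h h' => exact .neg_eq b c h h'
  | nat b h h' => exact .nat b h h'
  | neg_nat b h h' => exact .neg_nat b h h'
  | neg_neg b h h' => exact .neg_neg b h (hXY _ h')
  | and b c h h' => exact .and b c h (h'.imp (hXY _) (hXY _))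
  | neg_and b c h h' => exact .neg_and b c h (h'.imp (hXY _) (hXY _))
  | imp b c h h' => exact .imp b c h (h'.imp (hXY _) (hXY _))
  | neg_imp b c h h' => exact .neg_imp b c h (h'.imp (hXY _) (hXY _))
  | all f h h' => exact .all f h fun b => hXY _ (h' b)
  | neg_all f h h' => exact .neg_all f h (h'.imp fun b => hXY _)
  | lim f h h' => exact .lim f h fun b => (h' b).imp (hXY _) (hXY _)

theorem Clause.congr {X : M.N → Prop} {a a' : M.N} (ha : Eqv a' a) (h : Clause X a) :
    Clause X a' := by
  cases h with
  | eq b c h h' => exact .eq b c (ha.trans h) h'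
  | neg_eq b c h h' => exact .neg_eq b c (ha.trans h) h'
  | nat b h h' => exact .nat b (ha.trans h) h'
  | neg_nat b h h' => exact .neg_nat b (ha.trans h) h'
  | neg_neg b h h' => exact .neg_neg b (ha.trans h) h'
  | and b c h h' => exact .and b c (ha.trans h) h'
  | neg_and b c h h' => exact .neg_and b c (ha.trans h) h'
  | imp b c h h' => exact .imp b c (ha.trans h) h'
  | neg_imp b c h h' => exact .neg_imp b c (ha.trans h) h'
  | all f h h' => exact .all f (ha.trans h) h'
  | neg_all f h h' => exact .neg_all f (ha.trans h) h'
  | lim f h h' => exact .lim f (ha.trans h) h'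

/-! ### Inversion of the clauses -/

section inversion
variable {X : M.N → Prop} {a b f : M.N}

/-- Here and below, unique decomposition in the form of the simp lemmas for `Eqv` refutes every
clause of a different shape. The surviving clause has equivalent arguments; where `X` is involved,
its invariance `hX` transfers membership. -/
theorem clause_eq : Clause X (dEq a b) ↔ Eqv a b := by
  refine ⟨fun hc => ?_, .eq _ _ (.refl _)⟩
  cases hc <;> rename_i h h' <;> simp at h
  exact (h.1.trans h').trans h.2.symm

theorem clause_neg_eq : Clause X (dNeg (dEq a b)) ↔ ¬ Eqv a b := by
  refine ⟨fun hc hab => ?_, .neg_eq _ _ (.refl _)⟩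
  cases hc <;> rename_i h h' <;> simp at h
  exact h' ((h.1.symm.trans hab).trans h.2)

theorem clause_nat : Clause X (dNat a) ↔ IsNum a := by
  refine ⟨fun hc => ?_, .nat _ (.refl _)⟩
  cases hc <;> rename_i h h' <;> simp at h
  exact h'.congr h.symm

theorem clause_neg_nat : Clause X (dNeg (dNat a)) ↔ ¬ IsNum a := by
  refine ⟨fun hc ha => ?_, .neg_nat _ (.refl _)⟩
  cases hc <;> rename_i h h' <;> simp at h
  exact h' (ha.congr h)

variable (hX : ∀ {x y}, Eqv x y → X x → X y)
include hX

theorem clause_neg_neg : Clause X (dNeg (dNeg a)) ↔ X a := by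
  refine ⟨fun hc => ?_, .neg_neg _ (.refl _)⟩
  cases hc <;> rename_i h h' <;> simp at h
  exact hX h.symm h'

theorem clause_and : Clause X (dAnd a b) ↔ X a ∧ X b := by
  refine ⟨fun hc => ?_, .and _ _ (.refl _)⟩
  cases hc <;> rename_i h h' <;> simp at h
  exact h'.imp (hX h.1.symm) (hX h.2.symm)

theorem clause_neg_and : Clause X (dNeg (dAnd a b)) ↔ X (dNeg a) ∨ X (dNeg b) := by
  refine ⟨fun hc => ?_, .neg_and _ _ (.refl _)⟩
  cases hc <;> rename_i h h' <;> simp at h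
  exact h'.imp (hX h.1.symm.dNeg) (hX h.2.symm.dNeg)

theorem clause_imp : Clause X (dImp a b) ↔ X (dNeg a) ∨ X b := by
  refine ⟨fun hc => ?_, .imp _ _ (.refl _)⟩
  cases hc <;> rename_i h h' <;> simp at h
  exact h'.imp (hX h.1.symm.dNeg) (hX h.2.symm)

theorem clause_neg_imp : Clause X (dNeg (dImp a b)) ↔ X a ∧ X (dNeg b) := by
  refine ⟨fun hc => ?_, .neg_imp _ _ (.refl _)⟩
  cases hc <;> rename_i h h' <;> simp at h
  exact h'.imp (hX h.1.symm) (hX h.2.symm.dNeg)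

theorem clause_all : Clause X (dAll f) ↔ ∀ b, X (ap f b) := by
  refine ⟨fun hc b => ?_, .all _ (.refl _)⟩
  cases hc <;> rename_i h h' <;> simp at h
  exact hX (h.symm.ap (.refl _)) (h' b)

theorem clause_neg_all : Clause X (dNeg (dAll f)) ↔ ∃ b, X (dNeg (ap f b)) := by
  refine ⟨fun hc => ?_, .neg_all _ (.refl _)⟩
  cases hc <;> rename_i h h' <;> simp at h
  exact h'.imp fun b => hX (h.symm.ap (.refl _)).dNeg

theorem clause_lim (hc : Clause X (lim f b)) :
    Eqv b M.zeroEq ∧ ∀ b, X (ap f b) ∨ X (dNeg (ap f b)) := by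
  cases hc <;> rename_i h h' <;> simp at h
  exact ⟨h.2, fun b => (h' b).imp (hX (h.1.symm.ap (.refl _))) (hX (h.1.symm.ap (.refl _)).dNeg)⟩

omit hX in
-- Negations of terms `l f b` thus enter through `A₁` alone, apart from closure under equality.
theorem not_clause_neg_lim : ¬ Clause X (dNeg (lim f b)) := by
  intro hc
  cases hc <;> rename_i h h' <;> simp at h

end inversion
end KModel

/-! ## The stages of the inductive definition -/

namespace KModel

/-- `X_α`, the union of the stages below `α`. -/
def Stage {M : KModel} (α : M.O) (x : M.N) : Prop := ∃ β, M.lt β α ∧ M.P β x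

/-- The union of all stages. -/
def Tr {M : KModel} (x : M.N) : Prop := ∃ α : M.O, M.P α x

instance {M : KModel} : DefSet (Tr (M := M)) := ⟨by unfold Tr; infer_instance⟩

/-- Models of the theory of the inductive definition. -/
class IsFID (M : KModel) : Prop extends IsPA M where
  lt_irrefl (α : M.O) : ¬ M.lt α α
  lt_trans {α β γ : M.O} : M.lt α β → M.lt β γ → M.lt α γ
  lt_total (α β : M.O) : M.lt α β ∨ α = β ∨ M.lt β α
  stage (α : M.O) (x : M.N) : M.P α x ↔ Stage α x ∨ Op (Stage α) x
  op_tr (x : M.N) : Op Tr x → Tr x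
  tind (A : KForm) (v : ℕ → M.N) (o : ℕ → M.O) :
    (∀ α, (∀ β, M.lt β α → M.sat A v (scons β o)) → M.sat A v (scons α o)) →
      ∀ α, M.sat A v (scons α o)

variable {M : KModel} [hM : IsFID M]

theorem ordInd {Q : M.O → Prop} [Def fun (_ : ℕ → M.N) o => Q (o 0)]
    (h : ∀ α, (∀ β, M.lt β α → Q β) → Q α) (α : M.O) : Q α := by
  obtain ⟨A, f, g, hA⟩ := Def.exists_formO fun (_ : ℕ → M.N) o => Q (o 0)
  have o : ℕ → M.O := fun _ => Classical.choice hM.nonempty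
  refine (hA α (fun _ => 0) o).2 (hM.tind A _ _ (fun β hβ => ?_) α)
  exact (hA β _ o).1 (h β fun γ hγ => (hA γ _ o).2 (hβ γ hγ))

/-- Transfinite induction in `M` yields least elements only for definable sets of ordinals. -/
theorem exists_least {Q : M.O → Prop} [Def fun (_ : ℕ → M.N) o => Q (o 0)] {α : M.O}
    (h : Q α) : ∃ β, (β = α ∨ M.lt β α) ∧ Q β ∧ ∀ γ, M.lt γ β → ¬ Q γ := by
  by_contra hc
  have : ∀ β, (β = α ∨ M.lt β α) → ¬ Q β := by
    intro β
    refine ordInd (Q := fun β => (β = α ∨ M.lt β α) → ¬ Q β)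
      (fun β ih hβ hQβ => ?_) β
    refine hc ⟨β, hβ, hQβ, fun γ hγ => ih γ hγ (.inr ?_)⟩
    rcases hβ with rfl | hβ
    · exact hγ
    · exact hM.lt_trans hγ hβ
  exact this α (.inl rfl) h

omit hM in
theorem Stage.tr {α : M.O} {x : M.N} (h : Stage α x) : Tr x := h.imp fun _ => And.right

theorem Stage.mono {α β : M.O} (h : M.lt α β) {x : M.N} (hx : Stage α x) : Stage β x :=
  hx.imp fun _ => And.imp_left fun h' => hM.lt_trans h' h

theorem Closed.congr {X : M.N → Prop} (hX : Closed X) {x y : M.N} (h : Eqv x y) (hx : X x) : X y :=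
  hX y (.inr ⟨x, h.symm, hx⟩)

theorem closed_tr : Closed (Tr (M := M)) := fun x h => hM.op_tr x (.inl h)

/-- The stage `α` is the one at which the terms `l f b` enter. -/
def Ready (α : M.O) (f : M.N) : Prop := Closed (Stage α) ∧ LimReady (Stage α) f

theorem Ready.congr {α : M.O} {f f' : M.N} (h : Eqv f f') (hf : Ready α f) : Ready α f' :=
  ⟨hf.1, hf.1.congr (eqv_lim.2 ⟨h, .refl _⟩) hf.2.1,
    fun h' => hf.2.2 (hf.1.congr (eqv_lim.2 ⟨h.symm, .refl _⟩) h')⟩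

theorem Closed.natZero {X : M.N → Prop} (hX : Closed X) : X M.natZero :=
  hX _ (.inl (clause_nat.2 isNum_zero))

theorem Closed.zeroEq {X : M.N → Prop} (hX : Closed X) : X M.zeroEq :=
  hX _ (.inl (clause_eq.2 (.refl _)))

theorem Ready.lim {α : M.O} {f b : M.N} (hf : Ready α f) (hb : Stage α b) : M.P α (lim f b) :=
  (hM.stage _ _).2 (.inr (.inr ⟨hf.1, f, b, hf.2, .inl ⟨rfl, hb⟩⟩))

theorem Ready.neg_lim {α : M.O} {f b : M.N} (hf : Ready α f) (hb : ¬ Stage α b) :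
    M.P α (dNeg (KModel.lim f b)) :=
  (hM.stage _ _).2 (.inr (.inr ⟨hf.1, f, b, hf.2, .inr ⟨rfl, hb⟩⟩))

/-- At the earlier stage `α` the set is closed, hence contains `natZero`; so `l f natZero` is added
there and blocks `β`. With linearity, `f` is treated at most once. -/
theorem Ready.not_lt {α β : M.O} {f : M.N} (hf : Ready α f) (hf' : Ready β f) : ¬ M.lt α β :=
  fun h => hf'.2.2 ⟨α, h, hf.lim hf.1.natZero⟩

theorem Ready.unique {α β : M.O} {f : M.N} (hf : Ready α f) (hf' : Ready β f) : α = β :=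
  ((hM.lt_total α β).resolve_left (hf.not_lt hf')).resolve_right (hf'.not_lt hf)

/-- `x` enters at stage `α`, by a clause of `A₀` or by one of `A₁`. -/
def Enters (α : M.O) (x : M.N) : Prop := Clause (Stage α) x ∨
  ∃ f b, Ready α f ∧ ((Eqv x (lim f b) ∧ Stage α b) ∨ (Eqv x (dNeg (lim f b)) ∧ ¬ Stage α b))

/-- Take the least stage at which any term equal to `x` occurs. Minimality over the whole
equivalence class excludes both inheritance from earlier stages and the equality clause, so a proper
clause or `A₁` must have acted. -/
theorem exists_enters {α : M.O} {x : M.N} (h : M.P α x) :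
    ∃ β, (β = α ∨ M.lt β α) ∧ Enters β x := by
  obtain ⟨β, hβ, ⟨c, hc, hP⟩, hmin⟩ :=
    exists_least (Q := fun α => ∃ c, Eqv x c ∧ M.P α c) ⟨x, .refl x, h⟩
  have hmin' : ∀ {c}, Eqv x c → ¬ Stage β c := fun h1 ⟨γ, h2, h3⟩ => hmin γ h2 ⟨_, h1, h3⟩
  refine ⟨β, hβ, ?_⟩
  rcases (hM.stage _ _).1 hP with h1 | (h1 | ⟨b, h1, h2⟩) | ⟨h1, f, b, h2, h3⟩
  · exact (hmin' hc h1).elim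
  · exact .inl (h1.congr hc)
  · exact (hmin' (hc.trans h1) h2).elim
  · refine .inr ⟨f, b, ⟨h1, h2⟩, h3.imp ?_ ?_⟩
    · rintro ⟨rfl, h4⟩; exact ⟨hc, h4⟩
    · rintro ⟨rfl, h4⟩; exact ⟨hc, h4⟩

theorem Stage.exists_enters {α : M.O} {x : M.N} (h : Stage α x) : ∃ β, M.lt β α ∧ Enters β x := by
  obtain ⟨β, h1, h2⟩ := h
  obtain ⟨γ, h3, h4⟩ := KModel.exists_enters h2
  refine ⟨γ, ?_, h4⟩
  rcases h3 with rfl | h3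
  · exact h1
  · exact hM.lt_trans h3 h1

theorem Tr.exists_enters {x : M.N} (h : Tr x) : ∃ β, Enters β x := by
  obtain ⟨β, h1⟩ := h
  obtain ⟨γ, -, h4⟩ := KModel.exists_enters h1
  exact ⟨γ, h4⟩

/-- Neither of the form `l f b` nor of the form `¬̇ (l f b)`. -/
def NotLim (x : M.N) : Prop := ∀ f b, ¬ Eqv x (lim f b) ∧ ¬ Eqv x (dNeg (lim f b))

theorem Enters.clause {α : M.O} {x : M.N} (h : Enters α x) (hx : NotLim x) :
    Clause (Stage α) x := by
  rcases h with h | ⟨f, b, -, ⟨h, -⟩ | ⟨h, -⟩⟩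
  · exact h
  · exact ((hx f b).1 h).elim
  · exact ((hx f b).2 h).elim

/-- Closure gives one direction. Conversely, outside the range of `l` and its negations `A₁` never
acts, so `x` entered by a clause over a smaller stage, and clauses are monotone. -/
theorem stage_iff_clause {α : M.O} (hα : Closed (Stage α)) {x : M.N} (hx : NotLim x) :
    Stage α x ↔ Clause (Stage α) x := by
  refine ⟨fun h => ?_, fun h => hα x (.inl h)⟩
  obtain ⟨β, h1, h2⟩ := h.exists_enters
  exact (h2.clause hx).mono fun y => Stage.mono h1

theorem tr_iff_clause {x : M.N} (hx : NotLim x) : Tr x ↔ Clause Tr x := by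
  refine ⟨fun h => ?_, fun h => closed_tr x (.inl h)⟩
  obtain ⟨β, h2⟩ := h.exists_enters
  exact (h2.clause hx).mono fun y => Stage.tr

/-- The mark cannot stem from `A₁`: that would be an earlier treatment of a term equal to `f`,
contrary to uniqueness. So it stems from the clause, which certifies that `f` was total by then. -/
theorem Ready.lim_clause {α : M.O} {f : M.N} (hf : Ready α f) :
    ∃ β, M.lt β α ∧ Clause (Stage β) (KModel.lim f M.zeroEq) := by
  obtain ⟨β, h1, h2 | ⟨g, b, h2, ⟨h3, -⟩ | ⟨h3, -⟩⟩⟩ := hf.2.1.exists_enters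
  · exact ⟨β, h1, h2⟩
  · rw [eqv_lim] at h3
    exact (hf.not_lt (hf.unique (h2.congr h3.1.symm) ▸ hf) (hf.unique (h2.congr h3.1.symm) ▸ h1)).elim
  · simp at h3

theorem Ready.total {α : M.O} {f : M.N} (hf : Ready α f) (b : M.N) :
    Stage α (ap f b) ∨ Stage α (dNeg (ap f b)) := by
  obtain ⟨β, h1, h2⟩ := hf.lim_clause
  exact (clause_lim (hf.1.congr) (h2.mono fun y => Stage.mono h1)).2 b

/-- If `l f b` entered as a mark, then `b` equals `zeroEq`, which lies in every closed set;
otherwise it entered by `A₁`, at the unique stage where `f` is treated. -/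
theorem Ready.stage_of_lim {α : M.O} {f b : M.N} (hf : Ready α f) (h : Tr (KModel.lim f b)) :
    Stage α b := by
  obtain ⟨β, h2 | ⟨g, c, h2, ⟨h3, h4⟩ | ⟨h3, -⟩⟩⟩ := h.exists_enters
  · exact hf.1.congr (clause_lim closed_tr.congr (h2.mono fun y => Stage.tr)).1.symm hf.1.zeroEq
  · rw [eqv_lim] at h3
    obtain rfl := hf.unique (h2.congr h3.1.symm)
    exact hf.1.congr h3.2.symm h4
  · simp at h3

theorem Ready.not_stage_of_neg_lim {α : M.O} {f b : M.N} (hf : Ready α f)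
    (h : Tr (dNeg (KModel.lim f b))) : ¬ Stage α b := by
  obtain ⟨β, h2 | ⟨g, c, h2, ⟨h3, -⟩ | ⟨h3, h4⟩⟩⟩ := h.exists_enters
  · exact (not_clause_neg_lim h2).elim
  · simp at h3
  · simp at h3
    obtain rfl := hf.unique (h2.congr h3.1.symm)
    exact fun h => h4 (hf.1.congr h3.2 h)

/-- The union of all stages is closed under the whole operator. A mark without `l f natZero` would
let `A₁` act on this union and add it, so `l f natZero` is true. It is not a mark, since `natZero`
differs from `zeroEq`; hence it entered by `A₁`. -/
theorem exists_ready {f : M.N} (h : Tr (lim f M.zeroEq)) : ∃ α, Ready α f := by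
  have h1 : Tr (lim f M.natZero) := by
    by_contra hc
    exact hc (hM.op_tr _ (.inr ⟨closed_tr, f, _, ⟨h, hc⟩, .inl ⟨rfl, closed_tr.natZero⟩⟩))
  obtain ⟨β, h2 | ⟨g, c, h2, ⟨h3, -⟩ | ⟨h3, -⟩⟩⟩ := h1.exists_enters
  · have := (clause_lim closed_tr.congr (h2.mono fun y => Stage.tr)).1
    simp at this
  · rw [eqv_lim] at h3
    exact ⟨β, h2.congr h3.1.symm⟩
  · simp at h3

theorem tr_neg_neg {x : M.N} : Tr (dNeg (dNeg x)) ↔ Tr x := by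
  have h : Tr x → Tr (dNeg (dNeg x)) := fun h =>
    closed_tr _ (.inl ((clause_neg_neg closed_tr.congr).2 h))
  refine ⟨fun h => ?_, h⟩
  rw [tr_iff_clause (by simp [NotLim]), clause_neg_neg closed_tr.congr] at h
  exact h

/-- Truth is consistent. -/
theorem consistent {x : M.N} (h : Tr x) : ¬ Tr (dNeg x) := by
  obtain ⟨α, h⟩ := h
  -- The induction is on the stage of `x` alone; its negation may be true at any stage.
  refine ordInd (Q := fun α => ∀ x, M.P α x → ¬ Tr (dNeg x)) (fun α ih x h => ?_) α x h
  have ih' : ∀ {x : M.N}, Stage α x → ¬ Tr (dNeg x) := fun ⟨β, h1, h2⟩ => ih β h1 _ h2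
  -- Truth of a double negation amounts to truth, so the hypothesis also applies when the negated
  -- formula is the one with the small stage.
  have ihn : ∀ {x : M.N}, Stage α (dNeg x) → ¬ Tr x := fun h h' => ih' h (tr_neg_neg.2 h')
  have hc : ∀ {x y : M.N}, Eqv x y → Tr x → Tr y := closed_tr.congr
  rcases (hM.stage _ _).1 h with h1 | (h1 | ⟨b, h1, h2⟩) | ⟨h1, f, b, h2, h3⟩
  · exact ih' h1
  · intro hn
    have hi : ∀ {y}, Eqv x y → Tr (dNeg y) := fun h => hc h.dNeg hn
    cases h1 <;> rename_i h h' <;> replace hi := hi h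
    · rw [tr_iff_clause (by simp [NotLim]), clause_neg_eq] at hi
      exact hi h'
    · rw [tr_neg_neg, tr_iff_clause (by simp [NotLim]), clause_eq] at hi
      exact h' hi
    · rw [tr_iff_clause (by simp [NotLim]), clause_neg_nat] at hi
      exact hi h'
    · rw [tr_neg_neg, tr_iff_clause (by simp [NotLim]), clause_nat] at hi
      exact h' hi
    · rw [tr_neg_neg] at hi
      exact ih' h' hi
    · rw [tr_iff_clause (by simp [NotLim]), clause_neg_and hc] at hi
      exact hi.elim (ih' h'.1) (ih' h'.2)
    · rw [tr_neg_neg, tr_iff_clause (by simp [NotLim]), clause_and hc] at hi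
      exact h'.elim (fun h => ihn h hi.1) fun h => ihn h hi.2
    · rw [tr_iff_clause (by simp [NotLim]), clause_neg_imp hc] at hi
      exact h'.elim (fun h => ihn h hi.1) fun h => ih' h hi.2
    · rw [tr_neg_neg, tr_iff_clause (by simp [NotLim]), clause_imp hc] at hi
      exact hi.elim (ih' h'.1) (ihn h'.2)
    · rw [tr_iff_clause (by simp [NotLim]), clause_neg_all hc] at hi
      exact hi.elim fun b hb => ih' (h' b) hb
    · rw [tr_neg_neg, tr_iff_clause (by simp [NotLim]), clause_all hc] at hi
      exact h'.elim fun b hb => ihn hb (hi b)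
    -- Here `x` is a mark. Its negation could only come from `A₁` with `zeroEq` missing from a
    -- closed stage, which is impossible.
    · obtain ⟨β, hβ | ⟨g, c, h4, ⟨h5, -⟩ | ⟨h5, h6⟩⟩⟩ := hi.exists_enters
      · exact not_clause_neg_lim hβ
      · simp at h5
      · simp at h5
        exact h6 (h4.1.congr h5.2 h4.1.zeroEq)
  · exact fun h => ih' h2 (hc h1.dNeg h)
  -- `A₁` has acted at the ready stage `α`, and by uniqueness the opposite statement would have to
  -- be decided by membership in the same set.
  · rcases h3 with ⟨rfl, h3⟩ | ⟨rfl, h3⟩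
    · exact fun h => Ready.not_stage_of_neg_lim ⟨h1, h2⟩ h h3
    · rw [tr_neg_neg]
      exact fun h => h3 (Ready.stage_of_lim ⟨h1, h2⟩ h)

/-! ### Universes -/

/-- `f` is a class. -/
def IsClass (f : M.N) : Prop := ∀ x, Tr (ap f x) ∨ Tr (dNeg (ap f x))

/-- `u` is a universe. -/
def IsUniv (u : M.N) : Prop := ∃ f, Eqv u (ap (M.cst .l) f) ∧ IsClass f


/-- A universe is the characteristic function of a closed stage. -/
structure IsStageOf (α : M.O) (u : M.N) : Prop where
  closed : Closed (Stage α)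
  tr (x : M.N) : Tr (ap u x) ↔ Stage α x
  tr_neg (x : M.N) : Tr (dNeg (ap u x)) ↔ ¬ Stage α x

theorem Ready.isStageOf {α : M.O} {f u : M.N} (hf : Ready α f) (hu : Eqv u (ap (M.cst .l) f)) :
    IsStageOf α u := by
  have h : ∀ x, Eqv (ap u x) (KModel.lim f x) := fun x => hu.ap (.refl x)
  refine ⟨hf.1, fun x => ⟨fun h1 => ?_, fun h1 => ?_⟩, fun x => ⟨fun h1 => ?_, fun h1 => ?_⟩⟩
  · exact hf.stage_of_lim (closed_tr.congr (h x) h1)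
  · exact closed_tr.congr (h x).symm ⟨α, hf.lim h1⟩
  · exact hf.not_stage_of_neg_lim (closed_tr.congr (h x).dNeg h1)
  · exact closed_tr.congr (h x).symm.dNeg ⟨α, hf.neg_lim h1⟩

theorem IsClass.exists_ready {f : M.N} (hf : IsClass f) : ∃ α, Ready α f :=
  KModel.exists_ready (closed_tr _ (.inl (.lim f (.refl _) hf)))

theorem IsUniv.exists_stage {u : M.N} (h : IsUniv u) : ∃ α, IsStageOf α u := by
  obtain ⟨f, h1, h2⟩ := h
  obtain ⟨α, hα⟩ := h2.exists_ready
  exact ⟨α, hα.isStageOf h1⟩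

theorem IsUniv.congr {u u' : M.N} (h : IsUniv u) (h' : Eqv u u') : IsUniv u' :=
  h.imp fun _ => And.imp_left h'.symm.trans

theorem IsUniv.isClass {u : M.N} (h : IsUniv u) : IsClass u := by
  obtain ⟨α, hα⟩ := h.exists_stage
  intro x
  rw [hα.tr, hα.tr_neg]
  exact em _

theorem IsUniv.tr {u x : M.N} (h : IsUniv u) (hx : Tr (ap u x)) : Tr x := by
  obtain ⟨α, hα⟩ := h.exists_stage
  exact ((hα.tr x).1 hx).tr

/-- Truth in `u` is membership in a closed stage. Together with the inversion lemmas this yields the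
compositional universe axioms. -/
theorem IsUniv.tr_iff_clause {u x : M.N} (h : IsUniv u) (hx : NotLim x) :
    Tr (ap u x) ↔ Clause (fun x => Tr (ap u x)) x := by
  obtain ⟨α, hα⟩ := h.exists_stage
  simp only [hα.tr]
  exact stage_iff_clause hα.closed hx

theorem tr_ap_congr (u : M.N) {x y : M.N} (h : Eqv x y) (hx : Tr (ap u x)) : Tr (ap u y) :=
  closed_tr.congr (.ap (.refl u) h) hx

theorem IsClass.isUniv {f : M.N} (hf : IsClass f) : IsUniv (ap (M.cst .l) f) := ⟨f, .refl _, hf⟩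

/-- When `f` is treated, each `f x` has already been decided in that stage. By consistency the
decision agrees with truth, and `A₁` passes it on to `l f`. -/
theorem IsClass.reflects {f : M.N} (hf : IsClass f) (x : M.N) :
    (Tr (ap f x) → Tr (lim f (ap f x))) ∧
      (Tr (dNeg (ap f x)) → Tr (lim f (dNeg (ap f x)))) := by
  obtain ⟨α, hα⟩ := hf.exists_ready
  rcases hα.total x with h | h
  · exact ⟨fun _ => ⟨α, hα.lim h⟩, fun h' => (consistent h.tr h').elim⟩
  · exact ⟨fun h' => (consistent h' h.tr).elim, fun _ => ⟨α, hα.lim h⟩⟩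

/-! ### Proposition induction -/

/-- The operator of proposition induction. -/
inductive PropOp (B : M.N → Prop) (x : M.N) : Prop
  | eq (y z : M.N) (h : Eqv x (dEq y z))
  | nat (y : M.N) (h : Eqv x (dNat y))
  | neg (y : M.N) (h : Eqv x (dNeg y)) (h' : B y)
  | and (y z : M.N) (h : Eqv x (dAnd y z))
    (h' : (B y ∧ B z) ∨ (B y ∧ Tr (dNeg y)) ∨ (B z ∧ Tr (dNeg z)))
  | imp (y z : M.N) (h : Eqv x (dImp y z))
    (h' : (B y ∧ B z) ∨ (B y ∧ Tr (dNeg y)) ∨ (B z ∧ Tr z))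
  | all (g : M.N) (h : Eqv x (dAll g))
    (h' : (∀ y, B (ap g y)) ∨ ∃ y, B (ap g y) ∧ Tr (dNeg (ap g y)))
  | lim (f y : M.N) (h : Eqv x (lim f y)) (h' : ∀ z, B (ap f z))

theorem propInd {B : M.N → Prop} [hB : DefSet B] (hc : ∀ x y, Eqv x y → B x → B y)
    (h : ∀ x, PropOp B x → B x) {x : M.N} (hx : Tr x ∨ Tr (dNeg x)) : B x := by
  -- The clauses may rest on a true negation and then need `B` of the formula negated, so `B y` is
  -- carried along whenever `x` equals the negation of `y`.
  have main : ∀ (α : M.O) (x : M.N), M.P α x → B x ∧ ∀ y, Eqv x (dNeg y) → B y := by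
    intro α
    refine ordInd (Q := fun α => ∀ x, M.P α x → B x ∧ ∀ y, Eqv x (dNeg y) → B y)
      (fun α ih x hx => ?_) α
    have ih1 : ∀ {x}, Stage α x → B x := fun ⟨β, h1, h2⟩ => (ih β h1 _ h2).1
    have ih2 : ∀ {x}, Stage α (dNeg x) → B x := fun ⟨β, h1, h2⟩ => (ih β h1 _ h2).2 _ (.refl _)
    have pos : ∀ {x : M.N}, B x → (∀ y, ¬ Eqv x (dNeg y)) → B x ∧ ∀ y, Eqv x (dNeg y) → B y :=
      fun h h' => ⟨h, fun y hy => (h' y hy).elim⟩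
    have neg : ∀ {x y : M.N}, Eqv x (dNeg y) → B y → B x ∧ ∀ y, Eqv x (dNeg y) → B y := by
      intro x y hxy hy
      refine ⟨h x (.neg y hxy hy), fun z hz => hc y z ?_ hy⟩
      have := hxy.symm.trans hz
      rw [eqv_app (by simp) (by simp)] at this
      exact this.2
    have npos : ∀ {x y : M.N}, Eqv x y → (∀ z, ¬ Eqv y (dNeg z)) → ∀ z, ¬ Eqv x (dNeg z) :=
      fun h h' z hz => h' z (h.symm.trans hz)
    -- The clause that marks `f` has all `f z` decided in earlier stages. So `B` holds of each `f
    -- z`, and then of `l f b` for every `b`.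
    have lim : ∀ {f}, Clause (Stage α) (lim f M.zeroEq) → ∀ b, B (lim f b) := by
      intro f hf b
      cases hf <;> rename_i he h' <;> simp at he
      refine h _ (.lim _ b (eqv_lim.2 ⟨he, .refl b⟩) fun z => ?_)
      exact (h' z).elim ih1 ih2
    rcases (hM.stage _ _).1 hx with h1 | (h1 | ⟨b, h1, h2⟩) | ⟨h1, f, b, h2, h3⟩
    · obtain ⟨β, h1, h2⟩ := h1
      exact ih β h1 x h2
    · cases h1 <;> rename_i he h'
      · exact pos (h x (.eq _ _ he)) (npos he (by simp))
      · exact neg he (h _ (.eq _ _ (.refl _)))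
      · exact pos (h x (.nat _ he)) (npos he (by simp))
      · exact neg he (h _ (.nat _ (.refl _)))
      · exact neg he (h _ (.neg _ (.refl _) (ih1 h')))
      · exact pos (h x (.and _ _ he (.inl (h'.imp ih1 ih1)))) (npos he (by simp))
      · refine neg he (h _ (.and _ _ (.refl _) (.inr (h'.imp ?_ ?_)))) <;>
          exact fun h' => ⟨ih2 h', h'.tr⟩
      · refine pos (h x (.imp _ _ he (.inr (h'.imp ?_ ?_)))) (npos he (by simp))
        · exact fun h' => ⟨ih2 h', h'.tr⟩
        · exact fun h' => ⟨ih1 h', h'.tr⟩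
      · exact neg he (h _ (.imp _ _ (.refl _) (.inl (h'.imp ih1 ih2))))
      · exact pos (h x (.all _ he (.inl fun b => ih1 (h' b)))) (npos he (by simp))
      · exact neg he (h _ (.all _ (.refl _) (.inr (h'.imp fun b hb => ⟨ih2 hb, hb.tr⟩))))
      · refine pos (hc _ _ he.symm (lim (.lim _ (.refl _) h') _)) (npos he (by simp))
    · obtain ⟨β, h3, h4⟩ := h2
      obtain ⟨h5, h6⟩ := ih β h3 b h4
      exact ⟨hc _ _ h1.symm h5, fun y hy => h6 y (h1.symm.trans hy)⟩
    -- For terms added by `A₁`, the totality of `f` is recovered from the earlier stage at which its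
    -- mark entered.
    · have hr : Ready α f := ⟨h1, h2⟩
      obtain ⟨β, h4, h5⟩ := hr.lim_clause
      have h6 := lim (h5.mono fun y => Stage.mono h4) b
      rcases h3 with ⟨rfl, h3⟩ | ⟨rfl, h3⟩
      · exact pos h6 (by simp)
      · exact neg (.refl _) h6
  rcases hx with ⟨α, hα⟩ | ⟨α, hα⟩
  · exact (main α x hα).1
  · exact (main α _ hα).2 x (.refl _)

end KModel

/-! ## Semantics of the operator forms -/

@[simp] theorem scons_zero {α : Type*} (a : α) (f : ℕ → α) : scons a f 0 = a := rfl

@[simp] theorem scons_succ {α : Type*} (a : α) (f : ℕ → α) (i : ℕ) : scons a f (i + 1) = f i := rfl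

namespace KModel
variable {M : KModel}

/-- The set variable ranges over arbitrary subsets of the model, so one computation serves both for
the stages and for their union. -/
def osat (M : KModel) (X : M.N → Prop) : OpForm → (ℕ → M.N) → Prop
  | .eq s t, v => M.eval v s = M.eval v t
  | .mem t, v => X (M.eval v t)
  | .neg A, v => ¬ M.osat X A v
  | .and A B, v => M.osat X A v ∧ M.osat X B v
  | .imp A B, v => M.osat X A v → M.osat X B v
  | .all A, v => ∀ x, M.osat X A (scons x v)

theorem sat_toK {F : NTerm → KForm} {X : M.N → Prop} {o : ℕ → M.O}
    (hF : ∀ t v, M.sat (F t) v o ↔ X (M.eval v t)) (A : OpForm) (v : ℕ → M.N) :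
    M.sat (A.toK F) v o ↔ M.osat X A v := by
  induction A generalizing v with
  | eq s t => rfl
  | mem t => exact hF t v
  | neg A ih => exact not_congr (ih v)
  | and A B ih₁ ih₂ => exact and_congr (ih₁ v) (ih₂ v)
  | imp A B ih₁ ih₂ => exact imp_congr (ih₁ v) (ih₂ v)
  | all A ih => exact forall_congr' fun x => ih _

theorem sat_Pbelow (α : ℕ) (t : NTerm) (v : ℕ → M.N) (o : ℕ → M.O) :
    M.sat (.Pbelow α t) v o ↔ Stage (o α) (M.eval v t) := by
  simp [KForm.Pbelow, KForm.exO, sat, Stage]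

theorem sat_Pinf (t : NTerm) (v : ℕ → M.N) (o : ℕ → M.O) :
    M.sat (.Pinf t) v o ↔ Tr (M.eval v t) := by
  simp [KForm.Pinf, KForm.exO, sat, Tr]

section
variable (X : M.N → Prop) (v : ℕ → M.N)

theorem osat_subst (A : OpForm) (σ : ℕ → NTerm) :
    M.osat X (A.subst σ) v ↔ M.osat X A (fun i => M.eval v (σ i)) := by
  induction A generalizing σ v with
  | eq s t => simp only [OpForm.subst, osat, eval_subst]
  | mem t => simp only [OpForm.subst, osat, eval_subst]
  | neg A ih => simp only [OpForm.subst, osat, ih]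
  | and A B ih₁ ih₂ => simp only [OpForm.subst, osat, ih₁, ih₂]
  | imp A B ih₁ ih₂ => simp only [OpForm.subst, osat, ih₁, ih₂]
  | all A ih =>
    simp only [OpForm.subst, osat, ih]
    refine forall_congr' fun x => iff_of_eq (congrArg _ (funext fun i => ?_))
    cases i with
    | zero => rfl
    | succ i => exact eval_subst _ _ _

theorem osat_or (A B : OpForm) : M.osat X (.or A B) v ↔ M.osat X A v ∨ M.osat X B v := by
  simp only [OpForm.or, osat]; tauto

theorem osat_ex (A : OpForm) : M.osat X (.ex A) v ↔ ∃ x, M.osat X A (scons x v) := by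
  simp [OpForm.ex, osat]

end

theorem eval_fn1 (v : ℕ → M.N) (f : PR 1) (s : NTerm) :
    M.eval v (.fn f ![s]) = M.fn f ![M.eval v s] := by
  rw [eval]; congr 1; funext i; fin_cases i; rfl

theorem eval_fn2 (v : ℕ → M.N) (f : PR 2) (s t : NTerm) :
    M.eval v (.fn f ![s, t]) = M.fn f ![M.eval v s, M.eval v t] := by
  rw [eval]; congr 1; funext i; fin_cases i <;> rfl

section
variable (v : ℕ → M.N) (s t : NTerm)

theorem eval_pair : M.eval v (.pair s t) = pair (M.eval v s) (M.eval v t) := eval_fn2 ..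
theorem eval_left : M.eval v (.left s) = left (M.eval v s) := eval_fn1 ..
theorem eval_right : M.eval v (.right s) = right (M.eval v s) := eval_fn1 ..
theorem eval_nth : M.eval v (.nth s t) = nth (M.eval v s) (M.eval v t) := eval_fn2 ..
theorem eval_fnPart : M.eval v (.fnPart s) = fnPart (M.eval v s) := eval_fn1 ..
theorem eval_argPart : M.eval v (.argPart s) = argPart (M.eval v s) := eval_fn1 ..
theorem eval_num : M.eval v (.num s) = num (M.eval v s) := eval_fn1 ..
theorem eval_ap : M.eval v (.ap s t) = ap (M.eval v s) (M.eval v t) := eval_fn2 ..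
theorem eval_var (i : ℕ) : M.eval v (.var i) = v i := rfl

end

section
variable (X : M.N → Prop) (v : ℕ → M.N)

theorem osat_inst1 (A : OpForm) (s : NTerm) :
    M.osat X (A.inst1 s) v ↔ M.osat X A (scons (M.eval v s) v) := by
  rw [OpForm.inst1, osat_subst]
  exact iff_of_eq (congrArg _ (funext fun i => by cases i <;> rfl))

theorem osat_inst2 (A : OpForm) (s t : NTerm) :
    M.osat X (A.inst2 s t) v ↔ M.osat X A (scons (M.eval v s) (scons (M.eval v t) v)) := by
  rw [OpForm.inst2, osat_subst]
  exact iff_of_eq (congrArg _ (funext fun i => by rcases i with _ | _ | i <;> rfl))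

end

variable [hM : IsPA M]

section
variable (v : ℕ → M.N) (r s t : NTerm)

theorem eval_cst (c : FConst) : M.eval v (.cst c) = M.cst c := eval_numeral _ _
omit hM in
theorem eval_ap2 : M.eval v (.ap2 r s t) = ap2 (M.eval v r) (M.eval v s) (M.eval v t) := by
  rw [NTerm.ap2, eval_ap, eval_ap]; rfl
theorem eval_tpair : M.eval v (.tpair s t) = tpair (M.eval v s) (M.eval v t) := by
  rw [NTerm.tpair, eval_ap2, eval_cst]; rfl
theorem eval_dEq : M.eval v (.dEq s t) = dEq (M.eval v s) (M.eval v t) := by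
  rw [NTerm.dEq, eval_ap, eval_cst, eval_tpair]
theorem eval_dNeg : M.eval v (.dNeg s) = dNeg (M.eval v s) := by
  rw [NTerm.dNeg, eval_ap, eval_cst]
theorem eval_dAnd : M.eval v (.dAnd s t) = dAnd (M.eval v s) (M.eval v t) := by
  rw [NTerm.dAnd, eval_ap, eval_cst, eval_tpair]
theorem eval_dImp : M.eval v (.dImp s t) = dImp (M.eval v s) (M.eval v t) := by
  rw [NTerm.dImp, eval_ap, eval_cst, eval_tpair]
theorem eval_dAll : M.eval v (.dAll s) = dAll (M.eval v s) := by
  rw [NTerm.dAll, eval_ap, eval_cst]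
theorem eval_dNat : M.eval v (.dNat s) = dNat (M.eval v s) := by
  rw [NTerm.dNat, eval_ap, eval_cst]
theorem eval_lim : M.eval v (.lim s t) = lim (M.eval v s) (M.eval v t) := by
  rw [NTerm.lim, eval_ap2, eval_cst]; rfl
theorem eval_zeroEq : M.eval v .zeroEq = M.zeroEq := by
  rw [NTerm.zeroEq, eval_dEq, eval_cst]
theorem eval_natZero : M.eval v .natZero = M.natZero := by
  rw [NTerm.natZero, eval_dNat, eval_cst]

theorem osat_lt (X : M.N → Prop) : M.osat X (.lt s t) v ↔ M.eval v s < M.eval v t := by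
  simp only [OpForm.lt, OpForm.ne, osat, NTerm.sub, eval_fn2, eval_zero]; rfl

end

variable (X : M.N → Prop) (v : ℕ → M.N)

theorem osat_contr : M.osat X .contr v ↔ Contr (v 0) (v 1) := by
  simp only [OpForm.contr, OpForm.ne, osat, osat_or, osat_ex, eval_ap2, eval_ap, eval_cst,
    eval_tpair, eval_num, eval_var, scons]
  constructor
  · rintro (⟨x, y, h, h'⟩ | ⟨x, y, z, h, h'⟩ | ⟨x, y, h, h'⟩ | ⟨x, y, h, h'⟩ | ⟨x, h, h'⟩ |
      ⟨x, y, n, h, h'⟩ | ⟨x, y, m, n, hmn, h, h'⟩)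
    · exact .inl (.inl ⟨y, by rw [h', h]⟩)
    · exact .inr ⟨x, y, z, h, h'⟩
    · exact .inl (.inr (.inl ⟨y, by rw [h', h]⟩))
    · exact .inl (.inr (.inr (.inl ⟨x, by rw [h', h]⟩)))
    · exact .inl (.inr (.inr (.inr (.inl (by rw [h', h])))))
    · exact .inl (.inr (.inr (.inr (.inr (.inl ⟨y, n, by rw [h', h]⟩)))))
    · exact .inl (.inr (.inr (.inr (.inr (.inr ⟨x, m, n, hmn, by rw [h', h]⟩)))))
  · rintro ((⟨y, h⟩ | ⟨y, h⟩ | ⟨y, h⟩ | h | ⟨y, n, h⟩ | ⟨y, m, n, hmn, h⟩) | ⟨x, y, z, h, h'⟩)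
    · exact .inl ⟨_, _, h, rfl⟩
    · exact .inr (.inr (.inl ⟨_, _, h, rfl⟩))
    · exact .inr (.inr (.inr (.inl ⟨_, _, h, rfl⟩)))
    · exact .inr (.inr (.inr (.inr (.inl ⟨_, h, rfl⟩))))
    · exact .inr (.inr (.inr (.inr (.inr (.inl ⟨_, _, _, h, rfl⟩)))))
    · exact .inr (.inr (.inr (.inr (.inr (.inr ⟨_, _, _, _, hmn, h, rfl⟩)))))
    · exact .inr (.inl ⟨_, _, _, h, h'⟩)

/-- `Der` was shaped after the formula, so after evaluation both sides agree up to the grouping of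
disjunctions. -/
theorem osat_red : M.osat X .red v ↔ Red (v 0) (v 1) := by
  simp only [OpForm.red, OpForm.justified, osat, osat_or, osat_ex, osat_lt, osat_inst2, osat_contr,
    OpForm.src, OpForm.tgt, eval_left, eval_right, eval_nth, eval_pair, eval_ap, eval_zero,
    eval_var, scons]
  simp only [Red, Der, RedAx, RedRule, CompatRule, TransRule, or_assoc]

theorem osat_eqv (s t : NTerm) : M.osat X (.eqv s t) v ↔ Eqv (M.eval v s) (M.eval v t) := by
  simp only [OpForm.eqv, osat_inst2, osat_ex, osat, osat_red, eval_var, scons, Eqv]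

theorem osat_isNat (t : NTerm) : M.osat X (.isNat t) v ↔ IsNum (M.eval v t) := by
  simp only [OpForm.isNat, osat_inst1, osat_inst2, osat_ex, osat_red, eval_num, eval_var, scons,
    IsNum]

theorem osat_opA₀ : M.osat X .opA₀ v ↔ OpA₀ X (v 0) := by
  simp only [OpForm.opA₀, osat, osat_or, osat_ex, osat_eqv, osat_isNat, eval_dEq, eval_dNeg,
    eval_dNat, eval_dAnd, eval_dImp, eval_dAll, eval_lim, eval_zeroEq, eval_ap, eval_var, scons]
  constructor
  · rintro (⟨b, c, h, h'⟩ | ⟨b, c, h, h'⟩ | ⟨b, h, h'⟩ | ⟨b, h, h'⟩ | ⟨b, h, h'⟩ | ⟨b, c, h, h'⟩ |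
      ⟨b, c, h, h'⟩ | ⟨b, c, h, h'⟩ | ⟨b, c, h, h'⟩ | ⟨f, h, h'⟩ | ⟨f, h, h'⟩ | ⟨f, h, h'⟩ | h)
    · exact .inl (.eq b c h h')
    · exact .inl (.neg_eq b c h h')
    · exact .inl (.nat b h h')
    · exact .inl (.neg_nat b h h')
    · exact .inl (.neg_neg b h h')
    · exact .inl (.and b c h h')
    · exact .inl (.neg_and b c h h')
    · exact .inl (.imp b c h h')
    · exact .inl (.neg_imp b c h h')
    · exact .inl (.all f h h')
    · exact .inl (.neg_all f h h')
    · exact .inl (.lim f h h')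
    · exact .inr h
  · rintro ((⟨b, c, h, h'⟩ | ⟨b, c, h, h'⟩ | ⟨b, h, h'⟩ | ⟨b, h, h'⟩ | ⟨b, h, h'⟩ | ⟨b, c, h, h'⟩ |
      ⟨b, c, h, h'⟩ | ⟨b, c, h, h'⟩ | ⟨b, c, h, h'⟩ | ⟨f, h, h'⟩ | ⟨f, h, h'⟩ | ⟨f, h, h'⟩) | h)
    · exact .inl ⟨b, c, h, h'⟩
    · iterate 1 right
      exact .inl ⟨b, c, h, h'⟩
    · iterate 2 right
      exact .inl ⟨b, h, h'⟩
    · iterate 3 right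
      exact .inl ⟨b, h, h'⟩
    · iterate 4 right
      exact .inl ⟨b, h, h'⟩
    · iterate 5 right
      exact .inl ⟨b, c, h, h'⟩
    · iterate 6 right
      exact .inl ⟨b, c, h, h'⟩
    · iterate 7 right
      exact .inl ⟨b, c, h, h'⟩
    · iterate 8 right
      exact .inl ⟨b, c, h, h'⟩
    · iterate 9 right
      exact .inl ⟨f, h, h'⟩
    · iterate 10 right
      exact .inl ⟨f, h, h'⟩
    · iterate 11 right
      exact .inl ⟨f, h, h'⟩
    · iterate 12 right
      exact h

theorem osat_opA₁ : M.osat X .opA₁ v ↔ OpA₁ X (v 0) := by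
  simp only [OpForm.opA₁, OpForm.limReady, osat, osat_or, eval_dNeg, eval_lim, eval_zeroEq,
    eval_natZero, eval_argPart, eval_fnPart, eval_var]
  constructor
  · rintro (⟨⟨h1, h2⟩, h3⟩ | ⟨h1, ⟨h2, h3⟩, h4⟩)
    · exact ⟨_, _, h2, .inl ⟨h1, h3⟩⟩
    · exact ⟨_, _, h3, .inr ⟨by rw [← h2]; exact h1, h4⟩⟩
  · have hf : ∀ f b : M.N, fnPart (lim f b) = ap (M.cst .l) f := fun f b => fnPart_ap _ _
    have ha : ∀ f b : M.N, argPart (lim f b) = b := fun f b => argPart_ap _ _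
    rintro ⟨f, b, h1, ⟨h2, h3⟩ | ⟨h2, h3⟩⟩
    · rw [h2, hf, ha, argPart_ap]
      exact .inl ⟨⟨rfl, h1⟩, h3⟩
    · rw [h2, argPart_ap, hf, ha, argPart_ap]
      exact .inr ⟨rfl, ⟨rfl, h1⟩, h3⟩

theorem osat_combine : M.osat X (.combine .opA₀ .opA₁) v ↔ Op X (v 0) := by
  simp only [OpForm.combine, osat_or, osat, osat_opA₀, osat_opA₁, eval_var, scons]
  rfl

end KModel

theorem KModel.IsFID.of_models {M : KModel} [hO : Nonempty M.O]
    (h : M.Models (FID .opA₀ .opA₁)) : IsFID M := by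
  have hPA : IsPA M := ⟨hO, fun A hA => h A (.pa hA)⟩
  have v : ℕ → M.N := fun _ => 0
  refine { hPA with
    lt_irrefl := fun α => h _ .lt_irrefl v fun _ => α
    lt_trans := fun {α β γ} h1 h2 => h _ .lt_trans v (scons α (scons β fun _ => γ)) ⟨h1, h2⟩
    lt_total := fun α β => ?_, stage := fun α x => ?_, op_tr := fun x hx => ?_
    tind := fun A v o hA => ?_ }
  · have := h _ .lt_total v (scons α fun _ => β)
    simp only [KForm.or, sat, scons] at this
    tauto
  · have := h _ .op1 (fun _ => x) fun _ => α
    simp only [KForm.or, KForm.iff, sat, sat_Pbelow, eval_var,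
      sat_toK (fun t v => sat_Pbelow 0 t v _), osat_combine] at this
    rw [or_iff_not_and_not]
    exact ⟨this.1, this.2⟩
  · have := h _ .op2 (fun _ => x) fun _ => Classical.choice hO
    simp only [sat, sat_Pinf, eval_var, sat_toK (fun t v => sat_Pinf t v _), osat_combine] at this
    exact this hx
  · have := h _ (.tind A) v o
    simp only [sat, KForm.atO_eq, sat_subst] at this
    refine this fun α h1 => hA α fun β hβ => ?_
    have h2 := h1 β hβ
    rwa [show (fun i => scons β (scons α o) (scons 0 (fun i => i + 2) i)) = scons β o from
      funext fun i => by cases i <;> rfl] at h2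

/-! ## Soundness of the translation -/

theorem FForm.at_eq (A : FForm) (m : ℕ) (t : FTerm) :
    A.at' m t = A.subst (scons t fun i => .var (i + m)) := by
  unfold FForm.at'; congr 1

namespace KModel
variable {M : KModel}

section
variable [hM : IsPA M]

def feval (M : KModel) [IsPA M] (v : ℕ → M.N) : FTerm → M.N
  | .var i => v i
  | .const c => M.cst c
  | .app s t => ap (M.feval v s) (M.feval v t)

/-- The interpretation of the language of Frege structures in a model. -/
def fsat (M : KModel) [IsPA M] : FForm → (ℕ → M.N) → Prop
  | .eq s t, v => Eqv (M.feval v s) (M.feval v t)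
  | .nat t, v => IsNum (M.feval v t)
  | .tr t, v => Tr (M.feval v t)
  | .univ t, v => ∃ f, Eqv (M.feval v t) (ap (M.cst .l) f) ∧ ∀ x, Tr (ap f x) ∨ Tr (dNeg (ap f x))
  | .neg A, v => ¬ M.fsat A v
  | .and A B, v => M.fsat A v ∧ M.fsat B v
  | .imp A B, v => M.fsat A v → M.fsat B v
  | .all A, v => ∀ x, M.fsat A (scons x v)

theorem eval_star (v : ℕ → M.N) (t : FTerm) : M.eval v t.star = M.feval v t := by
  induction t with
  | var i => rfl
  | const c => exact eval_cst v c
  | app s t ih₁ ih₂ => rw [FTerm.star, eval_ap, ih₁, ih₂]; rfl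

theorem sat_star (A : FForm) (v : ℕ → M.N) (o : ℕ → M.O) : M.sat A.star v o ↔ M.fsat A v := by
  have hF := fun t v => sat_Pinf (M := M) t v o
  induction A generalizing v with
  | eq s t => simp only [FForm.star, sat_toK hF, osat_eqv, eval_star, fsat]
  | nat t => simp only [FForm.star, sat_toK hF, osat_isNat, eval_star, fsat]
  | tr t => simp only [FForm.star, sat_Pinf, eval_star, fsat]
  | univ t =>
    simp only [FForm.star, sat_toK hF, osat_inst1, osat_ex, osat, osat_eqv, osat_or, eval_ap,
      eval_dNeg, eval_cst, eval_var, eval_star, fsat, scons]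
  | neg A ih => exact not_congr (ih v)
  | and A B ih₁ ih₂ => exact and_congr (ih₁ v) (ih₂ v)
  | imp A B ih₁ ih₂ => exact imp_congr (ih₁ v) (ih₂ v)
  | all A ih => exact forall_congr' fun x => ih _

theorem feval_subst (σ : ℕ → FTerm) (v : ℕ → M.N) (t : FTerm) :
    M.feval v (t.subst σ) = M.feval (fun i => M.feval v (σ i)) t := by
  induction t with
  | var i => rfl
  | const c => rfl
  | app s t ih₁ ih₂ => simp only [FTerm.subst, feval, ih₁, ih₂]

theorem fsat_subst (A : FForm) (σ : ℕ → FTerm) (v : ℕ → M.N) :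
    M.fsat (A.subst σ) v ↔ M.fsat A (fun i => M.feval v (σ i)) := by
  induction A generalizing σ v with
  | eq s t => simp only [FForm.subst, fsat, feval_subst]
  | nat t => simp only [FForm.subst, fsat, feval_subst]
  | tr t => simp only [FForm.subst, fsat, feval_subst]
  | univ t => simp only [FForm.subst, fsat, feval_subst]
  | neg A ih => simp only [FForm.subst, fsat, ih]
  | and A B ih₁ ih₂ => simp only [FForm.subst, fsat, ih₁, ih₂]
  | imp A B ih₁ ih₂ => simp only [FForm.subst, fsat, ih₁, ih₂]
  | all A ih =>
    simp only [FForm.subst, fsat, ih]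
    refine forall_congr' fun x => iff_of_eq (congrArg _ (funext fun i => ?_))
    cases i with
    | zero => rfl
    | succ i => exact feval_subst _ _ _

theorem fsat_at (A : FForm) (m : ℕ) (t : FTerm) (v : ℕ → M.N) :
    M.fsat (A.at' m t) v ↔ M.fsat A (scons (M.feval v t) fun i => v (i + m)) := by
  rw [FForm.at_eq, fsat_subst]
  exact iff_of_eq (congrArg _ (funext fun i => by cases i <;> rfl))

theorem fsat_or (A B : FForm) (v : ℕ → M.N) :
    M.fsat (.or A B) v ↔ M.fsat A v ∨ M.fsat B v := by
  simp only [FForm.or, fsat]; tauto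

theorem fsat_ex (A : FForm) (v : ℕ → M.N) : M.fsat (.ex A) v ↔ ∃ x, M.fsat A (scons x v) := by
  simp [FForm.ex, fsat]

theorem fsat_iff (A B : FForm) (v : ℕ → M.N) :
    M.fsat (.iff A B) v ↔ (M.fsat A v ↔ M.fsat B v) := by
  simp only [FForm.iff, fsat]; tauto

/-- Truth of a formula in the interpretation is definable through its translation; this makes the
schemata of induction and proposition induction available for all formulas. -/
instance (A : FForm) (v : ℕ → M.N) : DefSet fun x => M.fsat A (scons x v) := by
  refine ⟨A.star, scons (.inl 0) fun i => .inr (v i), .inl, fun w o => ?_⟩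
  rw [sat_star]
  exact iff_of_eq (congrArg _ (funext fun i => by cases i <;> rfl))

theorem feval_congr {v w : ℕ → M.N} (h : ∀ i, Eqv (v i) (w i)) (t : FTerm) :
    Eqv (M.feval v t) (M.feval w t) := by
  induction t with
  | var i => exact h i
  | const c => exact .refl _
  | app s t ih₁ ih₂ => exact ih₁.ap ih₂

end

variable [hM : IsFID M]

theorem fsat_univ (t : FTerm) (v : ℕ → M.N) : M.fsat (.univ t) v ↔ IsUniv (M.feval v t) := Iff.rfl

/-- `Eqv` is a congruence for application and the three atomic predicates. Hence it can interpret
equality although it is not identity of codes. -/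
theorem fsat_congr (A : FForm) {v w : ℕ → M.N} (h : ∀ i, Eqv (v i) (w i)) :
    M.fsat A v ↔ M.fsat A w := by
  induction A generalizing v w with
  | eq s t =>
    exact ⟨fun h' => ((feval_congr h s).symm.trans h').trans (feval_congr h t),
      fun h' => ((feval_congr h s).trans h').trans (feval_congr h t).symm⟩
  | nat t =>
    exact ⟨fun h' => h'.congr (feval_congr h t), fun h' => h'.congr (feval_congr h t).symm⟩
  | tr t => exact ⟨closed_tr.congr (feval_congr h t), closed_tr.congr (feval_congr h t).symm⟩
  | univ t =>
    rw [fsat_univ, fsat_univ]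
    exact ⟨fun h' => h'.congr (feval_congr h t), fun h' => h'.congr (feval_congr h t).symm⟩
  | neg A ih => exact not_congr (ih h)
  | and A B ih₁ ih₂ => exact and_congr (ih₁ h) (ih₂ h)
  | imp A B ih₁ ih₂ => exact imp_congr (ih₁ h) (ih₂ h)
  | all A ih =>
    refine forall_congr' fun x => ih fun i => ?_
    cases i with
    | zero => exact .refl x
    | succ i => exact h i

theorem fsat_scons_congr (A : FForm) {x y : M.N} (h : Eqv x y) (v : ℕ → M.N) :
    M.fsat A (scons x v) ↔ M.fsat A (scons y v) := by
  refine fsat_congr A fun i => ?_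
  cases i with
  | zero => exact h
  | succ i => exact .refl _

theorem ind_num {Q : M.N → Prop} [DefSet Q] (h0 : Q (num 0))
    (hs : ∀ n, Q (num n) → Q (num (succ n))) (n : M.N) : Q (num n) :=
  ind (Q := fun n => Q (num n)) h0 hs n

theorem inert_dotted {c : FConst} (h : c.IsDotted) : Inert c := by
  cases c <;> simp_all [FConst.IsDotted, Inert]

/-! ### Truth of the axioms of `KFUPI` -/

theorem fsat_TON {A : FForm} (h : TON A) (v : ℕ → M.N) : M.fsat A v := by
  have hz : Eqv (num 0) (M.cst .zero) := num_zero (M := M) ▸ .refl _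
  cases h with
  | k => exact eqv_k _ _
  | s => exact eqv_s _ _ _
  | pair => exact ⟨eqv_p0 _ _, eqv_p1 _ _⟩
  | nat_zero_succ =>
    refine ⟨isNum_zero, fun x hx => ?_⟩
    obtain ⟨n, hn⟩ := IsNum.exists_eqv hx
    exact .of_eqv (n := succ n) (num_succ n ▸ .ap (.refl _) hn)
  | succ => exact fun x _ => ⟨fun h => eqv_cst_app (by simp) h.symm, eqv_pN x⟩
  | pred =>
    rintro x ⟨hx, hx'⟩
    obtain ⟨n, hn⟩ := IsNum.exists_eqv hx
    rcases eq_zero_or_succ n with rfl | ⟨n, rfl⟩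
    · exact (hx' (hn.trans hz)).elim
    · rw [num_succ] at hn
      have h1 : Eqv (ap (M.cst .pN) x) (num n) := (Eqv.ap (.refl _) hn).trans (eqv_pN _)
      exact ⟨.of_eqv h1, (Eqv.ap (.refl _) h1).trans hn.symm⟩
  | cases_eq =>
    rintro ⟨h0, -, h⟩
    obtain ⟨n, hn⟩ := IsNum.exists_eqv h0
    exact (Eqv.ap2 (.refl _) hn (Eqv.trans (Eqv.symm h) hn)).trans (eqv_dN_eq _ _ n)
  | cases_ne =>
    rintro ⟨h0, h1, h⟩
    obtain ⟨m, hm⟩ := IsNum.exists_eqv h0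
    obtain ⟨n, hn⟩ := IsNum.exists_eqv h1
    refine (Eqv.ap2 (.refl _) hm hn).trans (eqv_dN_ne _ _ ?_)
    rintro rfl
    exact h (hm.trans hn.symm)
  | ind A =>
    rintro ⟨h0, hs⟩ x ⟨n, hn⟩
    rw [fsat_at] at h0
    -- An element of the interpreted `N` equals some numeral `num n` with `n` in `M`, so the schema
    -- becomes induction on `n` in `M`.
    refine (fsat_scons_congr A hn.eqv v).2 ?_
    refine ind_num (Q := fun x => M.fsat A (scons x v))
      ((fsat_scons_congr A hz v).2 h0) (fun n ih => ?_) n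
    have := hs (num n) ⟨⟨n, .refl _⟩, ih⟩
    rw [fsat_at] at this
    rw [num_succ]
    exact this

theorem fsat_cls (i : ℕ) (v : ℕ → M.N) : M.fsat (.cls i) v ↔ IsClass (v i) := by
  simp only [FForm.cls, FForm.prop, fsat, fsat_or]; rfl

/-- Each compositional axiom concerns a term that is neither `l f b` nor its negation, and so
combines `IsUniv.tr_iff_clause` with the matching inversion lemma. -/
theorem fsat_KFUAx {A : FForm} (h : KFUAx A) (v : ℕ → M.N) : M.fsat A v := by
  have hc : ∀ u : M.N, ∀ {x y}, Eqv x y → Tr (ap u x) → Tr (ap u y) :=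
    fun u _ _ => tr_ap_congr u
  cases h with
  | lim =>
    intro h
    rw [fsat_cls] at h
    exact ⟨h.isUniv, fun x => (h.reflects x).1, fun x => (h.reflects x).2⟩
  | u_cons => exact fun (h : IsUniv (v 0)) x hx => consistent (h.tr hx.1) (h.tr hx.2)
  | u_class =>
    intro (h : IsUniv (v 0))
    rw [fsat_cls]
    exact h.isClass
  | u_true => exact fun (h : IsUniv (v 0)) x => h.tr
  | u_eq =>
    intro (h : IsUniv (v 0)) x y
    rw [fsat_iff]
    exact (h.tr_iff_clause (x := dEq x y) (by simp [NotLim])).trans clause_eq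
  | u_neg_eq =>
    intro (h : IsUniv (v 0)) x y
    rw [fsat_iff]
    exact (h.tr_iff_clause (x := dNeg (dEq x y)) (by simp [NotLim])).trans clause_neg_eq
  | u_nat =>
    intro (h : IsUniv (v 0)) x
    rw [fsat_iff]
    exact (h.tr_iff_clause (x := dNat x) (by simp [NotLim])).trans clause_nat
  | u_neg_nat =>
    intro (h : IsUniv (v 0)) x
    rw [fsat_iff]
    exact (h.tr_iff_clause (x := dNeg (dNat x)) (by simp [NotLim])).trans clause_neg_nat
  | u_neg_neg =>
    intro (h : IsUniv (v 0)) x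
    rw [fsat_iff]
    exact (h.tr_iff_clause (x := dNeg (dNeg x)) (by simp [NotLim])).trans (clause_neg_neg (hc _))
  | u_and =>
    intro (h : IsUniv (v 0)) x y
    rw [fsat_iff]
    exact (h.tr_iff_clause (x := dAnd x y) (by simp [NotLim])).trans (clause_and (hc _))
  | u_neg_and =>
    intro (h : IsUniv (v 0)) x y
    rw [fsat_iff, fsat_or]
    exact (h.tr_iff_clause (x := dNeg (dAnd x y)) (by simp [NotLim])).trans (clause_neg_and (hc _))
  | u_imp =>
    intro (h : IsUniv (v 0)) x y
    rw [fsat_iff, fsat_or]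
    exact (h.tr_iff_clause (x := dImp x y) (by simp [NotLim])).trans (clause_imp (hc _))
  | u_neg_imp =>
    intro (h : IsUniv (v 0)) x y
    rw [fsat_iff]
    exact (h.tr_iff_clause (x := dNeg (dImp x y)) (by simp [NotLim])).trans (clause_neg_imp (hc _))
  | u_all =>
    intro (h : IsUniv (v 0)) x
    rw [fsat_iff]
    exact (h.tr_iff_clause (x := dAll x) (by simp [NotLim])).trans (clause_all (hc _))
  | u_neg_all =>
    intro (h : IsUniv (v 0)) x
    rw [fsat_iff, fsat_ex]
    exact (h.tr_iff_clause (x := dNeg (dAll x)) (by simp [NotLim])).trans (clause_neg_all (hc _))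

theorem fsat_UG {A : FForm} (h : UG A) (v : ℕ → M.N) : M.fsat A v := by
  cases h with
  | ne c d hc hd h => exact fun h' => h (eqv_cst.1 h')
  | ne_app c d hc hd => exact eqv_cst_app (inert_dotted hd)
  | app_ne_app c d hc hd h =>
    exact fun h' => h ((eqv_app (inert_dotted hc) (inert_dotted hd)).1 h').1
  | app_inj c hc => exact fun h => ((eqv_app (inert_dotted hc) (inert_dotted hc)).1 h).2
  | l_ne c hc => exact eqv_lim_cst
  | l_ne_app c hc => exact eqv_lim_app (inert_dotted hc)
  | l_inj => exact eqv_lim.1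

/-- The semantic principle `propInd` applies since the set defined by `B` is definable in `M` and
invariant under `Eqv`. -/
theorem fsat_pi (B : FForm) (v : ℕ → M.N) :
    M.fsat (.imp (.all (.imp (propOp B) B)) (.all (.imp (.prop (.var 0)) B))) v := by
  intro h x hx
  rw [FForm.prop, fsat_or] at hx
  refine propInd (B := fun x => M.fsat B (scons x v))
    (fun x y hxy => (fsat_scons_congr B hxy v).1) (fun x hx => h x ?_) hx
  simp only [propOp, fsat_or, fsat_ex, fsat, fsat_at]
  rcases hx with ⟨y, z, h⟩ | ⟨y, h⟩ | ⟨y, h, h'⟩ | ⟨y, z, h, h'⟩ | ⟨y, z, h, h'⟩ | ⟨g, h, h'⟩ |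
    ⟨f, y, h, h'⟩
  · exact .inl ⟨y, z, h⟩
  · exact .inr (.inl ⟨y, h⟩)
  · exact .inr (.inr (.inl ⟨y, h, h'⟩))
  · exact .inr (.inr (.inr (.inl ⟨y, z, h, h'⟩)))
  · exact .inr (.inr (.inr (.inr (.inl ⟨y, z, h, h'⟩))))
  · exact .inr (.inr (.inr (.inr (.inr (.inl ⟨g, h, h'⟩)))))
  · exact .inr (.inr (.inr (.inr (.inr (.inr ⟨f, y, h, h'⟩)))))

/-- Every model of the theory of the inductive definition interprets the derivable formulas. -/
theorem fsat_of_fprov {A : FForm} (h : FProv KFUPI A) (v : ℕ → M.N) : M.fsat A v := by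
  induction h generalizing v with
  | ax h =>
    cases h with
    | ton h => exact fsat_TON h v
    | kfu h => exact fsat_KFUAx h v
    | ug h => exact fsat_UG h v
    | pi B => exact fsat_pi B v
  | mp _ _ ih₁ ih₂ => exact ih₁ v (ih₂ v)
  | gen _ ih => exact fun x => ih _
  | imp_k A B => exact fun h _ => h
  | imp_s A B C => exact fun h h' h'' => h h'' (h' h'')
  | contra A B => exact fun h h' => by_contra fun h'' => h h'' h'
  | and_left A B => exact And.left
  | and_right A B => exact And.right
  | and_intro A B => exact And.intro
  | all_elim A t =>
    intro h
    rw [fsat_at]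
    exact h _
  | all_distr A B =>
    intro h hA x
    refine h x ?_
    rw [FForm.shift, fsat_subst]
    exact hA
  | eq_refl t => exact Eqv.refl (M.feval v t)
  | eq_subst A s t =>
    intro h
    change M.fsat _ v → M.fsat _ v
    rw [fsat_at, fsat_at]
    exact (fsat_scons_congr A h _).1

end KModel

/-! ## The operator forms are positive and quantifier-free -/

theorem NTerm.VarsBelow.subst {n m : ℕ} {σ : ℕ → NTerm} (hσ : ∀ i < n, (σ i).VarsBelow m) :
    ∀ {t : NTerm}, t.VarsBelow n → (t.subst σ).VarsBelow m
  | .var i, h => hσ i h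
  | .fn _ _, h => fun i => NTerm.VarsBelow.subst hσ (h i)

theorem OpForm.FreeBelow.subst {A : OpForm} {n m : ℕ} {σ : ℕ → NTerm} (hA : A.FreeBelow n)
    (hσ : ∀ i < n, (σ i).VarsBelow m) : (A.subst σ).FreeBelow m := by
  induction A generalizing n m σ with
  | eq s t => exact ⟨hA.1.subst hσ, hA.2.subst hσ⟩
  | mem t => exact NTerm.VarsBelow.subst hσ hA
  | neg A ih => exact ih hA hσ
  | and A B ih₁ ih₂ => exact ⟨ih₁ hA.1 hσ, ih₂ hA.2 hσ⟩
  | imp A B ih₁ ih₂ => exact ⟨ih₁ hA.1 hσ, ih₂ hA.2 hσ⟩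
  | all A ih =>
    refine ih (n := n + 1) hA fun i hi => ?_
    cases i with
    | zero => exact Nat.succ_pos m
    | succ i =>
      exact NTerm.VarsBelow.subst (n := m) (m := m + 1) (σ := fun j => .var (j + 1))
        (fun j hj => Nat.succ_lt_succ hj) (hσ i (Nat.lt_of_succ_lt_succ hi))

theorem NTerm.VarsBelow.mono {n m : ℕ} (h : n ≤ m) : ∀ {t : NTerm}, t.VarsBelow n → t.VarsBelow m
  | .var _, ht => Nat.lt_of_lt_of_le ht h
  | .fn _ _, ht => fun i => NTerm.VarsBelow.mono h (ht i)

theorem OpForm.FreeBelow.mono {A : OpForm} {n m : ℕ} (hA : A.FreeBelow n) (h : n ≤ m) :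
    A.FreeBelow m := by
  induction A generalizing n m with
  | eq s t => exact ⟨hA.1.mono h, hA.2.mono h⟩
  | mem t => exact NTerm.VarsBelow.mono h hA
  | neg A ih => exact ih hA h
  | and A B ih₁ ih₂ => exact ⟨ih₁ hA.1 h, ih₂ hA.2 h⟩
  | imp A B ih₁ ih₂ => exact ⟨ih₁ hA.1 h, ih₂ hA.2 h⟩
  | all A ih => exact ih (n := n + 1) hA (Nat.succ_le_succ h)

/-- The set variable does not occur. -/
def OpForm.MemFree : OpForm → Prop
  | eq _ _ => True
  | mem _ => False
  | neg A => A.MemFree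
  | and A B => A.MemFree ∧ B.MemFree
  | imp A B => A.MemFree ∧ B.MemFree
  | all A => A.MemFree

theorem OpForm.MemFree.polarity {A : OpForm} (h : A.MemFree) (b : Bool) : A.Polarity b := by
  induction A generalizing b with
  | eq s t => trivial
  | mem t => exact h.elim
  | neg A ih => exact ih h _
  | and A B ih₁ ih₂ => exact ⟨ih₁ h.1 _, ih₂ h.2 _⟩
  | imp A B ih₁ ih₂ => exact ⟨ih₁ h.1 _, ih₂ h.2 _⟩
  | all A ih => exact ih h _

theorem OpForm.MemFree.subst {A : OpForm} (h : A.MemFree) (σ : ℕ → NTerm) :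
    (A.subst σ).MemFree := by
  induction A generalizing σ with
  | eq s t => trivial
  | mem t => exact h.elim
  | neg A ih => exact ih h _
  | and A B ih₁ ih₂ => exact ⟨ih₁ h.1 _, ih₂ h.2 _⟩
  | imp A B ih₁ ih₂ => exact ⟨ih₁ h.1 _, ih₂ h.2 _⟩
  | all A ih => exact ih h _

namespace NTerm
variable {n : ℕ} {r s t : NTerm}

theorem varsBelow_fn1 (f : PR 1) : (fn f ![s]).VarsBelow n ↔ s.VarsBelow n := by
  simp [VarsBelow]

theorem varsBelow_fn2 (f : PR 2) : (fn f ![s, t]).VarsBelow n ↔ s.VarsBelow n ∧ t.VarsBelow n := by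
  simp [VarsBelow, Fin.forall_fin_two]

theorem varsBelow_zero : zero.VarsBelow n := fun i => i.elim0

theorem varsBelow_numeral (k : ℕ) : (numeral k).VarsBelow n := by
  induction k with
  | zero => exact varsBelow_zero
  | succ k ih => exact (varsBelow_fn1 _).2 ih

theorem varsBelow_var {i : ℕ} : (var i).VarsBelow n ↔ i < n := Iff.rfl

end NTerm

namespace OpForm
open NTerm

variable {A : OpForm} {n : ℕ} {s t : NTerm}

theorem FreeBelow.inst1 (hA : A.FreeBelow 1) (hs : s.VarsBelow n) : (A.inst1 s).FreeBelow n := by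
  refine hA.subst fun i hi => ?_
  obtain rfl : i = 0 := by omega
  exact hs

theorem FreeBelow.inst2 (hA : A.FreeBelow 2) (hs : s.VarsBelow n) (ht : t.VarsBelow n) :
    (A.inst2 s t).FreeBelow n := by
  refine hA.subst fun i hi => ?_
  obtain rfl | rfl : i = 0 ∨ i = 1 := by omega
  exacts [hs, ht]

theorem freeBelow_contr : contr.FreeBelow 2 := by
  simp [contr, or, ex, ne, FreeBelow, NTerm.ap2, NTerm.ap, NTerm.tpair, NTerm.cst, NTerm.num,
    varsBelow_fn1, varsBelow_fn2, varsBelow_numeral, varsBelow_var]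

theorem memFree_contr : contr.MemFree := by
  simp [contr, or, ex, ne, MemFree]

theorem freeBelow_justified : justified.FreeBelow 3 := by
  have h : (contr.inst2 (src (var 2) (var 0)) (tgt (var 2) (var 0))).FreeBelow 3 := by
    apply freeBelow_contr.inst2 <;>
      simp [src, tgt, NTerm.left, NTerm.right, NTerm.nth, varsBelow_fn1, varsBelow_fn2,
        varsBelow_var]
  simp only [justified, or, ex, ne, lt, FreeBelow, h]
  simp [src, tgt, NTerm.left, NTerm.right, NTerm.nth,
    NTerm.sub, NTerm.ap, varsBelow_fn1, varsBelow_fn2, varsBelow_zero, varsBelow_var]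

theorem memFree_justified : justified.MemFree := by
  have h : (contr.inst2 (src (var 2) (var 0)) (tgt (var 2) (var 0))).MemFree :=
    memFree_contr.subst _
  simp [justified, or, ex, ne, lt, MemFree, h]

theorem freeBelow_red : red.FreeBelow 2 := by
  have h : justified.FreeBelow 5 := freeBelow_justified.mono (by omega)
  simp [red, ex, ne, lt, FreeBelow, h, NTerm.nth, NTerm.pair, NTerm.sub,
    varsBelow_fn2, varsBelow_zero, varsBelow_var]

theorem memFree_red : red.MemFree := by
  simp [red, ex, ne, lt, MemFree, memFree_justified]

theorem FreeBelow.eqv (hs : s.VarsBelow n) (ht : t.VarsBelow n) : (eqv s t).FreeBelow n := by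
  refine FreeBelow.inst2 (A := ex _) ?_ hs ht
  exact ⟨freeBelow_red.inst2 (by simp [varsBelow_var]) (by simp [varsBelow_var]),
    freeBelow_red.inst2 (by simp [varsBelow_var]) (by simp [varsBelow_var])⟩

theorem FreeBelow.isNat (ht : t.VarsBelow n) : (isNat t).FreeBelow n := by
  refine FreeBelow.inst1 (A := ex _) ?_ ht
  exact freeBelow_red.inst2 (by simp [varsBelow_var])
    (by simp [NTerm.num, varsBelow_fn1, varsBelow_var])

theorem memFree_eqv : (eqv s t).MemFree :=
  MemFree.subst (A := ex (and _ _)) ⟨memFree_red.subst _, memFree_red.subst _⟩ _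

theorem memFree_isNat : (isNat t).MemFree :=
  MemFree.subst (A := ex _) (memFree_red.subst _) _

/-- Equality and `N` of the term model also occur negated, but they do not contain the set variable
and thus have either polarity. -/
theorem isPOS_opA₀ : opA₀.IsPOS := by
  have h (n) {s t : NTerm} (hs : s.VarsBelow n) (ht : t.VarsBelow n) :
      (OpForm.eqv s t).FreeBelow n := .eqv hs ht
  have h' (n) {t : NTerm} (ht : t.VarsBelow n) : (OpForm.isNat t).FreeBelow n := .isNat ht
  have e (b) {s t : NTerm} : (OpForm.eqv s t).Polarity b := memFree_eqv.polarity b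
  have e' (b) {t : NTerm} : (OpForm.isNat t).Polarity b := memFree_isNat.polarity b
  constructor
  · simp [opA₀, or, ex, FreeBelow, h, h', NTerm.lim, NTerm.ap2, NTerm.ap, NTerm.dNeg, NTerm.zeroEq,
      NTerm.dAnd, NTerm.dImp, NTerm.dAll, NTerm.dEq, NTerm.dNat, NTerm.tpair, NTerm.cst,
      varsBelow_fn2, varsBelow_numeral, varsBelow_var]
  · simp [opA₀, or, ex, Polarity, e, e']

theorem isQF_opA₁ : opA₁.IsQF := by
  simp [IsQF, opA₁, limReady, or, FreeBelow, QuantifierFree, NTerm.lim, NTerm.ap2, NTerm.ap,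
    NTerm.dNeg, NTerm.zeroEq, NTerm.natZero, NTerm.dEq, NTerm.dNat, NTerm.tpair, NTerm.cst,
    NTerm.fnPart, NTerm.argPart, varsBelow_fn1, varsBelow_fn2, varsBelow_numeral, varsBelow_var]

end OpForm

theorem mainTheorem10 :
    OpForm.opA₀.IsPOS ∧ OpForm.opA₁.IsQF ∧
      ∀ A : FForm, FProv KFUPI A → KProv (FID OpForm.opA₀ OpForm.opA₁) A.star := by
  refine ⟨OpForm.isPOS_opA₀, OpForm.isQF_opA₁, fun A hA => KProv.of_models fun M hM v o => ?_⟩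
  -- Only models with an assignment have to be considered, so the ordinal sort has an element.
  have : Nonempty M.O := ⟨o 0⟩
  have := KModel.IsFID.of_models hM
  exact (KModel.sat_star A v o).2 (KModel.fsat_of_fprov hA v)
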